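/- **Conventions.** A 2-category is strict. For 2-categories $\mathcal B,\mathcal D$, $\mathrm{PsFun}(\mathcal B,\mathcal D)$ is the 2-category of pseudofunctors $\mathcal B\to\mathcal D$, pseudonatural transformations (with invertible constraints) and modifications. For a 2-category $\mathcal K$, a $\mathcal K$-category is a pair $(\mathcal B,E)$ of a 2-category and a 2-functor $E\colon\mathcal B\to\mathcal K$; a $\mathcal K$-functor $(\mathcal B,E)\to(\mathcal B',E')$ is a 2-functor $G$ with $E'G=E$; a $\mathcal K$-natural transformation $G\Rightarrow H$ is a pseudonatural transformation $\alpha$ with $E'*\alpha=1_E$; a $\mathcal K$-modification is a modification $\Gamma$ with $E'*\Gamma=1_{1_E}$. A $\mathcal K$-natural equivalence is a $\mathcal K$-natural transformation that has an inverse up to invertible $\mathcal K$-modifications. $\mathcal K$-functors $G\colon(\mathcal B,E)\to(\mathcal B',E')$ and $H\colon(\mathcal B',E')\to(\mathcal B,E)$ are *$\mathcal K$-quasi-inverses of each other* if there are $\mathcal K$-natural equivalences $1_{\mathcal B'}\Rightarrow GH$ and $HG\Rightarrow 1_{\mathcal B}$. **$n$-fold categories.** Let $\mathcal I$ be the category of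 the ordered sets $[0]=\{0\}$, $[1]=\{0,1\}$ and order-preserving maps. An $n$-fold category $\mathbb C$ ($n\ge 0$) is a presheaf of sets on $\mathcal I^n$ with, for every $1\le i\le n$ and $\alpha\in\{0,1\}^n$ with $\alpha_i=0$, a composition $\circ^i$ of elements of $\mathbb C(\alpha+\epsilon_i)$ that agree on their common $\alpha$-face, making $\mathbb C(\alpha),\mathbb C(\alpha+\epsilon_i)$ a category with identities given by the degeneracy, such that $\circ^i$ is compatible with the presheaf structure in the other directions and $\circ^i,\circ^j$ satisfy the interchange law for $i<j$. The elements of $\mathbb C(0)$, $\mathbb C(\epsilon_k)$, $\mathbb C(\epsilon_k+\epsilon_{k'})$, $\mathbb C(\epsilon_k+\epsilon_{k'}+\epsilon_{k''})$ are the objects (forming $\mathrm{Ob}(\mathbb C)$), the morphisms in direction $k$, the squares in directions $k<k'$, and the 3-cubes in directions $k<k'<k''$. A square $D$ has edges $j\colon X\to Y$, $i\colon Z\to W$ in direction $k$ and $q\colon X\to Z$, $p\colon Y\to W$ in direction $k'$. **The 2-category $\mathbf T\mathbb C$.** Its objects are the objects of $\mathbb C$; its morphisms are the paths of morphisms of $\mathbb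 C$ in arbitrary directions, composed by concatenation. An atomic transformation is one of $$\iota^k_X\colon 1_X\Rightarrow \mathrm{id}^k_X,\quad \theta^k_X\colon \mathrm{id}^k_X\Rightarrow 1_X,\quad \gamma_{h,h'}\colon (h)(h')\Rightarrow (hh'),\quad \delta_{h,h'}\colon (hh')\Rightarrow(h)(h'),\quad \sigma_D\colon (i)(q)\Rightarrow(p)(j)$$ concatenated with a path on each side; here $1_X$ is the empty path, $\mathrm{id}^k_X$ the identity in direction $k$, $h,h'$ are composable in one direction and $D$ is a square in directions $k<k'$. The 2-cells are the composable sequences of atomic transformations modulo the finest equivalence relations stable under composition and concatenation such that: disjoint transformations commute; $\theta^k$ is inverse to $\iota^k$ and $\delta$ to $\gamma$; inserting an identity in direction $k$ before or after a morphism $f$ of direction $k$ by $\iota^k$ equals splitting $f$ by $\delta$; $\gamma$ is associative; $\sigma$ of an identity square exchanges the cells $\iota$; $\sigma$ of a composite square in either direction is the pasting of the $\sigma$'s of the two squares, up to $\gamma$; for each 3-cube the two pastings of the $\sigma$'s of its faces are equal. **The 2-category $\mathbf{PsFun}(\mathbb C,\mathcal D)$**, for a 2-category $\mathcal D$. An object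 $F$ consists of a map $\mathrm{Ob}(\mathbb C)\to\mathrm{Ob}(\mathcal D)$; for each $k$ a pseudofunctor $F_k$ with this map on objects, to $\mathcal D$, from the category of objects and direction $k$ morphisms of $\mathbb C$; and for each square $D$ in directions $k<k'$ a 2-cell $F_D\colon F_k(i)F_{k'}(q)\Rightarrow F_{k'}(p)F_k(j)$ of $\mathcal D$, such that the $F_D$ are compatible, through the coherence constraints of the $F_k$, with identity squares and with composition of squares in both directions, and such that for each 3-cube the two pastings of the $F_D$ of its faces are equal. (Equivalently, it is a map of presheaves on $\mathcal I^n$ from $\mathbb C$ to the $n$-dimensional hypercubes with 2-cells in $\mathcal D$ with compatible pseudofunctors $F_k$.) A morphism $F\to G$ is a family $F(X)\to G(X)$, $X\in \mathrm{Ob}(\mathbb C)$, with, for each $k$, a pseudonatural transformation $F_k\to G_k$ with these components, compatible with $F_D$ and $G_D$ for every square $D$. A 2-cell is a family of 2-cells of $\mathcal D$ indexed by $\mathrm{Ob}(\mathbb C)$ which is a modification in every direction. **The functors.** Restriction to objects makes $\mathbf{PsFun}(\mathbb C,\mathcal D)$ and $\mathrm{PsFun}(\mathbf T\mathbb C,\mathcal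 D)$ into $\mathcal D^{\mathrm{Ob}(\mathbb C)}$-categories. * $\Psi\colon \mathrm{PsFun}(\mathbf T\mathbb C,\mathcal D)\to\mathbf{PsFun}(\mathbb C,\mathcal D)$ is restriction along the canonical map $\mathbb C\to\mathbf T\mathbb C$: $(\Psi H)(X)=H(X)$; $(\Psi H)_k(f)=H((f))$, with coherence constraints those of $H$ composed with $H(\theta^k_X)$ and $H(\delta)$; and $(\Psi H)_D$ is $H(\sigma_D)$ conjugated by the coherence constraints of $H$. On morphisms and 2-cells $\Psi$ restricts the components and constraints. * $\Phi\colon \mathbf{PsFun}(\mathbb C,\mathcal D)\to\mathrm{PsFun}(\mathbf T\mathbb C,\mathcal D)$ sends $F$ to the 2-functor with $(\Phi F)(X)=F(X)$ that maps a path to the composite of the images of its morphisms under the $F_k$, the cells $\iota,\theta,\gamma,\delta$ to the coherence constraints of the $F_k$ or their inverses, and $\sigma_D$ to $F_D$. On morphisms it keeps the components on objects and extends the constraints from morphisms of $\mathbb C$ to paths by pasting; on 2-cells it keeps the components. **Proposition.** Let $\mathbb C$ be an $n$-fold category and $\mathcal D$ a 2-category. The $\mathcal D^{\mathrm{Ob}(\mathbb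 C)}$-functors $$\Phi\colon \mathbf{PsFun}(\mathbb C,\mathcal D)\to\mathrm{PsFun}(\mathbf T\mathbb C,\mathcal D),\qquad \Psi\colon \mathrm{PsFun}(\mathbf T\mathbb C,\mathcal D)\to\mathbf{PsFun}(\mathbb C,\mathcal D)$$ are $\mathcal D^{\mathrm{Ob}(\mathbb C)}$-quasi-inverses of each other. -/

import Mathlib

open CategoryTheory Bicategory Opposite
open scoped Pseudofunctor.StrongTrans

universe t w v u

/-! ### The cube category and `n`-fold categories -/

/-- The objects `[0]` and `[1]` of the category `𝓘`. -/
def CubeI : Type := Fin 2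

/-- The integer `m` such that the object of `𝓘` is `[m] = {0, …, m}`. -/
def CubeI.dim (a : CubeI) : ℕ := Fin.val (n := 2) a

/-- Morphisms of `𝓘` are all order-preserving maps `[a] → [b]`. -/
instance : Category CubeI where
  Hom a b := Fin (a.dim + 1) →o Fin (b.dim + 1)
  id _ := OrderHom.id
  comp f g := g.comp f

/-- The category `𝓘ⁿ`. -/
abbrev Cube (n : ℕ) : Type := Fin n → CubeI

namespace Cube

variable {n : ℕ}

/-- The characteristic function `χ_S`. -/
def chi (S : Finset (Fin n)) : Cube n := fun i => if i ∈ S then (1 : Fin 2) else (0 : Fin 2)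

/-- The face map `α ⟶ β` all of whose missing coordinates are set to `0`. -/
def face₀ {α β : Cube n} (h : ∀ j, (α j).dim ≤ (β j).dim) : α ⟶ β := fun j =>
  show Fin ((α j).dim + 1) →o Fin ((β j).dim + 1) from
  { toFun := fun x => ⟨x.1, by have := h j; omega⟩
    monotone' := fun x y hxy => hxy }

/-- The face map `α ⟶ β` all of whose missing coordinates are set to `1`. -/
def face₁ {α β : Cube n} (h : ∀ j, (α j).dim ≤ (β j).dim) : α ⟶ β := fun j =>
  show Fin ((α j).dim + 1) →o Fin ((β j).dim + 1) from
  { toFun := fun x => ⟨x.1 + ((β j).dim - (α j).dim), by have := h j; omega⟩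
    monotone' := fun x y hxy => Nat.add_le_add_right (show x.1 ≤ y.1 from hxy) _ }

/-- The degeneracy map `β ⟶ α` collapsing the coordinates missing in `α`. -/
def degen {α β : Cube n} (_ : ∀ j, (α j).dim ≤ (β j).dim) : β ⟶ α := fun j =>
  show Fin ((β j).dim + 1) →o Fin ((α j).dim + 1) from
  { toFun := fun x => ⟨min x.1 (α j).dim, by omega⟩
    monotone' := fun x y hxy => min_le_min_right _ (show x.1 ≤ y.1 from hxy) }

/-- `α' = α + ε_i`. -/
structure Succ (i : Fin n) (α α' : Cube n) : Prop where
  zero : (α i).dim = 0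
  one : (α' i).dim = 1
  eq : ∀ j, j ≠ i → α j = α' j

theorem Succ.le {i : Fin n} {α α' : Cube n} (h : Succ i α α') (j : Fin n) :
    (α j).dim ≤ (α' j).dim := by
  by_cases hj : j = i
  · subst hj; simp [h.zero]
  · rw [h.eq j hj]

theorem chi_le {S T : Finset (Fin n)} (h : S ⊆ T) (j : Fin n) :
    (chi S j).dim ≤ (chi T j).dim := by
  unfold chi
  by_cases h1 : j ∈ S
  · simp [h1, h h1]
  · simp [h1, CubeI.dim]

theorem chi_succ {i : Fin n} {S T : Finset (Fin n)} (hi : i ∉ S) (hT : T = insert i S) :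
    Succ i (chi S) (chi T) where
  zero := by simp [chi, hi, CubeI.dim]
  one := by simp [chi, hT, CubeI.dim]
  eq j hj := by simp [chi, hT, hj]

end Cube

open Cube

/-- An `n`-fold category: a presheaf of sets on `𝓘ⁿ` with compositions `∘^i` in each direction.
`comp` is written in diagrammatic order. -/
structure NFoldCat (n : ℕ) where
  /-- The underlying presheaf. -/
  cell : (Cube n)ᵒᵖ ⥤ Type t
  /-- The composition in direction `i` of two `α'`-cells that agree on their common `α`-face. -/
  comp (i : Fin n) {α α' : Cube n} (h : Succ i α α') (x y : cell.obj (op α'))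
    (hxy : cell.map (face₁ h.le).op x = cell.map (face₀ h.le).op y) : cell.obj (op α')
  src_comp (i : Fin n) {α α' : Cube n} (h : Succ i α α') (x y : cell.obj (op α'))
    (hxy : cell.map (face₁ h.le).op x = cell.map (face₀ h.le).op y) :
    cell.map (face₀ h.le).op (comp i h x y hxy) = cell.map (face₀ h.le).op x
  tgt_comp (i : Fin n) {α α' : Cube n} (h : Succ i α α') (x y : cell.obj (op α'))
    (hxy : cell.map (face₁ h.le).op x = cell.map (face₀ h.le).op y) :
    cell.map (face₁ h.le).op (comp i h x y hxy) = cell.map (face₁ h.le).op y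
  id_comp (i : Fin n) {α α' : Cube n} (h : Succ i α α') (x : cell.obj (op α'))
    (hx : cell.map (face₁ h.le).op
        (cell.map (degen h.le).op (cell.map (face₀ h.le).op x)) =
      cell.map (face₀ h.le).op x) :
    comp i h (cell.map (degen h.le).op (cell.map (face₀ h.le).op x)) x hx = x
  comp_id (i : Fin n) {α α' : Cube n} (h : Succ i α α') (x : cell.obj (op α'))
    (hx : cell.map (face₁ h.le).op x = cell.map (face₀ h.le).op
        (cell.map (degen h.le).op (cell.map (face₁ h.le).op x))) :
    comp i h x (cell.map (degen h.le).op (cell.map (face₁ h.le).op x)) hx = x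
  assoc (i : Fin n) {α α' : Cube n} (h : Succ i α α') (x y z : cell.obj (op α'))
    (hxy : cell.map (face₁ h.le).op x = cell.map (face₀ h.le).op y)
    (hyz : cell.map (face₁ h.le).op y = cell.map (face₀ h.le).op z) :
    comp i h (comp i h x y hxy) z ((tgt_comp i h x y hxy).trans hyz) =
      comp i h x (comp i h y z hyz) (hxy.trans (src_comp i h y z hyz).symm)
  /-- Functoriality: `φ : β ⟶ α` is a morphism of `𝓘ⁿ` with `β_i = α_i = 0` and
  `φ' : β + ε_i ⟶ α + ε_i` is its extension by the identity in coordinate `i`. -/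
  map_comp (i : Fin n) {α α' β β' : Cube n} (hα : Succ i α α') (hβ : Succ i β β')
    (φ' : β' ⟶ α')
    (hφ : ∀ x : Fin ((β' i).dim + 1),
      (show Fin ((β' i).dim + 1) →o Fin ((α' i).dim + 1) from φ' i) x = x.1)
    (x y : cell.obj (op α'))
    (hxy : cell.map (face₁ hα.le).op x = cell.map (face₀ hα.le).op y)
    (hxy' : cell.map (face₁ hβ.le).op (cell.map φ'.op x) =
      cell.map (face₀ hβ.le).op (cell.map φ'.op y)) :
    cell.map φ'.op (comp i hα x y hxy) = comp i hβ (cell.map φ'.op x) (cell.map φ'.op y) hxy'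
  /-- The interchange law, for `α₁ = α + ε_i`, `α₂ = α + ε_j`, `α₁₂ = α + ε_i + ε_j`. -/
  interchange (i j : Fin n) (_ : i < j) {α α₁ α₂ α₁₂ : Cube n}
    (_ : Succ i α α₁) (_ : Succ j α α₂) (hi : Succ i α₂ α₁₂) (hj : Succ j α₁ α₁₂)
    (x y z w : cell.obj (op α₁₂))
    (hxy : cell.map (face₁ hi.le).op x = cell.map (face₀ hi.le).op y)
    (hzw : cell.map (face₁ hi.le).op z = cell.map (face₀ hi.le).op w)
    (hxz : cell.map (face₁ hj.le).op x = cell.map (face₀ hj.le).op z)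
    (hyw : cell.map (face₁ hj.le).op y = cell.map (face₀ hj.le).op w)
    (h₁ : cell.map (face₁ hj.le).op (comp i hi x y hxy) =
      cell.map (face₀ hj.le).op (comp i hi z w hzw))
    (h₂ : cell.map (face₁ hi.le).op (comp j hj x z hxz) =
      cell.map (face₀ hi.le).op (comp j hj y w hyw)) :
    comp j hj (comp i hi x y hxy) (comp i hi z w hzw) h₁ =
      comp i hi (comp j hj x z hxz) (comp j hj y w hyw) h₂

namespace NFoldCat

variable {n : ℕ} (C : NFoldCat.{t} n)

/-- The objects of `C`. -/
abbrev Obj : Type t := C.cell.obj (op (chi ∅))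

theorem edge_succ (k : Fin n) : Succ k (chi ∅) (chi {k}) := chi_succ (by simp) (by simp)

variable {C} in
/-- The morphisms `X ⟶ Y` of `C` in direction `k`, i.e. elements of `C(ε_k)` with source `X`
and target `Y`. -/
@[ext]
structure Edge (k : Fin n) (X Y : C.Obj) : Type t where
  cell : C.cell.obj (op (chi {k}))
  src : C.cell.map (face₀ (edge_succ k).le).op cell = X
  tgt : C.cell.map (face₁ (edge_succ k).le).op cell = Y

/-- The category `ι_k^* C` of objects and direction `k` morphisms of `C`. -/
def Line (_ : Fin n) : Type t := C.Obj

theorem face₀_degen {α β : Cube n} (h : ∀ j, (α j).dim ≤ (β j).dim) :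
    face₀ h ≫ degen h = 𝟙 α := by
  funext j
  apply OrderHom.ext
  funext x
  apply Fin.ext
  change min x.1 _ = x.1
  have := x.2
  omega

theorem face₁_degen {i : Fin n} {α β : Cube n} (h : Succ i α β) :
    face₁ h.le ≫ degen h.le = 𝟙 α := by
  funext j
  apply OrderHom.ext
  funext x
  apply Fin.ext
  change min (x.1 + _) _ = x.1
  have := x.2
  by_cases hj : j = i
  · subst hj
    have := h.zero
    omega
  · have : (α j).dim = (β j).dim := by rw [h.eq j hj]
    omega

theorem map_section {α β : Cube n} (s : α ⟶ β) (d : β ⟶ α) (h : s ≫ d = 𝟙 α)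
    (x : C.cell.obj (op α)) : C.cell.map s.op (C.cell.map d.op x) = x := by
  rw [← CategoryTheory.comp_apply, ← C.cell.map_comp, ← op_comp, h]; simp

variable {C} in
/-- The identity morphism of `X` in direction `k`. -/
def Edge.id (k : Fin n) (X : C.Obj) : Edge k X X where
  cell := C.cell.map (degen (edge_succ k).le).op X
  src := C.map_section _ _ (face₀_degen _) X
  tgt := C.map_section _ _ (face₁_degen (edge_succ k)) X

variable {C} in
/-- The composition of morphisms in direction `k` (diagrammatic order). -/
def Edge.comp {k : Fin n} {X Y Z : C.Obj} (f : Edge k X Y) (g : Edge k Y Z) : Edge k X Z where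
  cell := C.comp k (edge_succ k) f.cell g.cell (f.tgt.trans g.src.symm)
  src := (C.src_comp ..).trans f.src
  tgt := (C.tgt_comp ..).trans g.tgt

variable {C} in
theorem Edge.id_comp {k : Fin n} {X Y : C.Obj} (f : Edge k X Y) : (Edge.id k X).comp f = f := by
  obtain ⟨f, rfl, h⟩ := f
  exact Edge.ext (C.id_comp ..)

variable {C} in
theorem Edge.comp_id {k : Fin n} {X Y : C.Obj} (f : Edge k X Y) : f.comp (Edge.id k Y) = f := by
  obtain ⟨f, h, rfl⟩ := f
  exact Edge.ext (C.comp_id ..)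

variable {C} in
theorem Edge.assoc {k : Fin n} {X Y Z W : C.Obj} (f : Edge k X Y) (g : Edge k Y Z)
    (h : Edge k Z W) : (f.comp g).comp h = f.comp (g.comp h) :=
  Edge.ext (C.assoc ..)

instance (k : Fin n) : Category (C.Line k) where
  Hom X Y := Edge (C := C) k X Y
  id X := Edge.id k X
  comp f g := Edge.comp f g
  id_comp f := Edge.id_comp f
  comp_id f := Edge.comp_id f
  assoc f g h := Edge.assoc f g h

variable {C} in
/-- The squares of `C` in directions `k`, `k'` with prescribed boundary: elements of
`C(ε_k + ε_k')` with top edge `j`, bottom edge `i`, left edge `q` and right edge `p`. -/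
@[ext]
structure Sq {k k' : Fin n} {X Y Z W : C.Obj} (j : Edge k X Y) (i : Edge k Z W)
    (q : Edge k' X Z) (p : Edge k' Y W) : Type t where
  cell : C.cell.obj (op (chi {k, k'}))
  top : C.cell.map (face₀ (chi_le (S := {k}) (by simp))).op cell = j.cell
  bot : C.cell.map (face₁ (chi_le (S := {k}) (by simp))).op cell = i.cell
  left : C.cell.map (face₀ (chi_le (S := {k'}) (by simp))).op cell = q.cell
  right : C.cell.map (face₁ (chi_le (S := {k'}) (by simp))).op cell = p.cell

theorem sq_succ_left {k k' : Fin n} (h : k < k') : Succ k (chi {k'}) (chi {k, k'}) :=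
  chi_succ (by simpa using h.ne) rfl

theorem sq_succ_right {k k' : Fin n} (h : k < k') : Succ k' (chi {k}) (chi {k, k'}) :=
  chi_succ (by simpa using h.ne') (Finset.pair_comm k k')

/-- `D` is the identity square `s(f)` on the direction `k` morphism `f`. -/
def IsHId {k k' : Fin n} {X Y : C.Obj} {f : Edge k X Y}
    (D : Sq f f (Edge.id k' X) (Edge.id k' Y)) : Prop :=
  D.cell = C.cell.map (degen (chi_le (S := {k}) (by simp))).op f.cell

/-- `D` is the identity square `s(f)` on the direction `k'` morphism `f`. -/
def IsVId {k k' : Fin n} {X Y : C.Obj} {f : Edge k' X Y}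
    (D : Sq (Edge.id k X) (Edge.id k Y) f f) : Prop :=
  D.cell = C.cell.map (degen (chi_le (S := {k'}) (by simp))).op f.cell

/-- `D'' = D' ∘^k D`. -/
def IsHComp {k k' : Fin n} (h : k < k') {X₁ X₂ X₃ Y₁ Y₂ Y₃ : C.Obj}
    {j : Edge k X₁ X₂} {j' : Edge k X₂ X₃} {i : Edge k Y₁ Y₂} {i' : Edge k Y₂ Y₃}
    {p₁ : Edge k' X₁ Y₁} {p₂ : Edge k' X₂ Y₂} {p₃ : Edge k' X₃ Y₃}
    (D : Sq j i p₁ p₂) (D' : Sq j' i' p₂ p₃) (D'' : Sq (j.comp j') (i.comp i') p₁ p₃) : Prop :=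
  D''.cell = C.comp k (sq_succ_left h) D.cell D'.cell (D.right.trans D'.left.symm)

/-- `D'' = D' ∘^{k'} D`. -/
def IsVComp {k k' : Fin n} (h : k < k') {X₁ X₂ X₃ Y₁ Y₂ Y₃ : C.Obj}
    {p₁ : Edge k X₁ Y₁} {p₂ : Edge k X₂ Y₂} {p₃ : Edge k X₃ Y₃}
    {j : Edge k' X₁ X₂} {j' : Edge k' X₂ X₃} {i : Edge k' Y₁ Y₂} {i' : Edge k' Y₂ Y₃}
    (D : Sq p₁ p₂ j i) (D' : Sq p₂ p₃ j' i') (D'' : Sq p₁ p₃ (j.comp j') (i.comp i')) : Prop :=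
  D''.cell = C.comp k' (sq_succ_right h) D.cell D'.cell (D.bot.trans D'.top.symm)

/-- The six squares are the faces of an element of `C(ε_k + ε_k' + ε_k'')`: `K', K` are the faces
where the coordinate `k''` is `0`, `1`; `J', J` those where the coordinate `k'` is `0`, `1`;
`I', I` those where the coordinate `k` is `0`, `1`. -/
def IsCube {k k' k'' : Fin n} {X' Y' Z' W' X Y Z W : C.Obj}
    {b' : Edge k X' Y'} {a' : Edge k Z' W'} {b : Edge k X Y} {a : Edge k Z W}
    {q' : Edge k' X' Z'} {p' : Edge k' Y' W'} {q : Edge k' X Z} {p : Edge k' Y W}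
    {x : Edge k'' X' X} {y : Edge k'' Y' Y} {z : Edge k'' Z' Z} {w : Edge k'' W' W}
    (K' : Sq b' a' q' p') (K : Sq b a q p) (J' : Sq b' b x y) (J : Sq a' a z w)
    (I' : Sq q' q x z) (I : Sq p' p y w) : Prop :=
  ∃ c : C.cell.obj (op (chi {k, k', k''})),
    C.cell.map (face₀ (chi_le (S := {k, k'}) (by grind))).op c = K'.cell ∧
    C.cell.map (face₁ (chi_le (S := {k, k'}) (by grind))).op c = K.cell ∧
    C.cell.map (face₀ (chi_le (S := {k, k''}) (by grind))).op c = J'.cell ∧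
    C.cell.map (face₁ (chi_le (S := {k, k''}) (by grind))).op c = J.cell ∧
    C.cell.map (face₀ (chi_le (S := {k', k''}) (by grind))).op c = I'.cell ∧
    C.cell.map (face₁ (chi_le (S := {k', k''}) (by grind))).op c = I.cell

/-! ### The `2`-category `T C` generated by `C` -/

variable {C} in
/-- Paths of morphisms of `C` in arbitrary directions. -/
inductive TPath (X : C.Obj) : C.Obj → Type t
  | nil : TPath X X
  | cons {Y Z : C.Obj} {k : Fin n} (p : TPath X Y) (e : Edge k Y Z) : TPath X Z

namespace TPath

variable {C}

/-- Concatenation of paths. -/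
def comp {X Y Z : C.Obj} (p : TPath X Y) : TPath Y Z → TPath X Z
  | nil => p
  | cons q e => cons (comp p q) e

@[simp]
theorem comp_nil {X Y : C.Obj} (p : TPath X Y) : p.comp nil = p := rfl

@[simp]
theorem nil_comp {X Y : C.Obj} (p : TPath X Y) : nil.comp p = p := by
  induction p with
  | nil => rfl
  | cons p e ih => exact congrArg (cons · e) ih

@[simp]
theorem comp_assoc {X Y Z W : C.Obj} (p : TPath X Y) (q : TPath Y Z) (r : TPath Z W) :
    (p.comp q).comp r = p.comp (q.comp r) := by
  induction r with
  | nil => rfl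
  | cons r e ih => exact congrArg (cons · e) ih

end TPath

variable {C} in
/-- A path of length one. -/
abbrev Edge.path {k : Fin n} {X Y : C.Obj} (f : Edge k X Y) : TPath X Y := TPath.nil.cons f

/-- The atomic transformations `ι`, `θ`, `γ`, `δ`, `σ` between paths, before concatenation with
other paths on both sides. -/
inductive Basic : ∀ {X Y : C.Obj}, TPath X Y → TPath X Y → Type t
  | iota (k : Fin n) (X : C.Obj) : Basic (TPath.nil : TPath X X) (Edge.id k X).path
  | theta (k : Fin n) (X : C.Obj) : Basic (Edge.id k X).path (TPath.nil : TPath X X)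
  | gamma {k : Fin n} {X Y Z : C.Obj} (f : Edge k X Y) (g : Edge k Y Z) :
      Basic (f.path.comp g.path) (f.comp g).path
  | delta {k : Fin n} {X Y Z : C.Obj} (f : Edge k X Y) (g : Edge k Y Z) :
      Basic (f.comp g).path (f.path.comp g.path)
  | sigma {k k' : Fin n} (h : k < k') {X Y Z W : C.Obj} {j : Edge k X Y} {i : Edge k Z W}
      {q : Edge k' X Z} {p : Edge k' Y W} (D : Sq j i q p) :
      Basic (q.path.comp i.path) (j.path.comp p.path)

variable {C} in
/-- Atomic transformations `p ⇒ q`: a basic one `u ⇒ v` preceded by a path `f` and followed by a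
path `g`. -/
structure Atomic {X Y : C.Obj} (p q : TPath X Y) : Type t where
  {W Z : C.Obj}
  f : TPath X W
  {u v : TPath W Z}
  b : C.Basic u v
  g : TPath Z Y
  hp : p = (f.comp u).comp g
  hq : q = (f.comp v).comp g

variable {C} in
/-- Transformations: sequences of composable atomic transformations. -/
inductive Trafo {X Y : C.Obj} (p : TPath X Y) : TPath X Y → Type t
  | nil : Trafo p p
  | cons {q r : TPath X Y} : Trafo p q → Atomic q r → Trafo p r

namespace Trafo

variable {C}

/-- Composition of transformations (diagrammatic order). -/
def comp {X Y : C.Obj} {p q r : TPath X Y} (s : Trafo p q) : Trafo q r → Trafo p r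
  | nil => s
  | cons t a => cons (comp s t) a

/-- The transformation given by a basic one between paths `f` and `g`. -/
def whiskered {X W Z Y : C.Obj} (f : TPath X W) {u v : TPath W Z} (b : C.Basic u v)
    (g : TPath Z Y) : Trafo ((f.comp u).comp g) ((f.comp v).comp g) :=
  cons nil ⟨f, b, g, rfl, rfl⟩

/-- The transformation given by a basic one; here the source and the target are only required to
be equal to those of `b`. -/
def of {X Y : C.Obj} {p q u v : TPath X Y} (b : C.Basic u v)
    (hp : p = u := by rfl) (hq : q = v := by rfl) : Trafo p q :=
  cons nil ⟨.nil, b, .nil, by simp [hp], by simp [hq]⟩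

/-- Concatenation with a path on the source side. -/
def whiskerL {X Y Z : C.Obj} (h : TPath X Y) {p q : TPath Y Z} :
    Trafo p q → Trafo (h.comp p) (h.comp q)
  | nil => nil
  | cons t a => cons (whiskerL h t)
      ⟨h.comp a.f, a.b, a.g, (congrArg h.comp a.hp).trans (by simp),
        (congrArg h.comp a.hq).trans (by simp)⟩

/-- Concatenation with a path on the target side. -/
def whiskerR {X Y Z : C.Obj} {p q : TPath X Y} (t : Trafo p q) (h : TPath Y Z) :
    Trafo (p.comp h) (q.comp h) :=
  match t with
  | nil => nil
  | cons t a => cons (whiskerR t h)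
      ⟨a.f, a.b, a.g.comp h, (congrArg (·.comp h) a.hp).trans (by simp),
        (congrArg (·.comp h) a.hq).trans (by simp)⟩

end Trafo

open Trafo

variable {C} in
/-- The finest system of equivalence relations on transformations which is stable under composition
and concatenation and satisfies the listed relations. -/
inductive Rel : ∀ {X Y : C.Obj} {p q : TPath X Y}, Trafo p q → Trafo p q → Prop
  | refl {X Y : C.Obj} {p q : TPath X Y} (s : Trafo p q) : Rel s s
  | symm {X Y : C.Obj} {p q : TPath X Y} {s t : Trafo p q} : Rel s t → Rel t s
  | trans {X Y : C.Obj} {p q : TPath X Y} {s t r : Trafo p q} : Rel s t → Rel t r → Rel s r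
  | comp_left {X Y : C.Obj} {p q r : TPath X Y} (e : Trafo p q) {s t : Trafo q r} :
      Rel s t → Rel (e.comp s) (e.comp t)
  | comp_right {X Y : C.Obj} {p q r : TPath X Y} {s t : Trafo p q} (e : Trafo q r) :
      Rel s t → Rel (s.comp e) (t.comp e)
  | whiskerL {X Y Z : C.Obj} (h : TPath X Y) {p q : TPath Y Z} {s t : Trafo p q} :
      Rel s t → Rel (s.whiskerL h) (t.whiskerL h)
  | whiskerR {X Y Z : C.Obj} {p q : TPath X Y} {s t : Trafo p q} (h : TPath Y Z) :
      Rel s t → Rel (s.whiskerR h) (t.whiskerR h)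
  | exchange {X Y Z : C.Obj} {f f' : TPath X Y} {g g' : TPath Y Z}
      (s : Trafo f f') (t : Trafo g g') :
      Rel ((t.whiskerL f).comp (s.whiskerR g')) ((s.whiskerR g).comp (t.whiskerL f'))
  | iota_theta (k : Fin n) (X : C.Obj) :
      Rel ((of (.iota k X)).comp (of (.theta k X))) .nil
  | theta_iota (k : Fin n) (X : C.Obj) :
      Rel ((of (.theta k X)).comp (of (.iota k X))) .nil
  | iota_right {k : Fin n} {X Y : C.Obj} (f : Edge k X Y) :
      Rel (p := f.path) (q := (Edge.id k X).path.comp f.path)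
        (whiskered .nil (.iota k X) f.path)
        (of (.delta (Edge.id k X) f) (by rw [f.id_comp]))
  | iota_left {k : Fin n} {X Y : C.Obj} (f : Edge k X Y) :
      Rel (p := f.path) (q := f.path.comp (Edge.id k Y).path)
        (whiskered f.path (.iota k Y) .nil)
        (of (.delta f (Edge.id k Y)) (by rw [f.comp_id]))
  | gamma_delta {k : Fin n} {X Y Z : C.Obj} (f : Edge k X Y) (g : Edge k Y Z) :
      Rel ((of (.gamma f g)).comp (of (.delta f g))) .nil
  | delta_gamma {k : Fin n} {X Y Z : C.Obj} (f : Edge k X Y) (g : Edge k Y Z) :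
      Rel ((of (.delta f g)).comp (of (.gamma f g))) .nil
  | gamma_assoc {k : Fin n} {X Y Z W : C.Obj} (f : Edge k X Y) (g : Edge k Y Z) (h : Edge k Z W) :
      Rel (p := (f.path.comp g.path).comp h.path) (q := ((f.comp g).comp h).path)
        ((whiskered .nil (.gamma f g) h.path).comp (of (.gamma (f.comp g) h)))
        ((whiskered f.path (.gamma g h) .nil).comp (of (.gamma f (g.comp h)) rfl
          (by rw [Edge.assoc])))
  | sigma_hid {k k' : Fin n} (hk : k < k') {X Y : C.Obj} {f : Edge k X Y}
      (D : Sq f f (Edge.id k' X) (Edge.id k' Y)) (hD : C.IsHId D) :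
      Rel (p := f.path) (q := f.path.comp (Edge.id k' Y).path)
        (Trafo.comp (q := (Edge.id k' X).path.comp f.path)
          (whiskered .nil (.iota k' X) f.path) (of (.sigma hk D)))
        (whiskered f.path (.iota k' Y) .nil)
  | sigma_vid {k k' : Fin n} (hk : k < k') {X Y : C.Obj} {f : Edge k' X Y}
      (D : Sq (Edge.id k X) (Edge.id k Y) f f) (hD : C.IsVId D) :
      Rel (p := f.path) (q := (Edge.id k X).path.comp f.path)
        (Trafo.comp (q := f.path.comp (Edge.id k Y).path)
          (whiskered f.path (.iota k Y) .nil) (of (.sigma hk D)))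
        (whiskered .nil (.iota k X) f.path)
  | sigma_hcomp {k k' : Fin n} (hk : k < k') {X₁ X₂ X₃ Y₁ Y₂ Y₃ : C.Obj}
      {j : Edge k X₁ X₂} {j' : Edge k X₂ X₃} {i : Edge k Y₁ Y₂} {i' : Edge k Y₂ Y₃}
      {p₁ : Edge k' X₁ Y₁} {p₂ : Edge k' X₂ Y₂} {p₃ : Edge k' X₃ Y₃}
      (D : Sq j i p₁ p₂) (D' : Sq j' i' p₂ p₃) (D'' : Sq (j.comp j') (i.comp i') p₁ p₃)
      (hD : C.IsHComp hk D D' D'') :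
      Rel (p := (p₁.path.comp i.path).comp i'.path) (q := (j.comp j').path.comp p₃.path)
        ((whiskered .nil (.sigma hk D) i'.path).comp
          (Trafo.comp (q := (j.path.comp j'.path).comp p₃.path)
            (whiskered j.path (.sigma hk D') .nil)
            (whiskered .nil (.gamma j j') p₃.path)))
        (Trafo.comp (q := p₁.path.comp (i.comp i').path)
          (whiskered p₁.path (.gamma i i') .nil) (of (.sigma hk D'')))
  | sigma_vcomp {k k' : Fin n} (hk : k < k') {X₁ X₂ X₃ Y₁ Y₂ Y₃ : C.Obj}
      {p₁ : Edge k X₁ Y₁} {p₂ : Edge k X₂ Y₂} {p₃ : Edge k X₃ Y₃}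
      {j : Edge k' X₁ X₂} {j' : Edge k' X₂ X₃} {i : Edge k' Y₁ Y₂} {i' : Edge k' Y₂ Y₃}
      (D : Sq p₁ p₂ j i) (D' : Sq p₂ p₃ j' i') (D'' : Sq p₁ p₃ (j.comp j') (i.comp i'))
      (hD : C.IsVComp hk D D' D'') :
      Rel (p := (j.path.comp j'.path).comp p₃.path) (q := p₁.path.comp (i.comp i').path)
        (Trafo.comp (q := (j.path.comp p₂.path).comp i'.path)
          (whiskered j.path (.sigma hk D') .nil)
          (Trafo.comp (q := (p₁.path.comp i.path).comp i'.path)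
            (whiskered .nil (.sigma hk D) i'.path)
            (whiskered p₁.path (.gamma i i') .nil)))
        (Trafo.comp (q := (j.comp j').path.comp p₃.path)
          (whiskered .nil (.gamma j j') p₃.path) (of (.sigma hk D'')))
  | sigma_cube {k k' k'' : Fin n} (hk : k < k') (hk' : k' < k'') {X' Y' Z' W' X Y Z W : C.Obj}
      {b' : Edge k X' Y'} {a' : Edge k Z' W'} {b : Edge k X Y} {a : Edge k Z W}
      {q' : Edge k' X' Z'} {p' : Edge k' Y' W'} {q : Edge k' X Z} {p : Edge k' Y W}
      {x : Edge k'' X' X} {y : Edge k'' Y' Y} {z : Edge k'' Z' Z} {w : Edge k'' W' W}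
      (K' : Sq b' a' q' p') (K : Sq b a q p) (J' : Sq b' b x y) (J : Sq a' a z w)
      (I' : Sq q' q x z) (I : Sq p' p y w) (hc : C.IsCube K' K J' J I' I) :
      Rel (p := (x.path.comp q.path).comp a.path) (q := (b'.path.comp p'.path).comp w.path)
        (Trafo.comp (q := (x.path.comp b.path).comp p.path)
          (whiskered x.path (.sigma hk K) .nil)
          (Trafo.comp (q := (b'.path.comp y.path).comp p.path)
            (whiskered .nil (.sigma (hk.trans hk') J') p.path)
            (whiskered b'.path (.sigma hk' I) .nil)))
        (Trafo.comp (q := (q'.path.comp z.path).comp a.path)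
          (whiskered .nil (.sigma hk' I') a.path)
          (Trafo.comp (q := (q'.path.comp a'.path).comp w.path)
            (whiskered q'.path (.sigma (hk.trans hk') J) .nil)
            (whiskered .nil (.sigma hk K') w.path)))

namespace Trafo

variable {C}

theorem comp_assoc {X Y : C.Obj} {p q r s : TPath X Y} (a : Trafo p q) (b : Trafo q r)
    (c : Trafo r s) : (a.comp b).comp c = a.comp (b.comp c) := by
  induction c with
  | nil => rfl
  | cons c e ih => exact congrArg (cons · e) ih

theorem nil_comp {X Y : C.Obj} {p q : TPath X Y} (a : Trafo p q) : nil.comp a = a := by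
  induction a with
  | nil => rfl
  | cons c e ih => exact congrArg (cons · e) ih

theorem whiskerL_comp {X Y Z : C.Obj} (h : TPath X Y) {p q r : TPath Y Z}
    (a : Trafo p q) (b : Trafo q r) :
    (a.comp b).whiskerL h = (a.whiskerL h).comp (b.whiskerL h) := by
  induction b with
  | nil => rfl
  | cons c e ih => exact congrArg (cons · _) ih

theorem whiskerR_comp {X Y Z : C.Obj} {p q r : TPath X Y}
    (a : Trafo p q) (b : Trafo q r) (h : TPath Y Z) :
    (a.comp b).whiskerR h = (a.whiskerR h).comp (b.whiskerR h) := by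
  induction b with
  | nil => rfl
  | cons c e ih => exact congrArg (cons · _) ih

end Trafo

instance pathCategory (X Y : C.Obj) : Category (TPath X Y) where
  Hom p q := Quot (Rel (p := p) (q := q))
  id p := Quot.mk _ .nil
  comp := Quot.map₂ Trafo.comp (fun a _ _ h => .comp_left a h) (fun _ _ b h => .comp_right b h)
  id_comp := by rintro p q ⟨a⟩; exact congrArg (Quot.mk _) a.nil_comp
  comp_id := by rintro p q ⟨a⟩; rfl
  assoc := by rintro p q r s ⟨a⟩ ⟨b⟩ ⟨c⟩; exact congrArg (Quot.mk _) (comp_assoc a b c)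

variable {C} in
/-- The `2`-cell represented by a transformation. -/
def Trafo.cell {X Y : C.Obj} {p q : TPath X Y} (a : Trafo p q) : p ⟶ q := Quot.mk Rel a

variable {C} in
/-- The `2`-cell represented by an atomic transformation. -/
def Atomic.cell {X Y : C.Obj} {p q : TPath X Y} (a : Atomic p q) : p ⟶ q :=
  (Trafo.cons .nil a).cell

variable {C} in
theorem cell_cons {X Y : C.Obj} {p q r : TPath X Y} (s : Trafo p q) (a : Atomic q r) :
    (Trafo.cons s a).cell = s.cell ≫ a.cell := rfl

variable {C} in
theorem cell_comp {X Y : C.Obj} {p q r : TPath X Y} (s : Trafo p q) (t : Trafo q r) :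
    (s.comp t).cell = s.cell ≫ t.cell := rfl

variable {C} in
/-- Two composites of a `2`-cell with identities of paths agree as soon as they come from the same
atomic transformation. -/
theorem Atomic.cell_congr {X Y : C.Obj} {p q p' q' : TPath X Y} {W Z : C.Obj}
    {f f' : TPath X W} {u v : TPath W Z} (b : C.Basic u v) {g g' : TPath Z Y}
    (hp : p = (f.comp u).comp g) (hq : q = (f.comp v).comp g)
    (hp' : p' = (f'.comp u).comp g') (hq' : q' = (f'.comp v).comp g') (hf : f = f') (hg : g = g') :
    (Atomic.mk f b g hp hq).cell =
      eqToHom (by rw [hp, hp', hf, hg]) ≫ (Atomic.mk f' b g' hp' hq').cell ≫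
        eqToHom (by rw [hq, hq', hf, hg]) := by
  subst hf hg hp hq
  subst hp' hq'
  simp

variable {C} in
theorem cell_ind {X Y : C.Obj} {P : ∀ {p q : TPath X Y}, (p ⟶ q) → Prop}
    (hid : ∀ p : TPath X Y, P (𝟙 p))
    (hcons : ∀ {p q r : TPath X Y} (s : p ⟶ q) (a : Atomic q r), P s → P (s ≫ a.cell))
    {p q : TPath X Y} (s : p ⟶ q) : P s := by
  have key : ∀ {q : TPath X Y} (s : Trafo p q), P s.cell := fun s => by
    induction s with
    | nil => exact hid _
    | cons s a ih => exact hcons _ a ih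
  exact Quot.ind (fun s => key s) s

/-- The objects of the `2`-category generated by `C`. -/
structure T where
  of : C.Obj

instance : CategoryStruct (T C) where
  Hom X Y := TPath X.of Y.of
  id _ := TPath.nil
  comp p q := p.comp q

instance (X Y : T C) : Category (X ⟶ Y) := C.pathCategory X.of Y.of

variable {C} in
/-- Whiskering of `2`-cells on the source side. -/
def whiskL {X Y Z : C.Obj} (h : TPath X Y) {p q : TPath Y Z} (s : p ⟶ q) :
    h.comp p ⟶ h.comp q := Quot.map (Trafo.whiskerL h) (fun _ _ => .whiskerL h) s

variable {C} in
/-- Whiskering of `2`-cells on the target side. -/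
def whiskR {X Y Z : C.Obj} {p q : TPath X Y} (s : p ⟶ q) (h : TPath Y Z) :
    p.comp h ⟶ q.comp h := Quot.map (Trafo.whiskerR · h) (fun _ _ => .whiskerR h) s

variable {C} in
theorem whiskL_comp {X Y Z : C.Obj} (h : TPath X Y) {p q r : TPath Y Z} (s : p ⟶ q) (t : q ⟶ r) :
    whiskL h (s ≫ t) = whiskL h s ≫ whiskL h t := by
  obtain ⟨s⟩ := s
  obtain ⟨t⟩ := t
  exact congrArg (Quot.mk _) (whiskerL_comp h s t)

variable {C} in
theorem whiskR_comp {X Y Z : C.Obj} {p q r : TPath X Y} (s : p ⟶ q) (t : q ⟶ r) (h : TPath Y Z) :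
    whiskR (s ≫ t) h = whiskR s h ≫ whiskR t h := by
  obtain ⟨s⟩ := s
  obtain ⟨t⟩ := t
  exact congrArg (Quot.mk _) (whiskerR_comp s t h)

variable {C} in
theorem whiskL_id {X Y Z : C.Obj} (h : TPath X Y) (p : TPath Y Z) :
    whiskL h (𝟙 p) = 𝟙 _ := rfl

variable {C} in
theorem whiskR_id {X Y Z : C.Obj} (p : TPath X Y) (h : TPath Y Z) :
    whiskR (𝟙 p) h = 𝟙 _ := rfl

variable {C} in
theorem whiskL_eqToHom {X Y Z : C.Obj} (h : TPath X Y) {p q : TPath Y Z} (e : p = q) :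
    whiskL h (eqToHom e) = eqToHom (by rw [e]) := by
  subst e; rfl

variable {C} in
theorem whiskR_eqToHom {X Y Z : C.Obj} {p q : TPath X Y} (e : p = q) (h : TPath Y Z) :
    whiskR (eqToHom e) h = eqToHom (by rw [e]) := by
  subst e; rfl

variable {C} in
theorem nil_whiskL {X Y : C.Obj} {p q : TPath X Y} (s : p ⟶ q) :
    whiskL .nil s = eqToHom (by simp) ≫ s ≫ eqToHom (by simp) := by
  induction s using cell_ind with
  | hid p => simp [whiskL_id]
  | hcons s a ih =>
    rw [whiskL_comp, ih]
    have : whiskL .nil a.cell = eqToHom (by simp) ≫ a.cell ≫ eqToHom (by simp) :=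
      Atomic.cell_congr a.b _ _ a.hp a.hq (by simp) rfl
    rw [this]; simp

variable {C} in
theorem whiskR_nil {X Y : C.Obj} {p q : TPath X Y} (s : p ⟶ q) :
    whiskR s .nil = s := by
  induction s using cell_ind with
  | hid p => rfl
  | hcons s a ih => rw [whiskR_comp, ih]; rfl

variable {C} in
theorem comp_whiskL {X Y Z W : C.Obj} (f : TPath X Y) (g : TPath Y Z) {p q : TPath Z W}
    (s : p ⟶ q) :
    whiskL (f.comp g) s = eqToHom (by simp) ≫ whiskL f (whiskL g s) ≫ eqToHom (by simp) := by
  induction s using cell_ind with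
  | hid p => simp [whiskL_id]
  | hcons s a ih =>
    rw [whiskL_comp, whiskL_comp, whiskL_comp, ih]
    have : whiskL (f.comp g) a.cell =
        eqToHom (by simp) ≫ whiskL f (whiskL g a.cell) ≫ eqToHom (by simp) :=
      Atomic.cell_congr a.b _ _ _ _ (by simp) rfl
    rw [this]; simp

variable {C} in
theorem whiskR_comp_path {X Y Z W : C.Obj} {p q : TPath X Y} (s : p ⟶ q) (f : TPath Y Z)
    (g : TPath Z W) :
    whiskR s (f.comp g) = eqToHom (by simp) ≫ whiskR (whiskR s f) g ≫ eqToHom (by simp) := by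
  induction s using cell_ind with
  | hid p => simp [whiskR_id]
  | hcons s a ih =>
    rw [whiskR_comp, whiskR_comp, whiskR_comp, ih]
    have : whiskR a.cell (f.comp g) =
        eqToHom (by simp) ≫ whiskR (whiskR a.cell f) g ≫ eqToHom (by simp) :=
      Atomic.cell_congr a.b _ _ _ _ rfl (by simp)
    rw [this]; simp

variable {C} in
theorem whisk_assoc {X Y Z W : C.Obj} (f : TPath X Y) {p q : TPath Y Z} (s : p ⟶ q)
    (g : TPath Z W) :
    whiskR (whiskL f s) g = eqToHom (by simp) ≫ whiskL f (whiskR s g) ≫ eqToHom (by simp) := by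
  induction s using cell_ind with
  | hid p => simp [whiskL_id, whiskR_id]
  | hcons s a ih =>
    rw [whiskR_comp, whiskL_comp, whiskR_comp, whiskL_comp, ih]
    have : whiskR (whiskL f a.cell) g =
        eqToHom (by simp) ≫ whiskL f (whiskR a.cell g) ≫ eqToHom (by simp) :=
      Atomic.cell_congr a.b _ _ _ _ rfl rfl
    rw [this]; simp

variable {C} in
theorem pentagon_path {X Y Z W V : C.Obj} (f : TPath X Y) (g : TPath Y Z) (h : TPath Z W)
    (i : TPath W V) :
    whiskR (eqToHom (TPath.comp_assoc f g h)) i ≫ eqToHom (TPath.comp_assoc f (g.comp h) i) ≫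
      whiskL f (eqToHom (TPath.comp_assoc g h i)) =
    eqToHom (TPath.comp_assoc (f.comp g) h i) ≫ eqToHom (TPath.comp_assoc f g (h.comp i)) := by
  rw [whiskR_eqToHom, whiskL_eqToHom]; simp

variable {C} in
theorem triangle_path {X Y Z : C.Obj} (f : TPath X Y) (g : TPath Y Z) :
    eqToHom (TPath.comp_assoc f .nil g) ≫ whiskL f (eqToHom (TPath.nil_comp g)) =
      whiskR (eqToHom (TPath.comp_nil f)) g := by
  rw [whiskR_eqToHom, whiskL_eqToHom]; exact eqToHom_trans _ _

instance : Bicategory (T C) where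
  whiskerLeft f _ _ s := whiskL f s
  whiskerRight s h := whiskR s h
  associator p q r := eqToIso (TPath.comp_assoc p q r)
  leftUnitor p := eqToIso (TPath.nil_comp p)
  rightUnitor p := eqToIso (TPath.comp_nil p)
  whiskerLeft_id f g := whiskL_id f g
  whiskerLeft_comp f _ _ _ s t := whiskL_comp f s t
  id_whiskerLeft s := nil_whiskL s
  comp_whiskerLeft f g _ _ s := comp_whiskL f g s
  id_whiskerRight f g := whiskR_id f g
  comp_whiskerRight s t h := whiskR_comp s t h
  whiskerRight_id s := (whiskR_nil s).trans (by
    simp only [eqToIso]; exact ((Category.id_comp _).trans (Category.comp_id _)).symm)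
  whiskerRight_comp s f g := whiskR_comp_path s f g
  whisker_assoc f _ _ s g := whisk_assoc f s g
  whisker_exchange := by
    rintro X Y Z p q r s ⟨a⟩ ⟨b⟩
    exact Quot.sound (.exchange a b)
  pentagon f g h i := pentagon_path f g h i
  triangle f g := triangle_path f g

instance : Bicategory.Strict (T C) where
  id_comp p := TPath.nil_comp p
  comp_id p := TPath.comp_nil p
  assoc p q r := TPath.comp_assoc p q r
  leftUnitor_eqToIso _ := rfl
  rightUnitor_eqToIso _ := rfl
  associator_eqToIso _ _ _ := rfl

end NFoldCat

/-! ### The `2`-category `D^S` -/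

/-- The objects of the `2`-category `D^S`. -/
structure PowCat (S : Type t) (D : Type u) where
  obj : S → D

namespace PowCat

variable (S : Type t) (D : Type u) [Bicategory.{w, v} D]

variable {S D}

/-- Morphisms of `D^S`. -/
@[ext]
structure Hom (F G : PowCat S D) where
  app (X : S) : F.obj X ⟶ G.obj X

instance : CategoryStruct (PowCat S D) where
  Hom := Hom
  id F := ⟨fun X => 𝟙 (F.obj X)⟩
  comp f g := ⟨fun X => f.app X ≫ g.app X⟩

/-- `2`-cells of `D^S`. -/
@[ext]
structure Cell {F G : PowCat S D} (f g : F ⟶ G) where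
  app (X : S) : f.app X ⟶ g.app X

instance (F G : PowCat S D) : Category (F ⟶ G) where
  Hom := Cell
  id f := ⟨fun X => 𝟙 (f.app X)⟩
  comp a b := ⟨fun X => a.app X ≫ b.app X⟩
  id_comp _ := Cell.ext (funext fun _ => Category.id_comp _)
  comp_id _ := Cell.ext (funext fun _ => Category.comp_id _)
  assoc _ _ _ := Cell.ext (funext fun _ => Category.assoc _ _ _)

theorem hom_ext {F G : PowCat S D} {f g : F ⟶ G} {a b : f ⟶ g} (h : ∀ X, a.app X = b.app X) :
    a = b :=
  Cell.ext (funext h)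

/-- Isomorphisms of `D^S` from isomorphisms in `D`. -/
def mkIso {F G : PowCat S D} {f g : F ⟶ G} (e : ∀ X, f.app X ≅ g.app X) : f ≅ g where
  hom := ⟨fun X => (e X).hom⟩
  inv := ⟨fun X => (e X).inv⟩
  hom_inv_id := hom_ext fun X => (e X).hom_inv_id
  inv_hom_id := hom_ext fun X => (e X).inv_hom_id

/-- Whiskering in `D^S`. -/
def whiskL {F G H : PowCat S D} (f : F ⟶ G) {g h : G ⟶ H} (a : g ⟶ h) : f ≫ g ⟶ f ≫ h :=
  ⟨fun X => f.app X ◁ a.app X⟩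

/-- Whiskering in `D^S`. -/
def whiskR {F G H : PowCat S D} {f g : F ⟶ G} (a : f ⟶ g) (h : G ⟶ H) : f ≫ h ⟶ g ≫ h :=
  ⟨fun X => a.app X ▷ h.app X⟩

instance : Bicategory (PowCat S D) where
  whiskerLeft f _ _ a := whiskL f a
  whiskerRight a f := whiskR a f
  associator f g h := mkIso fun X => α_ (f.app X) (g.app X) (h.app X)
  leftUnitor f := mkIso fun X => λ_ (f.app X)
  rightUnitor f := mkIso fun X => ρ_ (f.app X)
  whiskerLeft_id _ _ := hom_ext fun _ => whiskerLeft_id _ _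
  whiskerLeft_comp _ _ _ _ _ _ := hom_ext fun _ => whiskerLeft_comp _ _ _
  id_whiskerLeft _ := hom_ext fun _ => id_whiskerLeft _
  comp_whiskerLeft _ _ _ _ _ := hom_ext fun _ => comp_whiskerLeft _ _ _
  id_whiskerRight _ _ := hom_ext fun _ => id_whiskerRight _ _
  comp_whiskerRight _ _ _ := hom_ext fun _ => comp_whiskerRight _ _ _
  whiskerRight_id _ := hom_ext fun _ => whiskerRight_id _
  whiskerRight_comp _ _ _ := hom_ext fun _ => whiskerRight_comp _ _ _
  whisker_assoc _ _ _ _ _ := hom_ext fun _ => whisker_assoc _ _ _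
  whisker_exchange _ _ := hom_ext fun _ => whisker_exchange _ _
  pentagon _ _ _ _ := hom_ext fun _ => Bicategory.pentagon _ _ _ _
  triangle _ _ := hom_ext fun _ => Bicategory.triangle _ _

theorem eqToHom_app {F G : PowCat S D} {f g : F ⟶ G} (h : f = g) (X : S) :
    (eqToHom h : f ⟶ g).app X = eqToHom (by rw [h]) := by
  subst h; rfl

theorem eq_conj {F G : PowCat S D} {f f' g g' : F ⟶ G} (h : f = g) (h' : g' = f') (a : f ⟶ f')
    (b : g ⟶ g')
    (hab : ∀ X, a.app X = eqToHom (by rw [h]) ≫ b.app X ≫ eqToHom (by rw [h'])) :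
    a = eqToHom h ≫ b ≫ eqToHom h' := by
  subst h h'
  exact (hom_ext fun X => by simpa using hab X).trans
    ((Category.id_comp _).trans (Category.comp_id b)).symm

theorem iso_ext_eqToIso {F G : PowCat S D} {f g : F ⟶ G} (e : ∀ X, f.app X ≅ g.app X) (h : f = g)
    (he : ∀ X, e X = eqToIso (by rw [h])) : mkIso e = eqToIso h := by
  subst h
  exact Iso.ext (hom_ext fun X => congrArg Iso.hom (he X))

instance [Bicategory.Strict D] : Bicategory.Strict (PowCat S D) where
  id_comp f := Hom.ext (funext fun X => Bicategory.Strict.id_comp (Hom.app f X))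
  comp_id f := Hom.ext (funext fun X => Bicategory.Strict.comp_id (Hom.app f X))
  assoc f g h := Hom.ext (funext fun X =>
    Bicategory.Strict.assoc (Hom.app f X) (Hom.app g X) (Hom.app h X))
  leftUnitor_eqToIso f := iso_ext_eqToIso _ _ fun X =>
    Bicategory.Strict.leftUnitor_eqToIso (Hom.app f X)
  rightUnitor_eqToIso f := iso_ext_eqToIso _ _ fun X =>
    Bicategory.Strict.rightUnitor_eqToIso (Hom.app f X)
  associator_eqToIso f g h := iso_ext_eqToIso _ _ fun X =>
    Bicategory.Strict.associator_eqToIso (Hom.app f X) (Hom.app g X) (Hom.app h X)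

end PowCat

/-! ### Pseudofunctors from an `n`-fold category to a `2`-category -/

/-- Pseudofunctors from a category `E` to a `2`-category `D` with prescribed map `o` on objects. -/
structure PsFunOn (E : Type t) [Category.{t} E] (D : Type u) [Bicategory.{w, v} D] (o : E → D) where
  map {X Y : E} (f : X ⟶ Y) : o X ⟶ o Y
  mapId (X : E) : map (𝟙 X) ≅ 𝟙 (o X)
  mapComp {X Y Z : E} (f : X ⟶ Y) (g : Y ⟶ Z) : map (f ≫ g) ≅ map f ≫ map g
  map_assoc {X Y Z W : E} (f : X ⟶ Y) (g : Y ⟶ Z) (h : Z ⟶ W) :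
    (mapComp (f ≫ g) h).hom ≫ (mapComp f g).hom ▷ map h ≫ (α_ (map f) (map g) (map h)).hom ≫
      map f ◁ (mapComp g h).inv ≫ (mapComp f (g ≫ h)).inv =
    eqToHom (by rw [Category.assoc])
  map_id_comp {X Y : E} (f : X ⟶ Y) :
    (mapComp (𝟙 X) f).hom ≫ (mapId X).hom ▷ map f ≫ (λ_ (map f)).hom =
      eqToHom (by rw [Category.id_comp])
  map_comp_id {X Y : E} (f : X ⟶ Y) :
    (mapComp f (𝟙 Y)).hom ≫ map f ◁ (mapId Y).hom ≫ (ρ_ (map f)).hom =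
      eqToHom (by rw [Category.comp_id])

/-- The underlying pseudofunctor. -/
def PsFunOn.toPseudofunctor {E : Type t} [Category.{t} E] {D : Type u} [Bicategory.{w, v} D]
    {o : E → D} (F : PsFunOn E D o) : LocallyDiscrete E ⥤ᵖ D :=
  LocallyDiscrete.mkPseudofunctor o F.map F.mapId F.mapComp F.map_assoc F.map_id_comp F.map_comp_id

open NFoldCat
open scoped Pseudofunctor.StrongTrans

/-- The objects of the `2`-category of pseudofunctors from an `n`-fold category `C` to a
`2`-category `D`. A family of maps from the cubes of `C` to the cubes in `D` which is compatible
with faces amounts to the maps on objects (`obj`), on edges (part of `line`) and on squares (`sq`,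
the `2`-cell `G_D`), such that the hexagons of `2`-cells coming from the `3`-dimensional cubes
commute (`cube`): the `2`-functor on a higher dimensional cube is determined by its vertices,
edges and faces. -/
structure MixedPsFun {n : ℕ} (C : NFoldCat.{t} n) (D : Type u) [Bicategory.{w, v} D] where
  obj : C.Obj → D
  line (k : Fin n) : PsFunOn (C.Line k) D obj
  sq {k k' : Fin n} (h : k < k') {X Y Z W : C.Obj} {j : Edge k X Y} {i : Edge k Z W}
    {q : Edge k' X Z} {p : Edge k' Y W} (S : Sq j i q p) :
    (line k').map q ≫ (line k).map i ⟶ (line k).map j ≫ (line k').map p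
  sq_hid {k k' : Fin n} (h : k < k') {X Y : C.Obj} {f : Edge k X Y}
    (S : Sq f f (Edge.id k' X) (Edge.id k' Y)) (_ : C.IsHId S) :
    sq h S ≫ (line k).map f ◁ ((line k').mapId Y).hom ≫ (ρ_ _).hom =
      ((line k').mapId X).hom ▷ (line k).map f ≫ (λ_ _).hom
  sq_vid {k k' : Fin n} (h : k < k') {X Y : C.Obj} {f : Edge k' X Y}
    (S : Sq (Edge.id k X) (Edge.id k Y) f f) (_ : C.IsVId S) :
    sq h S ≫ ((line k).mapId X).hom ▷ (line k').map f ≫ (λ_ _).hom =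
      (line k').map f ◁ ((line k).mapId Y).hom ≫ (ρ_ _).hom
  sq_hcomp {k k' : Fin n} (h : k < k') {X₁ X₂ X₃ Y₁ Y₂ Y₃ : C.Obj}
    {j : Edge k X₁ X₂} {j' : Edge k X₂ X₃} {i : Edge k Y₁ Y₂} {i' : Edge k Y₂ Y₃}
    {p₁ : Edge k' X₁ Y₁} {p₂ : Edge k' X₂ Y₂} {p₃ : Edge k' X₃ Y₃}
    (S : Sq j i p₁ p₂) (S' : Sq j' i' p₂ p₃) (S'' : Sq (j.comp j') (i.comp i') p₁ p₃)
    (_ : C.IsHComp h S S' S'') :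
    (line k').map p₁ ◁ ((line k).mapComp i i').hom ≫ (α_ _ _ _).inv ≫
        sq h S ▷ (line k).map i' ≫ (α_ _ _ _).hom ≫ (line k).map j ◁ sq h S' ≫ (α_ _ _ _).inv =
      sq h S'' ≫ ((line k).mapComp j j').hom ▷ (line k').map p₃
  sq_vcomp {k k' : Fin n} (h : k < k') {X₁ X₂ X₃ Y₁ Y₂ Y₃ : C.Obj}
    {p₁ : Edge k X₁ Y₁} {p₂ : Edge k X₂ Y₂} {p₃ : Edge k X₃ Y₃}
    {j : Edge k' X₁ X₂} {j' : Edge k' X₂ X₃} {i : Edge k' Y₁ Y₂} {i' : Edge k' Y₂ Y₃}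
    (S : Sq p₁ p₂ j i) (S' : Sq p₂ p₃ j' i') (S'' : Sq p₁ p₃ (j.comp j') (i.comp i'))
    (_ : C.IsVComp h S S' S'') :
    ((line k').mapComp j j').hom ▷ (line k).map p₃ ≫ (α_ _ _ _).hom ≫
        (line k').map j ◁ sq h S' ≫ (α_ _ _ _).inv ≫ sq h S ▷ (line k').map i' ≫ (α_ _ _ _).hom =
      sq h S'' ≫ (line k).map p₁ ◁ ((line k').mapComp i i').hom
  cube {k k' k'' : Fin n} (h : k < k') (h' : k' < k'') {X' Y' Z' W' X Y Z W : C.Obj}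
    {b' : Edge k X' Y'} {a' : Edge k Z' W'} {b : Edge k X Y} {a : Edge k Z W}
    {q' : Edge k' X' Z'} {p' : Edge k' Y' W'} {q : Edge k' X Z} {p : Edge k' Y W}
    {x : Edge k'' X' X} {y : Edge k'' Y' Y} {z : Edge k'' Z' Z} {w : Edge k'' W' W}
    (K' : Sq b' a' q' p') (K : Sq b a q p) (J' : Sq b' b x y) (J : Sq a' a z w)
    (I' : Sq q' q x z) (I : Sq p' p y w) (_ : C.IsCube K' K J' J I' I) :
    (line k'').map x ◁ sq h K ≫ (α_ _ _ _).inv ≫ sq (h.trans h') J' ▷ (line k').map p ≫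
        (α_ _ _ _).hom ≫ (line k).map b' ◁ sq h' I =
      (α_ _ _ _).inv ≫ sq h' I' ▷ (line k).map a ≫ (α_ _ _ _).hom ≫
        (line k').map q' ◁ sq (h.trans h') J ≫ (α_ _ _ _).inv ≫
        sq h K' ▷ (line k'').map w ≫ (α_ _ _ _).hom

namespace MixedPsFun

variable {n : ℕ} {C : NFoldCat.{t} n} {D : Type u} [Bicategory.{w, v} D]

/-- Morphisms of pseudofunctors: a pseudonatural transformation in each direction, all with the
same components on objects, compatible with the squares of `C`. -/
structure Mor (F G : MixedPsFun C D) where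
  app (X : C.Obj) : F.obj X ⟶ G.obj X
  nat {k : Fin n} {X Y : C.Obj} (f : Edge k X Y) :
    (F.line k).map f ≫ app Y ≅ app X ≫ (G.line k).map f
  nat_id (k : Fin n) (X : C.Obj) :
    (nat (Edge.id k X)).hom ≫ app X ◁ ((G.line k).mapId X).hom =
      ((F.line k).mapId X).hom ▷ app X ≫ (λ_ (app X)).hom ≫ (ρ_ (app X)).inv
  nat_comp {k : Fin n} {X Y Z : C.Obj} (f : Edge k X Y) (g : Edge k Y Z) :
    (nat (f.comp g)).hom ≫ app X ◁ ((G.line k).mapComp f g).hom =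
      ((F.line k).mapComp f g).hom ▷ app Z ≫ (α_ _ _ _).hom ≫ (F.line k).map f ◁ (nat g).hom ≫
        (α_ _ _ _).inv ≫ (nat f).hom ▷ (G.line k).map g ≫ (α_ _ _ _).hom
  nat_sq {k k' : Fin n} (h : k < k') {X Y Z W : C.Obj} {j : Edge k X Y} {i : Edge k Z W}
    {q : Edge k' X Z} {p : Edge k' Y W} (S : Sq j i q p) :
    F.sq h S ▷ app W ≫ (α_ _ _ _).hom ≫ (F.line k).map j ◁ (nat p).hom ≫ (α_ _ _ _).inv ≫
        (nat j).hom ▷ (G.line k').map p ≫ (α_ _ _ _).hom =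
      (α_ _ _ _).hom ≫ (F.line k').map q ◁ (nat i).hom ≫ (α_ _ _ _).inv ≫
        (nat q).hom ▷ (G.line k).map i ≫ (α_ _ _ _).hom ≫ app X ◁ G.sq h S

/-- The pseudonatural transformation underlying a morphism in direction `k`. -/
def Mor.line {F G : MixedPsFun C D} (μ : Mor F G) (k : Fin n) :
    (F.line k).toPseudofunctor ⟶ (G.line k).toPseudofunctor where
  app X := μ.app X.as
  naturality f := μ.nat f.as
  naturality_naturality {a b f g} η := by
    obtain rfl := LocallyDiscrete.eq_of_hom η
    obtain rfl := Subsingleton.elim η (𝟙 f)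
    rw [PrelaxFunctor.map₂_id, PrelaxFunctor.map₂_id]
    exact (congrArg (· ≫ _) (id_whiskerRight _ _)).trans ((Category.id_comp _).trans
      ((Category.comp_id _).symm.trans (congrArg (_ ≫ ·) (whiskerLeft_id _ _).symm)))
  naturality_id X := μ.nat_id k X.as
  naturality_comp f g := μ.nat_comp f.as g.as

/-- `2`-cells of pseudofunctors: families of `2`-cells of `D` which are modifications in each
direction. -/
@[ext]
structure Modif {F G : MixedPsFun C D} (μ ν : Mor F G) where
  app (X : C.Obj) : μ.app X ⟶ ν.app X
  nat {k : Fin n} {X Y : C.Obj} (f : Edge k X Y) :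
    (F.line k).map f ◁ app Y ≫ (ν.nat f).hom = (μ.nat f).hom ≫ app X ▷ (G.line k).map f

/-- The modification underlying a `2`-cell in direction `k`. -/
def Modif.line {F G : MixedPsFun C D} {μ ν : Mor F G} (Γ : Modif μ ν) (k : Fin n) :
    μ.line k ⟶ ν.line k where
  as := { app := fun X => Γ.app X.as
          naturality := fun f => Γ.nat f.as }

theorem paste_squares {X Y Z W X' Y' Z' W' X'' Y'' Z'' W'' : D}
    {j : X ⟶ Y} {i : Z ⟶ W} {q : X ⟶ Z} {p : Y ⟶ W}
    {j' : X' ⟶ Y'} {i' : Z' ⟶ W'} {q' : X' ⟶ Z'} {p' : Y' ⟶ W'}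
    {j'' : X'' ⟶ Y''} {i'' : Z'' ⟶ W''} {q'' : X'' ⟶ Z''} {p'' : Y'' ⟶ W''}
    {mX : X ⟶ X'} {mY : Y ⟶ Y'} {mZ : Z ⟶ Z'} {mW : W ⟶ W'}
    {nX : X' ⟶ X''} {nY : Y' ⟶ Y''} {nZ : Z' ⟶ Z''} {nW : W' ⟶ W''}
    {G : q ≫ i ⟶ j ≫ p} {G' : q' ≫ i' ⟶ j' ≫ p'} {G'' : q'' ≫ i'' ⟶ j'' ≫ p''}
    {mj : j ≫ mY ⟶ mX ≫ j'} {mp : p ≫ mW ⟶ mY ≫ p'} {mq : q ≫ mZ ⟶ mX ≫ q'}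
    {mi : i ≫ mW ⟶ mZ ≫ i'}
    {nj : j' ≫ nY ⟶ nX ≫ j''} {np : p' ≫ nW ⟶ nY ≫ p''} {nq : q' ≫ nZ ⟶ nX ≫ q''}
    {ni : i' ≫ nW ⟶ nZ ≫ i''}
    (h₁ : G ▷ mW ≫ (α_ _ _ _).hom ≫ j ◁ mp ≫ (α_ _ _ _).inv ≫ mj ▷ p' ≫ (α_ _ _ _).hom =
      (α_ _ _ _).hom ≫ q ◁ mi ≫ (α_ _ _ _).inv ≫ mq ▷ i' ≫ (α_ _ _ _).hom ≫ mX ◁ G')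
    (h₂ : G' ▷ nW ≫ (α_ _ _ _).hom ≫ j' ◁ np ≫ (α_ _ _ _).inv ≫ nj ▷ p'' ≫ (α_ _ _ _).hom =
      (α_ _ _ _).hom ≫ q' ◁ ni ≫ (α_ _ _ _).inv ≫ nq ▷ i'' ≫ (α_ _ _ _).hom ≫ nX ◁ G'') :
    G ▷ (mW ≫ nW) ≫ (α_ _ _ _).hom ≫
        j ◁ ((α_ _ _ _).inv ≫ mp ▷ nW ≫ (α_ _ _ _).hom ≫ mY ◁ np ≫ (α_ _ _ _).inv) ≫
        (α_ _ _ _).inv ≫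
        ((α_ _ _ _).inv ≫ mj ▷ nY ≫ (α_ _ _ _).hom ≫ mX ◁ nj ≫ (α_ _ _ _).inv) ▷ p'' ≫
        (α_ _ _ _).hom =
      (α_ _ _ _).hom ≫
        q ◁ ((α_ _ _ _).inv ≫ mi ▷ nW ≫ (α_ _ _ _).hom ≫ mZ ◁ ni ≫ (α_ _ _ _).inv) ≫
        (α_ _ _ _).inv ≫
        ((α_ _ _ _).inv ≫ mq ▷ nZ ≫ (α_ _ _ _).hom ≫ mX ◁ nq ≫ (α_ _ _ _).inv) ▷ i'' ≫
        (α_ _ _ _).hom ≫ (mX ≫ nX) ◁ G'' := by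
  calc
    _ = (α_ _ _ _).inv ≫ (G ▷ mW ≫ (α_ _ _ _).hom ≫ j ◁ mp) ▷ nW ⊗≫
          ((j ≫ mY) ◁ np ≫ mj ▷ (nY ≫ p'')) ⊗≫ mX ◁ nj ▷ p'' ⊗≫ 𝟙 _ := by bicategory
    _ = (α_ _ _ _).inv ≫ (G ▷ mW ≫ (α_ _ _ _).hom ≫ j ◁ mp ≫ (α_ _ _ _).inv ≫ mj ▷ p' ≫
          (α_ _ _ _).hom) ▷ nW ⊗≫ mX ◁ (j' ◁ np ≫ (α_ _ _ _).inv ≫ nj ▷ p'') ⊗≫ 𝟙 _ := by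
        rw [whisker_exchange]; bicategory
    _ = 𝟙 _ ⊗≫ q ◁ mi ▷ nW ⊗≫ mq ▷ i' ▷ nW ⊗≫ mX ◁ (G' ▷ nW ≫ (α_ _ _ _).hom ≫ j' ◁ np ≫
          (α_ _ _ _).inv ≫ nj ▷ p'' ≫ (α_ _ _ _).hom) ⊗≫ 𝟙 _ := by
        rw [h₁]; bicategory
    _ = 𝟙 _ ⊗≫ q ◁ mi ▷ nW ⊗≫ (mq ▷ (i' ≫ nW) ≫ (mX ≫ q') ◁ ni) ⊗≫ mX ◁ nq ▷ i'' ⊗≫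
          mX ◁ nX ◁ G'' ⊗≫ 𝟙 _ := by
        rw [h₂]; bicategory
    _ = _ := by
        rw [← whisker_exchange]; bicategory

instance : CategoryStruct (MixedPsFun C D) where
  Hom := Mor
  id F :=
    { app := fun X => 𝟙 (F.obj X)
      nat := fun f => ρ_ _ ≪≫ (λ_ _).symm
      nat_id := fun k X =>
        Pseudofunctor.StrongTrans.naturality_id (𝟙 (F.line k).toPseudofunctor) ⟨X⟩
      nat_comp := fun {k} _ _ _ f g =>
        Pseudofunctor.StrongTrans.naturality_comp (𝟙 (F.line k).toPseudofunctor) ⟨f⟩ ⟨g⟩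
      nat_sq := by intros; simp }
  comp {F G H} μ ν :=
    { app := fun X => μ.app X ≫ ν.app X
      nat := fun {k} _ _ f => (μ.line k ≫ ν.line k).naturality ⟨f⟩
      nat_id := fun k X => (μ.line k ≫ ν.line k).naturality_id ⟨X⟩
      nat_comp := fun {k} _ _ _ f g => (μ.line k ≫ ν.line k).naturality_comp ⟨f⟩ ⟨g⟩
      nat_sq := fun h _ _ _ _ _ _ _ _ S => paste_squares (μ.nat_sq h S) (ν.nat_sq h S) }

instance (F G : MixedPsFun C D) : Category (F ⟶ G) where
  Hom := Modif
  id μ :=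
    { app := fun X => 𝟙 (μ.app X)
      nat := by intros; simp }
  comp Γ Λ :=
    { app := fun X => Γ.app X ≫ Λ.app X
      nat := fun {k} _ _ f => (Γ.line k ≫ Λ.line k).as.naturality ⟨f⟩ }
  id_comp _ := Modif.ext (funext fun _ => Category.id_comp _)
  comp_id _ := Modif.ext (funext fun _ => Category.comp_id _)
  assoc _ _ _ := Modif.ext (funext fun _ => Category.assoc _ _ _)

theorem hom_ext {F G : MixedPsFun C D} {μ ν : F ⟶ G} {Γ Λ : μ ⟶ ν}
    (h : ∀ X, Modif.app Γ X = Modif.app Λ X) : Γ = Λ :=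
  Modif.ext (funext h)

/-- Invertible `2`-cells from invertible components. -/
def mkIso {F G : MixedPsFun C D} {μ ν : F ⟶ G} (e : ∀ X, Mor.app μ X ≅ Mor.app ν X)
    (he : ∀ {k : Fin n} {X Y : C.Obj} (f : Edge k X Y),
      (F.line k).map f ◁ (e Y).hom ≫ (Mor.nat ν f).hom =
        (Mor.nat μ f).hom ≫ (e X).hom ▷ (G.line k).map f) : μ ≅ ν where
  hom := { app := fun X => (e X).hom, nat := he }
  inv :=
    { app := fun X => (e X).inv
      nat := fun {k} X Y f => by
        rw [← cancel_mono ((e X).hom ▷ (G.line k).map f), Category.assoc, Category.assoc, ← he f,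
          ← comp_whiskerRight, Iso.inv_hom_id, id_whiskerRight, Category.comp_id,
          ← whiskerLeft_comp_assoc, Iso.inv_hom_id, whiskerLeft_id, Category.id_comp] }
  hom_inv_id := hom_ext fun X => (e X).hom_inv_id
  inv_hom_id := hom_ext fun X => (e X).inv_hom_id

/-- Whiskering of `2`-cells. -/
def whiskL {F G H : MixedPsFun C D} (μ : F ⟶ G) {ν ξ : G ⟶ H} (Γ : ν ⟶ ξ) : μ ≫ ν ⟶ μ ≫ ξ where
  app X := Mor.app μ X ◁ Modif.app Γ X
  nat {k} _ _ f := (Mor.line μ k ◁ Modif.line Γ k).as.naturality ⟨f⟩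

/-- Whiskering of `2`-cells. -/
def whiskR {F G H : MixedPsFun C D} {μ ν : F ⟶ G} (Γ : μ ⟶ ν) (ξ : G ⟶ H) : μ ≫ ξ ⟶ ν ≫ ξ where
  app X := Modif.app Γ X ▷ Mor.app ξ X
  nat {k} _ _ f := (Modif.line Γ k ▷ Mor.line ξ k).as.naturality ⟨f⟩

instance : Bicategory (MixedPsFun C D) where
  whiskerLeft μ _ _ Γ := whiskL μ Γ
  whiskerRight Γ μ := whiskR Γ μ
  associator μ ν ξ := mkIso (fun X => α_ (Mor.app μ X) (Mor.app ν X) (Mor.app ξ X))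
    fun {k} _ _ f => (α_ (Mor.line μ k) (Mor.line ν k) (Mor.line ξ k)).hom.as.naturality ⟨f⟩
  leftUnitor μ := mkIso (fun X => λ_ (Mor.app μ X))
    fun {k} _ _ f => (λ_ (Mor.line μ k)).hom.as.naturality ⟨f⟩
  rightUnitor μ := mkIso (fun X => ρ_ (Mor.app μ X))
    fun {k} _ _ f => (ρ_ (Mor.line μ k)).hom.as.naturality ⟨f⟩
  whiskerLeft_id _ _ := hom_ext fun _ => whiskerLeft_id _ _
  whiskerLeft_comp _ _ _ _ _ _ := hom_ext fun _ => whiskerLeft_comp _ _ _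
  id_whiskerLeft _ := hom_ext fun _ => id_whiskerLeft _
  comp_whiskerLeft _ _ _ _ _ := hom_ext fun _ => comp_whiskerLeft _ _ _
  id_whiskerRight _ _ := hom_ext fun _ => id_whiskerRight _ _
  comp_whiskerRight _ _ _ := hom_ext fun _ => comp_whiskerRight _ _ _
  whiskerRight_id _ := hom_ext fun _ => whiskerRight_id _
  whiskerRight_comp _ _ _ := hom_ext fun _ => whiskerRight_comp _ _ _
  whisker_assoc _ _ _ _ _ := hom_ext fun _ => whisker_assoc _ _ _
  whisker_exchange _ _ := hom_ext fun _ => whisker_exchange _ _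
  pentagon _ _ _ _ := hom_ext fun _ => Bicategory.pentagon _ _ _ _
  triangle _ _ := hom_ext fun _ => Bicategory.triangle _ _

end MixedPsFun

theorem MixedPsFun.eq_of_iso {n : ℕ} {C : NFoldCat.{t} n} {D : Type u} [Bicategory.{w, v} D]
    {F G : MixedPsFun C D} {μ ν : F ⟶ G} (e : μ ≅ ν) (h : ∀ X, Mor.app μ X = Mor.app ν X)
    (he : ∀ X, Modif.app e.hom X = eqToHom (h X)) : μ = ν := by
  obtain ⟨a, b, _, _, _⟩ := μ
  obtain ⟨a', b', _, _, _⟩ := ν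
  obtain rfl : a = a' := funext h
  have : @b = @b' := by
    funext k X Y f
    ext
    have key := Modif.nat e.hom f
    rw [he, he] at key
    simpa using key.symm
  subst this
  rfl

theorem MixedPsFun.iso_eq {n : ℕ} {C : NFoldCat.{t} n} {D : Type u} [Bicategory.{w, v} D]
    {F G : MixedPsFun C D} {μ ν : F ⟶ G} (e : μ ≅ ν) (h : μ = ν)
    (he : ∀ X, Modif.app e.hom X = eqToHom (by rw [h])) : e = eqToIso h := by
  subst h
  exact Iso.ext (hom_ext he)

instance {n : ℕ} {C : NFoldCat.{t} n} {D : Type u} [Bicategory.{w, v} D] [Bicategory.Strict D] :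
    Bicategory.Strict (MixedPsFun C D) where
  id_comp μ := MixedPsFun.eq_of_iso (λ_ μ) (fun _ => Bicategory.Strict.id_comp _)
    fun _ => congrArg Iso.hom (Bicategory.Strict.leftUnitor_eqToIso _)
  comp_id μ := MixedPsFun.eq_of_iso (ρ_ μ) (fun _ => Bicategory.Strict.comp_id _)
    fun _ => congrArg Iso.hom (Bicategory.Strict.rightUnitor_eqToIso _)
  assoc μ ν ξ := MixedPsFun.eq_of_iso (α_ μ ν ξ) (fun _ => Bicategory.Strict.assoc _ _ _)
    fun _ => congrArg Iso.hom (Bicategory.Strict.associator_eqToIso _ _ _)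
  leftUnitor_eqToIso _ := MixedPsFun.iso_eq _ _
    fun _ => congrArg Iso.hom (Bicategory.Strict.leftUnitor_eqToIso _)
  rightUnitor_eqToIso _ := MixedPsFun.iso_eq _ _
    fun _ => congrArg Iso.hom (Bicategory.Strict.rightUnitor_eqToIso _)
  associator_eqToIso _ _ _ := MixedPsFun.iso_eq _ _
    fun _ => congrArg Iso.hom (Bicategory.Strict.associator_eqToIso _ _ _)

theorem PsFun.eq_of_iso {B : Type*} [Bicategory B] {D : Type u} [Bicategory.{w, v} D]
    {F G : B ⥤ᵖ D} {μ ν : F ⟶ G} (e : μ ≅ ν) (h : ∀ X, μ.app X = ν.app X)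
    (he : ∀ X, e.hom.as.app X = eqToHom (h X)) : μ = ν := by
  obtain ⟨a, b, _, _, _⟩ := μ
  obtain ⟨a', b', _, _, _⟩ := ν
  obtain rfl : a = a' := funext h
  have : @b = @b' := by
    funext X Y f
    ext
    have key := e.hom.as.naturality f
    rw [he, he] at key
    simpa using key.symm
  subst this
  rfl

theorem PsFun.iso_eq {B : Type*} [Bicategory B] {D : Type u} [Bicategory.{w, v} D]
    {F G : B ⥤ᵖ D} {μ ν : F ⟶ G} (e : μ ≅ ν) (h : μ = ν)
    (he : ∀ X, e.hom.as.app X = eqToHom (by rw [h])) : e = eqToIso h := by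
  subst h
  exact Iso.ext (Pseudofunctor.StrongTrans.homCategory.ext he)

/-- If `D` is a `2`-category, then so is the bicategory of pseudofunctors to `D`. -/
instance PsFun.strict {B : Type*} [Bicategory B] {D : Type u} [Bicategory.{w, v} D]
    [Bicategory.Strict D] : Bicategory.Strict (B ⥤ᵖ D) where
  id_comp μ := PsFun.eq_of_iso (λ_ μ) (fun _ => Bicategory.Strict.id_comp _)
    fun _ => congrArg Iso.hom (Bicategory.Strict.leftUnitor_eqToIso _)
  comp_id μ := PsFun.eq_of_iso (ρ_ μ) (fun _ => Bicategory.Strict.comp_id _)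
    fun _ => congrArg Iso.hom (Bicategory.Strict.rightUnitor_eqToIso _)
  assoc μ ν ξ := PsFun.eq_of_iso (α_ μ ν ξ) (fun _ => Bicategory.Strict.assoc _ _ _)
    fun _ => congrArg Iso.hom (Bicategory.Strict.associator_eqToIso _ _ _)
  leftUnitor_eqToIso _ := PsFun.iso_eq _ _
    fun _ => congrArg Iso.hom (Bicategory.Strict.leftUnitor_eqToIso _)
  rightUnitor_eqToIso _ := PsFun.iso_eq _ _
    fun _ => congrArg Iso.hom (Bicategory.Strict.rightUnitor_eqToIso _)
  associator_eqToIso _ _ _ := PsFun.iso_eq _ _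
    fun _ => congrArg Iso.hom (Bicategory.Strict.associator_eqToIso _ _ _)

/-! ### `2`-categories over a base `2`-category -/

theorem StrictPseudofunctor.ext_prelax {B : Type*} [Bicategory B] {C : Type*} [Bicategory C]
    {F G : StrictPseudofunctor B C} (h : F.toPrelaxFunctor = G.toPrelaxFunctor) : F = G := by
  obtain ⟨⟨⟨P, i, c, _, _, _, _, _⟩, hi, hi'⟩, hc, hc'⟩ := F
  obtain ⟨⟨⟨P', i', c', _, _, _, _, _⟩, hi₁, hi₁'⟩, hc₁, hc₁'⟩ := G
  obtain rfl : P = P' := h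
  obtain rfl : i = i' := funext fun X => (hi' X).trans (hi₁' X).symm
  obtain rfl : @c = @c' := by
    funext X Y Z f g
    exact (hc' f g).trans (hc₁' f g).symm
  rfl

section Over

variable {B : Type*} [Bicategory B] {B' : Type*} [Bicategory B'] {B'' : Type*} [Bicategory B'']
  {K : Type*} [Bicategory K]

/-- For `K`-categories `(B, E)` and `(B', E')`, a `K`-functor is a `2`-functor `G : B → B'` such
that `E' G = E`. -/
structure OverFunctor (E : StrictPseudofunctor B K) (E' : StrictPseudofunctor B' K) where
  functor : StrictPseudofunctor B B'
  comm : functor.comp E' = E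

/-- The identity `K`-functor. -/
def OverFunctor.id (E : StrictPseudofunctor B K) : OverFunctor E E where
  functor := StrictPseudofunctor.id B
  comm := StrictPseudofunctor.ext_prelax rfl

/-- The composite of two `K`-functors (diagrammatic order). -/
def OverFunctor.comp {E : StrictPseudofunctor B K} {E' : StrictPseudofunctor B' K}
    {E'' : StrictPseudofunctor B'' K} (G : OverFunctor E E') (H : OverFunctor E' E'') :
    OverFunctor E E'' where
  functor := G.functor.comp H.functor
  comm := (StrictPseudofunctor.ext_prelax rfl :
    (G.functor.comp H.functor).comp E'' = G.functor.comp (H.functor.comp E'')).trans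
      ((congrArg G.functor.comp H.comm).trans G.comm)

variable {E : StrictPseudofunctor B K} {E' : StrictPseudofunctor B' K}

/-- A pseudonatural transformation `α : G ⇒ H` is a `K`-natural transformation if
`E' * α : E' G ⇒ E' H` is the identity of `E = E' G = E' H`, i.e. its components on objects and on
morphisms are identities. -/
structure IsOverNat {G H : OverFunctor E E'}
    (α : G.functor.toPseudofunctor ⟶ H.functor.toPseudofunctor) : Prop where
  app (X : B) : HEq (E'.map (α.app X)) (𝟙 (E.obj X))
  naturality {X Y : B} (f : X ⟶ Y) : HEq (E'.map₂ (α.naturality f).hom) (𝟙 (E.map f))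

/-- A modification `Γ` between `K`-natural transformations is a `K`-modification if `E' * Γ` is the
identity modification of the identity transformation of `E`. -/
def IsOverModif {G H : OverFunctor E E'}
    {α β : G.functor.toPseudofunctor ⟶ H.functor.toPseudofunctor} (Γ : α ⟶ β) : Prop :=
  ∀ X : B, HEq (E'.map₂ (Γ.as.app X)) (𝟙 (𝟙 (E.obj X)))

/-- A `K`-natural equivalence is a `K`-natural transformation with a quasi-inverse up to invertible
`K`-modifications. -/
def IsOverEquiv {G H : OverFunctor E E'}
    (α : G.functor.toPseudofunctor ⟶ H.functor.toPseudofunctor) : Prop :=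
  IsOverNat (G := G) (H := H) α ∧
    ∃ β : H.functor.toPseudofunctor ⟶ G.functor.toPseudofunctor, IsOverNat (G := H) (H := G) β ∧
      (∃ e : 𝟙 _ ≅ α ≫ β, IsOverModif (G := G) (H := G) e.hom) ∧
      (∃ e : β ≫ α ≅ 𝟙 _, IsOverModif (G := H) (H := H) e.hom)

/-- The `K`-functors `G` and `H` are `K`-quasi-inverses of each other: there are `K`-natural
equivalences `1 ⇒ G H` and `H G ⇒ 1`. -/
def OverQuasiInverse (G : OverFunctor E E') (H : OverFunctor E' E) : Prop :=
  (∃ α : (OverFunctor.id E').functor.toPseudofunctor ⟶ (H.comp G).functor.toPseudofunctor,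
    IsOverEquiv (G := OverFunctor.id E') (H := H.comp G) α) ∧
  (∃ α : (G.comp H).functor.toPseudofunctor ⟶ (OverFunctor.id E).functor.toPseudofunctor,
    IsOverEquiv (G := G.comp H) (H := OverFunctor.id E) α)

end Over

/-- The forgetful `2`-functor from pseudofunctors `C → D` to `D^{Ob C}`. -/
def MixedPsFun.forget {n : ℕ} (C : NFoldCat.{t} n) (D : Type u) [Bicategory.{w, v} D]
    [Bicategory.Strict D] : StrictPseudofunctor (MixedPsFun C D) (PowCat C.Obj D) :=
  StrictPseudofunctor.mk''
    { obj := fun F => ⟨F.obj⟩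
      map := fun μ => ⟨Mor.app μ⟩
      map₂ := fun Γ => ⟨Modif.app Γ⟩
      map₂_id := fun _ => rfl
      map₂_comp := fun _ _ => rfl
      map_id := fun _ => rfl
      map_comp := fun _ _ => rfl
      map₂_whisker_left := fun _ _ _ _ => PowCat.eq_conj _ _ _ _ fun _ =>
        ((Category.id_comp _).trans (Category.comp_id _)).symm
      map₂_whisker_right := fun _ _ => PowCat.eq_conj _ _ _ _ fun _ =>
        ((Category.id_comp _).trans (Category.comp_id _)).symm }

/-- The forgetful `2`-functor from pseudofunctors `T C → D` to `D^{Ob C}`. -/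
def PsFun.forget {n : ℕ} (C : NFoldCat.{t} n) (D : Type u) [Bicategory.{w, v} D]
    [Bicategory.Strict D] : StrictPseudofunctor (T C ⥤ᵖ D) (PowCat C.Obj D) :=
  StrictPseudofunctor.mk''
    { obj := fun F => ⟨fun X => F.obj ⟨X⟩⟩
      map := fun μ => ⟨fun X => μ.app ⟨X⟩⟩
      map₂ := fun Γ => ⟨fun X => Γ.as.app ⟨X⟩⟩
      map₂_id := fun _ => rfl
      map₂_comp := fun _ _ => rfl
      map_id := fun _ => rfl
      map_comp := fun _ _ => rfl
      map₂_whisker_left := fun _ _ _ _ => PowCat.eq_conj _ _ _ _ fun _ =>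
        ((Category.id_comp _).trans (Category.comp_id _)).symm
      map₂_whisker_right := fun _ _ => PowCat.eq_conj _ _ _ _ fun _ =>
        ((Category.id_comp _).trans (Category.comp_id _)).symm }

/-! ### The universal pseudofunctor from `C` to `T C` -/

namespace NFoldCat

variable {n : ℕ} {C : NFoldCat.{t} n}

/-- The morphism of `T C` given by a path. -/
def T.hom {X Y : C.Obj} (p : TPath X Y) : (⟨X⟩ : T C) ⟶ ⟨Y⟩ := p

/-- The `2`-cell of `T C` given by a transformation. -/
def T.hom₂ {X Y : C.Obj} {p q : TPath X Y} (s : Trafo p q) : T.hom p ⟶ T.hom q := s.cell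

/-- The invertible `2`-cell `θ`, with inverse `ι`. -/
def T.idIso (k : Fin n) (X : C.Obj) : T.hom (Edge.id k X).path ≅ 𝟙 (⟨X⟩ : T C) where
  hom := T.hom₂ (Trafo.of (.theta k X))
  inv := T.hom₂ (Trafo.of (.iota k X))
  hom_inv_id := Quot.sound (.theta_iota k X)
  inv_hom_id := Quot.sound (.iota_theta k X)

/-- The invertible `2`-cell `δ`, with inverse `γ`. -/
def T.compIso {k : Fin n} {X Y Z : C.Obj} (f : Edge k X Y) (g : Edge k Y Z) :
    T.hom (f.comp g).path ≅ T.hom f.path ≫ T.hom g.path where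
  hom := T.hom₂ (Trafo.of (.delta f g))
  inv := T.hom₂ (Trafo.of (.gamma f g))
  hom_inv_id := Quot.sound (.delta_gamma f g)
  inv_hom_id := Quot.sound (.gamma_delta f g)

/-- The `2`-cell `σ` of a square. -/
def T.sq {k k' : Fin n} (h : k < k') {X Y Z W : C.Obj} {j : Edge k X Y} {i : Edge k Z W}
    {q : Edge k' X Z} {p : Edge k' Y W} (S : Sq j i q p) :
    T.hom q.path ≫ T.hom i.path ⟶ T.hom j.path ≫ T.hom p.path :=
  T.hom₂ (Trafo.of (.sigma h S))

theorem T.hom₂_of {X Y : C.Obj} {p q u v : TPath X Y} (b : C.Basic u v) (hp : p = u) (hq : q = v) :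
    T.hom₂ (Trafo.of b hp hq) =
      eqToHom (congrArg T.hom hp) ≫ T.hom₂ (Trafo.of b) ≫ eqToHom (congrArg T.hom hq.symm) := by
  subst hp hq
  exact ((Category.id_comp _).trans (Category.comp_id _)).symm

theorem T.iota_right {k : Fin n} {X Y : C.Obj} (f : Edge k X Y) :
    (λ_ (T.hom f.path)).inv ≫ (T.idIso k X).inv ▷ T.hom f.path =
      eqToHom (by rw [f.id_comp]) ≫ (T.compIso (Edge.id k X) f).hom := by
  have h : T.hom₂ (Trafo.whiskered .nil (.iota k X) f.path) = _ := Quot.sound (.iota_right f)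
  have h' := T.hom₂_of (.delta (Edge.id k X) f) (by rw [f.id_comp]) rfl
  exact (h.trans h').trans (congrArg _ (Category.comp_id _))

theorem T.iota_left {k : Fin n} {X Y : C.Obj} (f : Edge k X Y) :
    (ρ_ (T.hom f.path)).inv ≫ T.hom f.path ◁ (T.idIso k Y).inv =
      eqToHom (by rw [f.comp_id]) ≫ (T.compIso f (Edge.id k Y)).hom := by
  have h : T.hom₂ (Trafo.whiskered f.path (.iota k Y) .nil) = _ := Quot.sound (.iota_left f)
  have h' := T.hom₂_of (.delta f (Edge.id k Y)) (by rw [f.comp_id]) rfl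
  exact (h.trans h').trans (congrArg _ (Category.comp_id _))

theorem T.gamma_assoc {k : Fin n} {X Y Z W : C.Obj} (f : Edge k X Y) (g : Edge k Y Z)
    (h : Edge k Z W) :
    (T.compIso f g).inv ▷ T.hom h.path ≫ (T.compIso (f.comp g) h).inv =
      (α_ _ _ _).hom ≫ T.hom f.path ◁ (T.compIso g h).inv ≫ (T.compIso f (g.comp h)).inv ≫
        eqToHom (by rw [Edge.assoc]) := by
  have e : T.hom₂ ((Trafo.whiskered .nil (.gamma f g) h.path).comp
      (Trafo.of (.gamma (f.comp g) h))) = _ := Quot.sound (.gamma_assoc f g h)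
  have e' := T.hom₂_of (p := f.path.comp (g.comp h).path) (q := ((f.comp g).comp h).path)
    (.gamma f (g.comp h)) rfl (by rw [Edge.assoc f g h])
  let a : T.hom ((f.path.comp g.path).comp h.path) ⟶ T.hom (f.path.comp (g.comp h).path) :=
    T.hom₂ (Trafo.whiskered f.path (.gamma g h) .nil)
  have e₂ : a = (α_ (T.hom f.path) (T.hom g.path) (T.hom h.path)).hom ≫
    T.hom f.path ◁ (T.compIso g h).inv := (Category.id_comp a).symm
  have e₃ := (congrArg (a ≫ ·) e').trans (congrArg (a ≫ ·) (Category.id_comp _))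
  refine (e.trans e₃).trans ?_
  rw [e₂]
  exact Category.assoc _ _ _

theorem T.sq_hid {k k' : Fin n} (h : k < k') {X Y : C.Obj} {f : Edge k X Y}
    (S : Sq f f (Edge.id k' X) (Edge.id k' Y)) (hS : C.IsHId S) :
    (λ_ _).inv ≫ (T.idIso k' X).inv ▷ T.hom f.path ≫ T.sq h S =
      (ρ_ _).inv ≫ T.hom f.path ◁ (T.idIso k' Y).inv :=
  Quot.sound (.sigma_hid h S hS)

theorem T.sq_vid {k k' : Fin n} (h : k < k') {X Y : C.Obj} {f : Edge k' X Y}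
    (S : Sq (Edge.id k X) (Edge.id k Y) f f) (hS : C.IsVId S) :
    (ρ_ _).inv ≫ T.hom f.path ◁ (T.idIso k Y).inv ≫ T.sq h S =
      (λ_ _).inv ≫ (T.idIso k X).inv ▷ T.hom f.path :=
  Quot.sound (.sigma_vid h S hS)

theorem T.sq_hcomp {k k' : Fin n} (h : k < k') {X₁ X₂ X₃ Y₁ Y₂ Y₃ : C.Obj}
    {j : Edge k X₁ X₂} {j' : Edge k X₂ X₃} {i : Edge k Y₁ Y₂} {i' : Edge k Y₂ Y₃}
    {p₁ : Edge k' X₁ Y₁} {p₂ : Edge k' X₂ Y₂} {p₃ : Edge k' X₃ Y₃}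
    (S : Sq j i p₁ p₂) (S' : Sq j' i' p₂ p₃) (S'' : Sq (j.comp j') (i.comp i') p₁ p₃)
    (hS : C.IsHComp h S S' S'') :
    (α_ _ _ _).inv ≫ T.sq h S ▷ T.hom i'.path ≫ (α_ _ _ _).hom ≫ T.hom j.path ◁ T.sq h S' ≫
        (α_ _ _ _).inv ≫ (T.compIso j j').inv ▷ T.hom p₃.path =
      T.hom p₁.path ◁ (T.compIso i i').inv ≫ T.sq h S'' :=
  Quot.sound (.sigma_hcomp h S S' S'' hS)

theorem T.sq_vcomp {k k' : Fin n} (h : k < k') {X₁ X₂ X₃ Y₁ Y₂ Y₃ : C.Obj}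
    {p₁ : Edge k X₁ Y₁} {p₂ : Edge k X₂ Y₂} {p₃ : Edge k X₃ Y₃}
    {j : Edge k' X₁ X₂} {j' : Edge k' X₂ X₃} {i : Edge k' Y₁ Y₂} {i' : Edge k' Y₂ Y₃}
    (S : Sq p₁ p₂ j i) (S' : Sq p₂ p₃ j' i') (S'' : Sq p₁ p₃ (j.comp j') (i.comp i'))
    (hS : C.IsVComp h S S' S'') :
    (α_ _ _ _).hom ≫ T.hom j.path ◁ T.sq h S' ≫ (α_ _ _ _).inv ≫ T.sq h S ▷ T.hom i'.path ≫
        (α_ _ _ _).hom ≫ T.hom p₁.path ◁ (T.compIso i i').inv =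
      (T.compIso j j').inv ▷ T.hom p₃.path ≫ T.sq h S'' :=
  Quot.sound (.sigma_vcomp h S S' S'' hS)

theorem T.sq_cube {k k' k'' : Fin n} (h : k < k') (h' : k' < k'') {X' Y' Z' W' X Y Z W : C.Obj}
    {b' : Edge k X' Y'} {a' : Edge k Z' W'} {b : Edge k X Y} {a : Edge k Z W}
    {q' : Edge k' X' Z'} {p' : Edge k' Y' W'} {q : Edge k' X Z} {p : Edge k' Y W}
    {x : Edge k'' X' X} {y : Edge k'' Y' Y} {z : Edge k'' Z' Z} {w : Edge k'' W' W}
    (K' : Sq b' a' q' p') (K : Sq b a q p) (J' : Sq b' b x y) (J : Sq a' a z w)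
    (I' : Sq q' q x z) (I : Sq p' p y w) (hc : C.IsCube K' K J' J I' I) :
    T.hom x.path ◁ T.sq h K ≫ (α_ _ _ _).inv ≫ T.sq (h.trans h') J' ▷ T.hom p.path ≫
        (α_ _ _ _).hom ≫ T.hom b'.path ◁ T.sq h' I =
      (α_ _ _ _).inv ≫ T.sq h' I' ▷ T.hom a.path ≫ (α_ _ _ _).hom ≫
        T.hom q'.path ◁ T.sq (h.trans h') J ≫ (α_ _ _ _).inv ≫
        T.sq h K' ▷ T.hom w.path ≫ (α_ _ _ _).hom :=
  Quot.sound (.sigma_cube h h' K' K J' J I' I hc)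

end NFoldCat

namespace NFoldCat

section

variable {B : Type*} [Bicategory B]

theorem hid_of {X Y : B} {f : X ⟶ Y} {a : X ⟶ X} {b : Y ⟶ Y} {S : a ≫ f ⟶ f ≫ b}
    {s : a ≅ 𝟙 X} {t : b ≅ 𝟙 Y} (h : (λ_ f).inv ≫ s.inv ▷ f ≫ S = (ρ_ f).inv ≫ f ◁ t.inv) :
    S ≫ f ◁ t.hom ≫ (ρ_ f).hom = s.hom ▷ f ≫ (λ_ f).hom := by
  have := congrArg (s.hom ▷ f ≫ (λ_ f).hom ≫ · ≫ f ◁ t.hom ≫ (ρ_ f).hom) h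
  simpa using this

theorem vid_of {X Y : B} {f : X ⟶ Y} {a : X ⟶ X} {b : Y ⟶ Y} {S : f ≫ b ⟶ a ≫ f}
    {s : a ≅ 𝟙 X} {t : b ≅ 𝟙 Y} (h : (ρ_ f).inv ≫ f ◁ t.inv ≫ S = (λ_ f).inv ≫ s.inv ▷ f) :
    S ≫ s.hom ▷ f ≫ (λ_ f).hom = f ◁ t.hom ≫ (ρ_ f).hom := by
  have := congrArg (f ◁ t.hom ≫ (ρ_ f).hom ≫ · ≫ s.hom ▷ f ≫ (λ_ f).hom) h
  simpa using this

theorem hcomp_of {X₁ X₂ X₃ Y₁ Y₂ Y₃ : B}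
    {j : X₁ ⟶ X₂} {j' : X₂ ⟶ X₃} {i : Y₁ ⟶ Y₂} {i' : Y₂ ⟶ Y₃} {j'' : X₁ ⟶ X₃} {i'' : Y₁ ⟶ Y₃}
    {p₁ : X₁ ⟶ Y₁} {p₂ : X₂ ⟶ Y₂} {p₃ : X₃ ⟶ Y₃}
    {S : p₁ ≫ i ⟶ j ≫ p₂} {S' : p₂ ≫ i' ⟶ j' ≫ p₃} {S'' : p₁ ≫ i'' ⟶ j'' ≫ p₃}
    {c : i'' ≅ i ≫ i'} {d : j'' ≅ j ≫ j'}
    (h : (α_ _ _ _).inv ≫ S ▷ i' ≫ (α_ _ _ _).hom ≫ j ◁ S' ≫ (α_ _ _ _).inv ≫ d.inv ▷ p₃ =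
      p₁ ◁ c.inv ≫ S'') :
    p₁ ◁ c.hom ≫ (α_ _ _ _).inv ≫ S ▷ i' ≫ (α_ _ _ _).hom ≫ j ◁ S' ≫ (α_ _ _ _).inv =
      S'' ≫ d.hom ▷ p₃ := by
  have := congrArg (p₁ ◁ c.hom ≫ · ≫ d.hom ▷ p₃) h
  simpa using this

theorem vcomp_of {X₁ X₂ X₃ Y₁ Y₂ Y₃ : B}
    {p₁ : X₁ ⟶ Y₁} {p₂ : X₂ ⟶ Y₂} {p₃ : X₃ ⟶ Y₃}
    {j : X₁ ⟶ X₂} {j' : X₂ ⟶ X₃} {i : Y₁ ⟶ Y₂} {i' : Y₂ ⟶ Y₃} {j'' : X₁ ⟶ X₃} {i'' : Y₁ ⟶ Y₃}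
    {S : j ≫ p₂ ⟶ p₁ ≫ i} {S' : j' ≫ p₃ ⟶ p₂ ≫ i'} {S'' : j'' ≫ p₃ ⟶ p₁ ≫ i''}
    {c : i'' ≅ i ≫ i'} {d : j'' ≅ j ≫ j'}
    (h : (α_ _ _ _).hom ≫ j ◁ S' ≫ (α_ _ _ _).inv ≫ S ▷ i' ≫ (α_ _ _ _).hom ≫ p₁ ◁ c.inv =
      d.inv ▷ p₃ ≫ S'') :
    d.hom ▷ p₃ ≫ (α_ _ _ _).hom ≫ j ◁ S' ≫ (α_ _ _ _).inv ≫ S ▷ i' ≫ (α_ _ _ _).hom =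
      S'' ≫ p₁ ◁ c.hom := by
  have := congrArg (d.hom ▷ p₃ ≫ · ≫ p₁ ◁ c.hom) h
  simpa using this

theorem assoc_of {X Y Z W : B} {f : X ⟶ Y} {g : Y ⟶ Z} {h : Z ⟶ W} {fg : X ⟶ Z} {gh : Y ⟶ W}
    {l r : X ⟶ W} {cfg : fg ≅ f ≫ g} {cgh : gh ≅ g ≫ h} {cl : l ≅ fg ≫ h} {cr : r ≅ f ≫ gh}
    (e : r = l)
    (k : cfg.inv ▷ h ≫ cl.inv = (α_ _ _ _).hom ≫ f ◁ cgh.inv ≫ cr.inv ≫ eqToHom e) :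
    cl.hom ≫ cfg.hom ▷ h ≫ (α_ f g h).hom ≫ f ◁ cgh.inv ≫ cr.inv = eqToHom e.symm := by
  subst e
  have := congrArg (cl.hom ≫ cfg.hom ▷ h ≫ ·) k
  simpa using this.symm

theorem id_comp_of {X Y : B} {f g : X ⟶ Y} {a : X ⟶ X} {s : a ≅ 𝟙 X} {c : g ≅ a ≫ f} (e : f = g)
    (k : (λ_ f).inv ≫ s.inv ▷ f = eqToHom e ≫ c.hom) :
    c.hom ≫ s.hom ▷ f ≫ (λ_ f).hom = eqToHom e.symm := by
  subst e
  have := congrArg (· ≫ s.hom ▷ f ≫ (λ_ f).hom) k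
  simpa using this.symm

theorem comp_id_of {X Y : B} {f g : X ⟶ Y} {a : Y ⟶ Y} {s : a ≅ 𝟙 Y} {c : g ≅ f ≫ a} (e : f = g)
    (k : (ρ_ f).inv ≫ f ◁ s.inv = eqToHom e ≫ c.hom) :
    c.hom ≫ f ◁ s.hom ≫ (ρ_ f).hom = eqToHom e.symm := by
  subst e
  have := congrArg (· ≫ f ◁ s.hom ≫ (ρ_ f).hom) k
  simpa using this.symm

end

variable {n : ℕ} (C : NFoldCat.{t} n)

/-- The pseudofunctor in direction `k` underlying the universal pseudofunctor from `C` to `T C`. -/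
def T.line (k : Fin n) : PsFunOn (C.Line k) (T C) (fun X : C.Obj => T.mk X) where
  map f := T.hom (Edge.path f)
  mapId X := T.idIso k X
  mapComp f g := T.compIso f g
  map_assoc f g h := assoc_of _ (T.gamma_assoc f g h)
  map_id_comp f := id_comp_of _ (T.iota_right f)
  map_comp_id f := comp_id_of _ (T.iota_left f)

/-- The universal pseudofunctor from `C` to `T C`. -/
def T.unit : MixedPsFun C (T C) where
  obj X := ⟨X⟩
  line := T.line C
  sq h _ _ _ _ _ _ _ _ S := T.sq h S
  sq_hid h _ _ _ S hS := hid_of (T.sq_hid h S hS)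
  sq_vid h _ _ _ S hS := vid_of (T.sq_vid h S hS)
  sq_hcomp h _ _ _ _ _ _ _ _ _ _ _ _ _ S S' S'' hS := hcomp_of (T.sq_hcomp h S S' S'' hS)
  sq_vcomp h _ _ _ _ _ _ _ _ _ _ _ _ _ S S' S'' hS := vcomp_of (T.sq_vcomp h S S' S'' hS)
  cube h h' _ _ _ _ _ _ _ _ _ _ _ _ _ _ _ _ _ _ _ _ K' K J' J I' I hc :=
    T.sq_cube h h' K' K J' J I' I hc

end NFoldCat

/-- The composite of a pseudofunctor from a category to `B` with a pseudofunctor `B → D`. -/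
def PsFunOn.postcomp {E : Type t} [Category.{t} E] {B : Type*} [Bicategory B]
    {D : Type u} [Bicategory.{w, v} D] {o : E → B} (F : PsFunOn E B o) (H : B ⥤ᵖ D) :
    PsFunOn E D (fun X => H.obj (o X)) where
  map f := H.map (F.map f)
  mapId X := H.map₂Iso (F.mapId X) ≪≫ H.mapId (o X)
  mapComp f g := H.map₂Iso (F.mapComp f g) ≪≫ H.mapComp (F.map f) (F.map g)
  map_assoc f g h := by
    have := congrArg H.map₂ (F.map_assoc f g h)
    rw [PrelaxFunctor.map₂_eqToHom] at this
    rw [← this]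
    simp
  map_id_comp f := by
    have := congrArg H.map₂ (F.map_id_comp f)
    rw [PrelaxFunctor.map₂_eqToHom] at this
    rw [← this]
    simp
  map_comp_id f := by
    have := congrArg H.map₂ (F.map_comp_id f)
    rw [PrelaxFunctor.map₂_eqToHom] at this
    rw [← this]
    simp

namespace MixedPsFun

section

variable {B : Type*} [Bicategory B] {D : Type u} [Bicategory.{w, v} D] (H : B ⥤ᵖ D)

/-- The image under a pseudofunctor of a `2`-cell filling a square. -/
def mapSq {X Y Z W : B} {j : X ⟶ Y} {i : Z ⟶ W} {q : X ⟶ Z} {p : Y ⟶ W} (S : q ≫ i ⟶ j ≫ p) :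
    H.map q ≫ H.map i ⟶ H.map j ≫ H.map p :=
  (H.mapComp q i).inv ≫ H.map₂ S ≫ (H.mapComp j p).hom

theorem map₂_assoc_inv {X Y Z W : B} (f : X ⟶ Y) (g : Y ⟶ Z) (h : Z ⟶ W) :
    H.map₂ (α_ f g h).inv = (H.mapComp f (g ≫ h)).hom ≫ H.map f ◁ (H.mapComp g h).hom ≫
      (α_ _ _ _).inv ≫ (H.mapComp f g).inv ▷ H.map h ≫ (H.mapComp (f ≫ g) h).inv := by
  rw [← cancel_epi (H.map₂ (α_ f g h).hom), ← H.map₂_comp]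
  simp

theorem mapSq_hid {X Y : B} {f : X ⟶ Y} {a : X ⟶ X} {b : Y ⟶ Y} {S : a ≫ f ⟶ f ≫ b}
    {s : a ⟶ 𝟙 X} {t : b ⟶ 𝟙 Y} (h : S ≫ f ◁ t ≫ (ρ_ f).hom = s ▷ f ≫ (λ_ f).hom) :
    mapSq H S ≫ H.map f ◁ (H.map₂ t ≫ (H.mapId Y).hom) ≫ (ρ_ _).hom =
      (H.map₂ s ≫ (H.mapId X).hom) ▷ H.map f ≫ (λ_ _).hom := by
  have := congrArg H.map₂ h
  rw [← cancel_epi (H.mapComp _ _).hom]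
  simpa [mapSq] using this

theorem mapSq_vid {X Y : B} {f : X ⟶ Y} {a : X ⟶ X} {b : Y ⟶ Y} {S : f ≫ b ⟶ a ≫ f}
    {s : a ⟶ 𝟙 X} {t : b ⟶ 𝟙 Y} (h : S ≫ s ▷ f ≫ (λ_ f).hom = f ◁ t ≫ (ρ_ f).hom) :
    mapSq H S ≫ (H.map₂ s ≫ (H.mapId X).hom) ▷ H.map f ≫ (λ_ _).hom =
      H.map f ◁ (H.map₂ t ≫ (H.mapId Y).hom) ≫ (ρ_ _).hom := by
  have := congrArg H.map₂ h
  rw [← cancel_epi (H.mapComp _ _).hom]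
  simpa [mapSq] using this

theorem mapSq_hcomp {X₁ X₂ X₃ Y₁ Y₂ Y₃ : B}
    {j : X₁ ⟶ X₂} {j' : X₂ ⟶ X₃} {i : Y₁ ⟶ Y₂} {i' : Y₂ ⟶ Y₃} {j'' : X₁ ⟶ X₃} {i'' : Y₁ ⟶ Y₃}
    {p₁ : X₁ ⟶ Y₁} {p₂ : X₂ ⟶ Y₂} {p₃ : X₃ ⟶ Y₃}
    {S : p₁ ≫ i ⟶ j ≫ p₂} {S' : p₂ ≫ i' ⟶ j' ≫ p₃} {S'' : p₁ ≫ i'' ⟶ j'' ≫ p₃}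
    {c : i'' ⟶ i ≫ i'} {d : j'' ⟶ j ≫ j'}
    (h : p₁ ◁ c ≫ (α_ _ _ _).inv ≫ S ▷ i' ≫ (α_ _ _ _).hom ≫ j ◁ S' ≫ (α_ _ _ _).inv =
      S'' ≫ d ▷ p₃) :
    H.map p₁ ◁ (H.map₂ c ≫ (H.mapComp i i').hom) ≫ (α_ _ _ _).inv ≫
        mapSq H S ▷ H.map i' ≫ (α_ _ _ _).hom ≫ H.map j ◁ mapSq H S' ≫ (α_ _ _ _).inv =
      mapSq H S'' ≫ (H.map₂ d ≫ (H.mapComp j j').hom) ▷ H.map p₃ := by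
  have := congrArg H.map₂ h
  rw [← cancel_epi (H.mapComp _ _).hom, ← cancel_mono ((H.mapComp j j').inv ▷ _),
    ← cancel_mono (H.mapComp _ _).inv]
  simpa [mapSq, map₂_assoc_inv] using this

theorem mapSq_vcomp {X₁ X₂ X₃ Y₁ Y₂ Y₃ : B}
    {p₁ : X₁ ⟶ Y₁} {p₂ : X₂ ⟶ Y₂} {p₃ : X₃ ⟶ Y₃}
    {j : X₁ ⟶ X₂} {j' : X₂ ⟶ X₃} {i : Y₁ ⟶ Y₂} {i' : Y₂ ⟶ Y₃} {j'' : X₁ ⟶ X₃} {i'' : Y₁ ⟶ Y₃}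
    {S : j ≫ p₂ ⟶ p₁ ≫ i} {S' : j' ≫ p₃ ⟶ p₂ ≫ i'} {S'' : j'' ≫ p₃ ⟶ p₁ ≫ i''}
    {c : i'' ⟶ i ≫ i'} {d : j'' ⟶ j ≫ j'}
    (h : d ▷ p₃ ≫ (α_ _ _ _).hom ≫ j ◁ S' ≫ (α_ _ _ _).inv ≫ S ▷ i' ≫ (α_ _ _ _).hom =
      S'' ≫ p₁ ◁ c) :
    (H.map₂ d ≫ (H.mapComp j j').hom) ▷ H.map p₃ ≫ (α_ _ _ _).hom ≫
        H.map j ◁ mapSq H S' ≫ (α_ _ _ _).inv ≫ mapSq H S ▷ H.map i' ≫ (α_ _ _ _).hom =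
      mapSq H S'' ≫ H.map p₁ ◁ (H.map₂ c ≫ (H.mapComp i i').hom) := by
  have := congrArg H.map₂ h
  rw [← cancel_epi (H.mapComp _ _).hom, ← cancel_mono (_ ◁ (H.mapComp i i').inv),
    ← cancel_mono (H.mapComp _ _).inv]
  simpa [mapSq, map₂_assoc_inv] using this

theorem mapSq_cube {X' Y' Z' W' X Y Z W : B}
    {b' : X' ⟶ Y'} {a' : Z' ⟶ W'} {b : X ⟶ Y} {a : Z ⟶ W}
    {q' : X' ⟶ Z'} {p' : Y' ⟶ W'} {q : X ⟶ Z} {p : Y ⟶ W}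
    {x : X' ⟶ X} {y : Y' ⟶ Y} {z : Z' ⟶ Z} {w : W' ⟶ W}
    {K' : q' ≫ a' ⟶ b' ≫ p'} {K : q ≫ a ⟶ b ≫ p} {J' : x ≫ b ⟶ b' ≫ y} {J : z ≫ a ⟶ a' ≫ w}
    {I' : x ≫ q ⟶ q' ≫ z} {I : y ≫ p ⟶ p' ≫ w}
    (h : x ◁ K ≫ (α_ _ _ _).inv ≫ J' ▷ p ≫ (α_ _ _ _).hom ≫ b' ◁ I =
      (α_ _ _ _).inv ≫ I' ▷ a ≫ (α_ _ _ _).hom ≫ q' ◁ J ≫ (α_ _ _ _).inv ≫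
        K' ▷ w ≫ (α_ _ _ _).hom) :
    H.map x ◁ mapSq H K ≫ (α_ _ _ _).inv ≫ mapSq H J' ▷ H.map p ≫ (α_ _ _ _).hom ≫
        H.map b' ◁ mapSq H I =
      (α_ _ _ _).inv ≫ mapSq H I' ▷ H.map a ≫ (α_ _ _ _).hom ≫ H.map q' ◁ mapSq H J ≫
        (α_ _ _ _).inv ≫ mapSq H K' ▷ H.map w ≫ (α_ _ _ _).hom := by
  have := congrArg H.map₂ h
  rw [← cancel_epi (_ ◁ (H.mapComp q a).hom), ← cancel_epi (H.mapComp x _).hom,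
    ← cancel_mono (_ ◁ (H.mapComp p' w).inv), ← cancel_mono (H.mapComp _ _).inv]
  simpa [mapSq, map₂_assoc_inv] using this

end

variable {n : ℕ} {C : NFoldCat.{t} n} {B : Type*} [Bicategory B] {D : Type u} [Bicategory.{w, v} D]

/-- The composite of a pseudofunctor `C → B` with a pseudofunctor `H : B → D`. -/
def postcomp (F : MixedPsFun C B) (H : B ⥤ᵖ D) : MixedPsFun C D where
  obj X := H.obj (F.obj X)
  line k := (F.line k).postcomp H
  sq h _ _ _ _ _ _ _ _ S := mapSq H (F.sq h S)
  sq_hid h _ _ _ S hS := mapSq_hid H (F.sq_hid h S hS)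
  sq_vid h _ _ _ S hS := mapSq_vid H (F.sq_vid h S hS)
  sq_hcomp h _ _ _ _ _ _ _ _ _ _ _ _ _ S S' S'' hS := mapSq_hcomp H (F.sq_hcomp h S S' S'' hS)
  sq_vcomp h _ _ _ _ _ _ _ _ _ _ _ _ _ S S' S'' hS := mapSq_vcomp H (F.sq_vcomp h S S' S'' hS)
  cube h h' _ _ _ _ _ _ _ _ _ _ _ _ _ _ _ _ _ _ _ _ K' K J' J I' I hc :=
    mapSq_cube H (F.cube h h' K' K J' J I' I hc)

end MixedPsFun

namespace MixedPsFun

section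

variable {B : Type*} [Bicategory B] {D : Type u} [Bicategory.{w, v} D] {H H' : B ⥤ᵖ D} (η : H ⟶ H')

theorem nat_mapId {X : B} {a : X ⟶ X} (s : a ⟶ 𝟙 X) :
    (η.naturality a).hom ≫ η.app X ◁ (H'.map₂ s ≫ (H'.mapId X).hom) =
      (H.map₂ s ≫ (H.mapId X).hom) ▷ η.app X ≫ (λ_ (η.app X)).hom ≫ (ρ_ (η.app X)).inv := by
  rw [whiskerLeft_comp, ← η.naturality_naturality_assoc, η.naturality_id, comp_whiskerRight,
    Category.assoc]

theorem nat_mapComp {X Y Z : B} {f : X ⟶ Y} {g : Y ⟶ Z} {l : X ⟶ Z} (c : l ⟶ f ≫ g) :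
    (η.naturality l).hom ≫ η.app X ◁ (H'.map₂ c ≫ (H'.mapComp f g).hom) =
      (H.map₂ c ≫ (H.mapComp f g).hom) ▷ η.app Z ≫ (α_ _ _ _).hom ≫
        H.map f ◁ (η.naturality g).hom ≫ (α_ _ _ _).inv ≫ (η.naturality f).hom ▷ H'.map g ≫
        (α_ _ _ _).hom := by
  rw [whiskerLeft_comp, ← η.naturality_naturality_assoc, η.naturality_comp, comp_whiskerRight,
    Category.assoc]

theorem nat_mapSq {X Y Z W : B} {j : X ⟶ Y} {i : Z ⟶ W} {q : X ⟶ Z} {p : Y ⟶ W}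
    (S : q ≫ i ⟶ j ≫ p) :
    mapSq H S ▷ η.app W ≫ (α_ _ _ _).hom ≫ H.map j ◁ (η.naturality p).hom ≫ (α_ _ _ _).inv ≫
        (η.naturality j).hom ▷ H'.map p ≫ (α_ _ _ _).hom =
      (α_ _ _ _).hom ≫ H.map q ◁ (η.naturality i).hom ≫ (α_ _ _ _).inv ≫
        (η.naturality q).hom ▷ H'.map i ≫ (α_ _ _ _).hom ≫ η.app X ◁ mapSq H' S := by
  rw [← cancel_epi ((H.mapComp q i).hom ▷ _)]
  have h₂ := η.naturality_comp q i =≫ (η.app X ◁ mapSq H' S)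
  simp only [Category.assoc] at h₂
  rw [← h₂]
  have h₁ := nat_mapComp η S
  simp only [mapSq, ← whiskerLeft_comp, ← comp_whiskerRight_assoc, Iso.hom_inv_id_assoc]
  exact h₁.symm

end

variable {n : ℕ} {C : NFoldCat.{t} n} {B : Type*} [Bicategory B] {D : Type u} [Bicategory.{w, v} D]

theorem eq_conj {F G : MixedPsFun C D} {f f' g g' : F ⟶ G} (h : f = g) (h' : g' = f')
    (a : f ⟶ f') (b : g ⟶ g')
    (hab : ∀ X, Modif.app a X = eqToHom (by rw [h]) ≫ Modif.app b X ≫ eqToHom (by rw [h'])) :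
    a = eqToHom h ≫ b ≫ eqToHom h' := by
  subst h h'
  exact (hom_ext fun X => by simpa using hab X).trans
    ((Category.id_comp _).trans (Category.comp_id b)).symm

/-- The morphism of composites induced by a pseudonatural transformation. -/
def postcompMap (F : MixedPsFun C B) {H H' : B ⥤ᵖ D} (η : H ⟶ H') :
    F.postcomp H ⟶ F.postcomp H' where
  app X := η.app (F.obj X)
  nat {k} _ _ f := η.naturality ((F.line k).map f)
  nat_id k X := nat_mapId η ((F.line k).mapId X).hom
  nat_comp {k} _ _ _ f g := nat_mapComp η ((F.line k).mapComp f g).hom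
  nat_sq h _ _ _ _ _ _ _ _ S := nat_mapSq η (F.sq h S)

/-- The `2`-cell of composites induced by a modification. -/
def postcompMap₂ (F : MixedPsFun C B) {H H' : B ⥤ᵖ D} {η θ : H ⟶ H'} (Γ : η ⟶ θ) :
    F.postcompMap η ⟶ F.postcompMap θ where
  app X := Γ.as.app (F.obj X)
  nat {k} _ _ f := Γ.as.naturality ((F.line k).map f)

/-- The `2`-functor `PsFun(B, D) → PsFun(C, D)` given by composition with a pseudofunctor
`C → B`. -/
def precomp [Bicategory.Strict B] (F : MixedPsFun C B) (D : Type u) [Bicategory.{w, v} D]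
    [Bicategory.Strict D] :
    StrictPseudofunctor (B ⥤ᵖ D) (MixedPsFun C D) :=
  StrictPseudofunctor.mk''
    { obj := F.postcomp
      map := F.postcompMap
      map₂ := F.postcompMap₂
      map₂_id := fun _ => rfl
      map₂_comp := fun _ _ => rfl
      map_id := fun _ => rfl
      map_comp := fun _ _ => rfl
      map₂_whisker_left := fun _ _ _ _ => eq_conj _ _ _ _ fun _ =>
        ((Category.id_comp _).trans (Category.comp_id _)).symm
      map₂_whisker_right := fun _ _ => eq_conj _ _ _ _ fun _ =>
        ((Category.id_comp _).trans (Category.comp_id _)).symm }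

end MixedPsFun

/-- The `D^{Ob C}`-functor `Ψ : PsFun(T C, D) → PsFun(C, D)`: composition with the universal
pseudofunctor from `C` to `T C`. -/
def Psi {n : ℕ} (C : NFoldCat.{t} n) (D : Type u) [Bicategory.{w, v} D] [Bicategory.Strict D] :
    OverFunctor (PsFun.forget C D) (MixedPsFun.forget C D) where
  functor := (T.unit C).precomp D
  comm := StrictPseudofunctor.ext_prelax rfl

namespace MixedPsFun

section

variable {D : Type u} [Bicategory.{w, v} D]

theorem coh_assoc {X Y Z W V : D} {p : X ⟶ Y} {q : Y ⟶ Z} {r : Z ⟶ W} {e : W ⟶ V}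
    {pq : X ⟶ Z} {qr : Y ⟶ W} {l l' : X ⟶ W} (a : l ⟶ pq ≫ r) (b : pq ⟶ p ≫ q) (i : l ⟶ l')
    (c : l' ⟶ p ≫ qr) (d : qr ⟶ q ≫ r)
    (h : a ≫ b ▷ r ≫ (α_ _ _ _).hom = i ≫ c ≫ p ◁ d) :
    (a ▷ e ≫ (α_ _ _ _).hom) ≫ b ▷ (r ≫ e) ≫ (α_ _ _ _).hom =
      i ▷ e ≫ (c ▷ e ≫ (α_ _ _ _).hom) ≫ p ◁ (d ▷ e ≫ (α_ _ _ _).hom) := by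
  calc
    _ = (a ≫ b ▷ r ≫ (α_ _ _ _).hom) ▷ e ⊗≫ 𝟙 _ := by bicategory
    _ = _ := by rw [h]; bicategory

theorem coh_nil {X Y Z : D} {p l : X ⟶ Y} (e : Y ⟶ Z) (c : l ⟶ 𝟙 X ≫ p) :
    (c ▷ e ≫ (α_ _ _ _).hom) ≫ (λ_ (p ≫ e)).hom = (c ≫ (λ_ p).hom) ▷ e := by
  bicategory

theorem coh_mid {X Y Z W : D} {p : X ⟶ Y} {u v : Y ⟶ Z} {r : Z ⟶ W} (β : u ⟶ v)
    {pu pv : X ⟶ Z} {ur vr : Y ⟶ W} {lu lu' lv lv' : X ⟶ W}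
    {au : lu ≅ pu ≫ r} {bu : pu ≅ p ≫ u} {Eu : lu ≅ lu'} {cu : lu' ≅ p ≫ ur} {du : ur ≅ u ≫ r}
    {av : lv ≅ pv ≫ r} {bv : pv ≅ p ≫ v} {Ev : lv ≅ lv'} {cv : lv' ≅ p ≫ vr} {dv : vr ≅ v ≫ r}
    (hu : au.hom ≫ bu.hom ▷ r ≫ (α_ _ _ _).hom = Eu.hom ≫ cu.hom ≫ p ◁ du.hom)
    (hv : av.hom ≫ bv.hom ▷ r ≫ (α_ _ _ _).hom = Ev.hom ≫ cv.hom ≫ p ◁ dv.hom) :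
    au.hom ≫ (bu.hom ≫ p ◁ β ≫ bv.inv) ▷ r ≫ av.inv =
      Eu.hom ≫ (cu.hom ≫ p ◁ (du.hom ≫ β ▷ r ≫ dv.inv) ≫ cv.inv) ≫ Ev.inv := by
  rw [← cancel_mono (av.hom ≫ bv.hom ▷ r ≫ (α_ _ _ _).hom)]
  conv_rhs => rw [hv]
  have := hu =≫ (p ◁ β ▷ r)
  simp only [Category.assoc] at this
  simpa using this

theorem coh_left {X Y Z W : D} {p : X ⟶ Y} {q : Y ⟶ Z} {u v : Z ⟶ W} (β : u ⟶ v)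
    {pq : X ⟶ Z} {qu qv : Y ⟶ W} {lu lu' lv lv' : X ⟶ W} {b : pq ≅ p ≫ q}
    {au : lu ≅ pq ≫ u} {Eu : lu ≅ lu'} {cu : lu' ≅ p ≫ qu} {du : qu ≅ q ≫ u}
    {av : lv ≅ pq ≫ v} {Ev : lv ≅ lv'} {cv : lv' ≅ p ≫ qv} {dv : qv ≅ q ≫ v}
    (hu : au.hom ≫ b.hom ▷ u ≫ (α_ _ _ _).hom = Eu.hom ≫ cu.hom ≫ p ◁ du.hom)
    (hv : av.hom ≫ b.hom ▷ v ≫ (α_ _ _ _).hom = Ev.hom ≫ cv.hom ≫ p ◁ dv.hom) :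
    au.hom ≫ pq ◁ β ≫ av.inv =
      Eu.hom ≫ (cu.hom ≫ p ◁ (du.hom ≫ q ◁ β ≫ dv.inv) ≫ cv.inv) ≫ Ev.inv := by
  rw [← cancel_mono (av.hom ≫ b.hom ▷ v ≫ (α_ _ _ _).hom)]
  conv_rhs => rw [hv]
  have := hu =≫ (p ◁ q ◁ β)
  simp only [Category.assoc] at this
  simpa [whisker_exchange_assoc] using this

theorem coh_right {X Y Z W : D} {u v : X ⟶ Y} {q : Y ⟶ Z} {r : Z ⟶ W} (β : u ⟶ v)
    {uq vq : X ⟶ Z} {qr : Y ⟶ W} {lu lu' lv lv' : X ⟶ W} {d : qr ≅ q ≫ r}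
    {au : lu ≅ uq ≫ r} {bu : uq ≅ u ≫ q} {Eu : lu ≅ lu'} {cu : lu' ≅ u ≫ qr}
    {av : lv ≅ vq ≫ r} {bv : vq ≅ v ≫ q} {Ev : lv ≅ lv'} {cv : lv' ≅ v ≫ qr}
    (hu : au.hom ≫ bu.hom ▷ r ≫ (α_ _ _ _).hom = Eu.hom ≫ cu.hom ≫ u ◁ d.hom)
    (hv : av.hom ≫ bv.hom ▷ r ≫ (α_ _ _ _).hom = Ev.hom ≫ cv.hom ≫ v ◁ d.hom) :
    cu.hom ≫ β ▷ qr ≫ cv.inv =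
      Eu.inv ≫ (au.hom ≫ (bu.hom ≫ β ▷ q ≫ bv.inv) ▷ r ≫ av.inv) ≫ Ev.hom := by
  rw [← cancel_mono (cv.hom ≫ v ◁ d.hom), ← cancel_epi Eu.hom]
  conv_rhs => simp only [Category.assoc, ← hv]
  have := hu =≫ (β ▷ (q ≫ r))
  simp only [Category.assoc] at this
  rw [whisker_exchange] at this
  simpa using this.symm

theorem coh_unit {X Y : D} {u v u' v' : X ⟶ Y} (β : u ⟶ v) {pu : u' ≅ 𝟙 X ≫ u}
    {pv : v' ≅ 𝟙 X ≫ v} {Eu : u' ≅ u} {Ev : v' ≅ v} (hu : pu.hom ≫ (λ_ _).hom = Eu.hom)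
    (hv : pv.hom ≫ (λ_ _).hom = Ev.hom) :
    pu.hom ≫ 𝟙 X ◁ β ≫ pv.inv = Eu.hom ≫ β ≫ Ev.inv := by
  rw [← cancel_mono (pv.hom ≫ (λ_ _).hom)]
  conv_rhs => rw [hv]
  simp [← hu]

end

variable {n : ℕ} {C : NFoldCat.{t} n} {D : Type u} [Bicategory.{w, v} D] (F : MixedPsFun C D)

/-- The image of a morphism in direction `k`. -/
def edge {k : Fin n} {X Y : C.Obj} (e : Edge k X Y) : F.obj X ⟶ F.obj Y := (F.line k).map e

/-- The morphism of `D` associated with a path: the composite of the images of its edges. -/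
def pathMap {X : C.Obj} : ∀ {Y : C.Obj}, TPath X Y → (F.obj X ⟶ F.obj Y)
  | _, .nil => 𝟙 (F.obj X)
  | _, .cons p e => pathMap p ≫ F.edge e

/-- The structural isomorphism for a concatenation of paths. -/
def pathComp {X Y : C.Obj} (p : TPath X Y) :
    ∀ {Z : C.Obj} (q : TPath Y Z), F.pathMap (p.comp q) ≅ F.pathMap p ≫ F.pathMap q
  | _, .nil => (ρ_ (F.pathMap p)).symm
  | _, .cons q e => whiskerRightIso (pathComp p q) (F.edge e) ≪≫ α_ _ _ _

theorem eqToHom_pathMap {X Y Z : C.Obj} {k : Fin n} {p q : TPath X Y} (h : p = q)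
    (e : Edge k Y Z) :
    eqToHom (congrArg F.pathMap h) ▷ F.edge e =
      (eqToHom (congrArg (fun p => F.pathMap (p.cons e)) h) :
        F.pathMap (p.cons e) ⟶ F.pathMap (q.cons e)) := by
  subst h; exact id_whiskerRight _ _

theorem pathComp_assoc {X Y Z W : C.Obj} (p : TPath X Y) (q : TPath Y Z) (r : TPath Z W) :
    (F.pathComp (p.comp q) r).hom ≫ (F.pathComp p q).hom ▷ F.pathMap r ≫ (α_ _ _ _).hom =
      eqToHom (congrArg F.pathMap (TPath.comp_assoc p q r)) ≫ (F.pathComp p (q.comp r)).hom ≫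
        F.pathMap p ◁ (F.pathComp q r).hom := by
  induction r with
  | nil =>
    change (ρ_ _).inv ≫ (F.pathComp p q).hom ▷ 𝟙 _ ≫ (α_ _ _ _).hom = 𝟙 _ ≫
      (F.pathComp p q).hom ≫ F.pathMap p ◁ (ρ_ _).inv
    simp
  | cons r e ih =>
    refine (coh_assoc (e := F.edge e) _ _ _ _ _ ih).trans ?_
    rw [F.eqToHom_pathMap (TPath.comp_assoc p q r) e]
    rfl

theorem pathComp_nil_left {X Y : C.Obj} (p : TPath X Y) :
    (F.pathComp .nil p).hom ≫ (λ_ (F.pathMap p)).hom =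
      eqToHom (congrArg F.pathMap (TPath.nil_comp p)) := by
  induction p with
  | nil =>
    change (ρ_ (𝟙 _)).inv ≫ (λ_ (𝟙 _)).hom = 𝟙 _
    rw [unitors_equal, Iso.inv_hom_id]
  | cons p e ih =>
    exact (coh_nil (F.edge e) _).trans ((congrArg (· ▷ F.edge e) ih).trans
      (F.eqToHom_pathMap (TPath.nil_comp p) e))

/-- The `2`-cell induced by `β` and the identity of a path on the source side. -/
def conjL {X Y Z : C.Obj} (f : TPath X Y) {u v : TPath Y Z} (β : F.pathMap u ⟶ F.pathMap v) :
    F.pathMap (f.comp u) ⟶ F.pathMap (f.comp v) :=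
  (F.pathComp f u).hom ≫ F.pathMap f ◁ β ≫ (F.pathComp f v).inv

/-- The `2`-cell induced by `β` and the identity of a path on the target side. -/
def conjR {X Y Z : C.Obj} {u v : TPath X Y} (β : F.pathMap u ⟶ F.pathMap v) (g : TPath Y Z) :
    F.pathMap (u.comp g) ⟶ F.pathMap (v.comp g) :=
  (F.pathComp u g).hom ≫ β ▷ F.pathMap g ≫ (F.pathComp v g).inv

theorem conjL_id {X Y Z : C.Obj} (f : TPath X Y) (u : TPath Y Z) :
    F.conjL f (𝟙 (F.pathMap u)) = 𝟙 _ := by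
  simp [conjL]

theorem conjR_id {X Y Z : C.Obj} (u : TPath X Y) (g : TPath Y Z) :
    F.conjR (𝟙 (F.pathMap u)) g = 𝟙 _ := by
  simp [conjR]

theorem conjL_comp {X Y Z : C.Obj} (f : TPath X Y) {u v w : TPath Y Z}
    (β : F.pathMap u ⟶ F.pathMap v) (γ : F.pathMap v ⟶ F.pathMap w) :
    F.conjL f (β ≫ γ) = F.conjL f β ≫ F.conjL f γ := by
  simp [conjL]

theorem conjR_comp {X Y Z : C.Obj} {u v w : TPath X Y}
    (β : F.pathMap u ⟶ F.pathMap v) (γ : F.pathMap v ⟶ F.pathMap w) (g : TPath Y Z) :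
    F.conjR (β ≫ γ) g = F.conjR β g ≫ F.conjR γ g := by
  simp [conjR]

theorem conjL_eqToHom {X Y Z : C.Obj} (f : TPath X Y) {u v : TPath Y Z} (h : u = v) :
    F.conjL f (eqToHom (congrArg F.pathMap h)) =
      eqToHom (congrArg (fun u => F.pathMap (f.comp u)) h) := by
  subst h; exact F.conjL_id f u

theorem conjR_eqToHom {X Y Z : C.Obj} {u v : TPath X Y} (h : u = v) (g : TPath Y Z) :
    F.conjR (eqToHom (congrArg F.pathMap h)) g =
      eqToHom (congrArg (fun u => F.pathMap (u.comp g)) h) := by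
  subst h; exact F.conjR_id u g

theorem conjL_nil {X Y : C.Obj} {u v : TPath X Y} (β : F.pathMap u ⟶ F.pathMap v) :
    F.conjL .nil β = eqToHom (congrArg F.pathMap (TPath.nil_comp u)) ≫ β ≫
      eqToHom (congrArg F.pathMap (TPath.nil_comp v).symm) := by
  exact coh_unit (Eu := eqToIso (congrArg F.pathMap (TPath.nil_comp u)))
    (Ev := eqToIso (congrArg F.pathMap (TPath.nil_comp v))) β (F.pathComp_nil_left u)
    (F.pathComp_nil_left v)

theorem conjR_nil {X Y : C.Obj} {u v : TPath X Y} (β : F.pathMap u ⟶ F.pathMap v) :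
    F.conjR β .nil = eqToHom (congrArg F.pathMap (TPath.comp_nil u)) ≫ β ≫
      eqToHom (congrArg F.pathMap (TPath.comp_nil v).symm) := by
  change (ρ_ _).inv ≫ β ▷ 𝟙 _ ≫ (ρ_ _).hom = 𝟙 _ ≫ β ≫ 𝟙 _
  simp

theorem conjL_conjL {X Y Z W : C.Obj} (f : TPath X Y) (g : TPath Y Z) {u v : TPath Z W}
    (β : F.pathMap u ⟶ F.pathMap v) :
    F.conjL (f.comp g) β = eqToHom (congrArg F.pathMap (TPath.comp_assoc f g u)) ≫
      F.conjL f (F.conjL g β) ≫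
        eqToHom (congrArg F.pathMap (TPath.comp_assoc f g v).symm) := by
  exact coh_left (Eu := eqToIso (congrArg F.pathMap (TPath.comp_assoc f g u)))
    (Ev := eqToIso (congrArg F.pathMap (TPath.comp_assoc f g v))) β (F.pathComp_assoc f g u)
    (F.pathComp_assoc f g v)

theorem conjR_conjR {X Y Z W : C.Obj} {u v : TPath X Y} (β : F.pathMap u ⟶ F.pathMap v)
    (f : TPath Y Z) (g : TPath Z W) :
    F.conjR β (f.comp g) = eqToHom (congrArg F.pathMap (TPath.comp_assoc u f g).symm) ≫
      F.conjR (F.conjR β f) g ≫ eqToHom (congrArg F.pathMap (TPath.comp_assoc v f g)) := by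
  exact coh_right (Eu := eqToIso (congrArg F.pathMap (TPath.comp_assoc u f g)))
    (Ev := eqToIso (congrArg F.pathMap (TPath.comp_assoc v f g))) β (F.pathComp_assoc u f g)
    (F.pathComp_assoc v f g)

theorem conjR_conjL {X Y Z W : C.Obj} (f : TPath X Y) {u v : TPath Y Z}
    (β : F.pathMap u ⟶ F.pathMap v) (g : TPath Z W) :
    F.conjR (F.conjL f β) g = eqToHom (congrArg F.pathMap (TPath.comp_assoc f u g)) ≫
      F.conjL f (F.conjR β g) ≫ eqToHom (congrArg F.pathMap (TPath.comp_assoc f v g).symm) := by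
  exact coh_mid (Eu := eqToIso (congrArg F.pathMap (TPath.comp_assoc f u g)))
    (Ev := eqToIso (congrArg F.pathMap (TPath.comp_assoc f v g))) β (F.pathComp_assoc f u g)
    (F.pathComp_assoc f v g)

theorem conj_exchange {X Y Z : C.Obj} {f f' : TPath X Y} {g g' : TPath Y Z}
    (s : F.pathMap f ⟶ F.pathMap f') (t : F.pathMap g ⟶ F.pathMap g') :
    F.conjL f t ≫ F.conjR s g' = F.conjR s g ≫ F.conjL f' t := by
  simp [conjL, conjR, whisker_exchange_assoc]

end MixedPsFun

namespace MixedPsFun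

variable {n : ℕ} {C : NFoldCat.{t} n} {D : Type u} [Bicategory.{w, v} D] (F : MixedPsFun C D)

/-- The coherence constraint for identities in direction `k`. -/
def edgeId (k : Fin n) (X : C.Obj) : F.edge (Edge.id k X) ≅ 𝟙 (F.obj X) := (F.line k).mapId X

/-- The coherence constraint for compositions in direction `k`. -/
def edgeComp {k : Fin n} {X Y Z : C.Obj} (f : Edge k X Y) (g : Edge k Y Z) :
    F.edge (f.comp g) ≅ F.edge f ≫ F.edge g := (F.line k).mapComp f g

/-- The `2`-cell of a square. -/
def face {k k' : Fin n} (h : k < k') {X Y Z W : C.Obj} {j : Edge k X Y} {i : Edge k Z W}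
    {q : Edge k' X Z} {p : Edge k' Y W} (S : Sq j i q p) :
    F.edge q ≫ F.edge i ⟶ F.edge j ≫ F.edge p := F.sq h S

/-- The `2`-cell of `D` associated with a basic transformation. -/
def basicMap : ∀ {X Y : C.Obj} {u v : TPath X Y}, C.Basic u v → (F.pathMap u ⟶ F.pathMap v)
  | _, _, _, _, .iota k X => (F.edgeId k X).inv ≫ (λ_ (F.edge (Edge.id k X))).inv
  | _, _, _, _, .theta k X => (λ_ (F.edge (Edge.id k X))).hom ≫ (F.edgeId k X).hom
  | _, _, _, _, .gamma f g =>
    (α_ (𝟙 (F.obj _)) (F.edge f) (F.edge g)).hom ≫ 𝟙 (F.obj _) ◁ (F.edgeComp f g).inv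
  | _, _, _, _, .delta f g =>
    𝟙 (F.obj _) ◁ (F.edgeComp f g).hom ≫ (α_ (𝟙 (F.obj _)) (F.edge f) (F.edge g)).inv
  | _, _, _, _, .sigma (j := j) (i := i) (q := q) (p := p) h S =>
    (α_ (𝟙 (F.obj _)) (F.edge q) (F.edge i)).hom ≫ 𝟙 (F.obj _) ◁ F.face h S ≫
      (α_ (𝟙 (F.obj _)) (F.edge j) (F.edge p)).inv

/-- The `2`-cell of `D` associated with an atomic transformation. -/
def atomicMap {X Y : C.Obj} {p q : TPath X Y} (a : Atomic p q) : F.pathMap p ⟶ F.pathMap q :=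
  eqToHom (congrArg F.pathMap a.hp) ≫ F.conjR (F.conjL a.f (F.basicMap a.b)) a.g ≫
    eqToHom (congrArg F.pathMap a.hq.symm)

/-- The `2`-cell of `D` associated with a transformation. -/
def trafoMap {X Y : C.Obj} {p : TPath X Y} :
    ∀ {q : TPath X Y}, Trafo p q → (F.pathMap p ⟶ F.pathMap q)
  | _, .nil => 𝟙 _
  | _, .cons t a => trafoMap t ≫ F.atomicMap a

theorem trafoMap_comp {X Y : C.Obj} {p q r : TPath X Y} (s : Trafo p q) (t : Trafo q r) :
    F.trafoMap (s.comp t) = F.trafoMap s ≫ F.trafoMap t := by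
  induction t with
  | nil => exact (Category.comp_id _).symm
  | cons t a ih => exact (congrArg (· ≫ F.atomicMap a) ih).trans (Category.assoc _ _ _)

theorem trafoMap_comp_eq {X Y : C.Obj} {p q r : TPath X Y} {s : Trafo p q} {t : Trafo q r}
    {x : F.pathMap p ⟶ F.pathMap q} {y : F.pathMap q ⟶ F.pathMap r} (h : F.trafoMap s = x)
    (h' : F.trafoMap t = y) : F.trafoMap (s.comp t) = x ≫ y := by
  rw [trafoMap_comp, h, h']

theorem trafoMap_whiskered {X W Z Y : C.Obj} (f : TPath X W) {u v : TPath W Z} (b : C.Basic u v)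
    (g : TPath Z Y) :
    F.trafoMap (Trafo.whiskered f b g) = F.conjR (F.conjL f (F.basicMap b)) g := by
  simp [Trafo.whiskered, trafoMap, atomicMap]

theorem eqToHom_conj {K : Type*} [Category K] {x y x' y' x'' y'' : K} (β : x ⟶ y) (h₁ : x = x')
    (h₂ : x' = x'') (h₃ : x'' = x) (h₁' : y' = y) (h₂' : y'' = y') (h₃' : y = y'') :
    𝟙 x ≫ eqToHom h₁ ≫ (eqToHom h₂ ≫ (eqToHom h₃ ≫ β ≫ eqToHom h₃') ≫ eqToHom h₂') ≫
      eqToHom h₁' = β := by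
  subst h₁ h₂ h₁' h₂'
  simp

theorem trafoMap_of {X Y : C.Obj} {p q u v : TPath X Y} (b : C.Basic u v) (hp : p = u)
    (hq : q = v) :
    F.trafoMap (Trafo.of b hp hq) = eqToHom (congrArg F.pathMap hp) ≫ F.basicMap b ≫
      eqToHom (congrArg F.pathMap hq.symm) := by
  subst hp hq
  rw [Trafo.of, trafoMap, trafoMap, atomicMap, conjR_nil, conjL_nil]
  refine Eq.trans ?_ ((Category.id_comp _).trans (Category.comp_id _)).symm
  exact eqToHom_conj _ _ _ _ _ _ _

theorem trafoMap_of_rfl {X Y : C.Obj} {u v : TPath X Y} (b : C.Basic u v) :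
    F.trafoMap (Trafo.of b) = F.basicMap b := by
  simp [trafoMap_of]

theorem trafoMap_whiskered_nil {X Y Z : C.Obj} (f : TPath X Y) {u v : TPath Y Z}
    (b : C.Basic u v) :
    F.trafoMap (Trafo.whiskered f b .nil) = F.conjL f (F.basicMap b) := by
  rw [trafoMap_whiskered, conjR_nil]
  exact (Category.id_comp _).trans (Category.comp_id _)

theorem coh_path {X Y Z : D} {u v : X ⟶ Y} (β : u ⟶ v) (e : Y ⟶ Z) :
    ((ρ_ u).inv ▷ e ≫ (α_ _ _ _).hom) ≫ β ▷ (𝟙 Y ≫ e) ≫ ((α_ _ _ _).inv ≫ (ρ_ v).hom ▷ e) =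
      β ▷ e := by
  simp

theorem trafoMap_whiskered_path {X Y Z W : C.Obj} (f : TPath X Y) {u v : TPath Y Z}
    (b : C.Basic u v) {k : Fin n} (e : Edge k Z W) :
    F.trafoMap (Trafo.whiskered f b e.path) = F.conjL f (F.basicMap b) ▷ F.edge e :=
  (F.trafoMap_whiskered f b e.path).trans (coh_path _ _)

theorem conjL_iota {X Y : C.Obj} (f : TPath X Y) (k : Fin n) :
    F.conjL f (F.basicMap (.iota k Y)) = (ρ_ (F.pathMap f)).inv ≫
      F.pathMap f ◁ (F.edgeId k Y).inv := by
  change (ρ_ (F.pathMap f)).inv ≫ F.pathMap f ◁ ((F.edgeId k Y).inv ≫ (λ_ _).inv) ≫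
    ((α_ _ _ _).inv ≫ (ρ_ (F.pathMap f)).hom ▷ F.edge _) = _
  simp

theorem conjL_gamma {X Y Z W : C.Obj} (p : TPath X Y) {k : Fin n} (f : Edge k Y Z)
    (g : Edge k Z W) :
    F.conjL p (F.basicMap (.gamma f g)) =
      (α_ (F.pathMap p) (F.edge f) (F.edge g)).hom ≫ F.pathMap p ◁ (F.edgeComp f g).inv := by
  change (((ρ_ (F.pathMap p)).inv ▷ F.edge f ≫ (α_ _ _ _).hom) ▷ F.edge g ≫ (α_ _ _ _).hom) ≫
    F.pathMap p ◁ ((α_ _ _ _).hom ≫ 𝟙 _ ◁ (F.edgeComp f g).inv) ≫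
    ((α_ _ _ _).inv ≫ (ρ_ (F.pathMap p)).hom ▷ F.edge _) = _
  simp

theorem conjL_delta {X Y Z W : C.Obj} (p : TPath X Y) {k : Fin n} (f : Edge k Y Z)
    (g : Edge k Z W) :
    F.conjL p (F.basicMap (.delta f g)) =
      F.pathMap p ◁ (F.edgeComp f g).hom ≫ (α_ (F.pathMap p) (F.edge f) (F.edge g)).inv := by
  change ((ρ_ (F.pathMap p)).inv ▷ F.edge _ ≫ (α_ _ _ _).hom) ≫
    F.pathMap p ◁ (𝟙 _ ◁ (F.edgeComp f g).hom ≫ (α_ _ _ _).inv) ≫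
    ((α_ _ _ _).inv ≫ ((α_ _ _ _).inv ≫ (ρ_ (F.pathMap p)).hom ▷ F.edge f) ▷ F.edge g) = _
  simp

theorem conjL_sigma {V : C.Obj} {k k' : Fin n} (h : k < k') {X Y Z W : C.Obj} (r : TPath V X)
    {j : Edge k X Y} {i : Edge k Z W} {q : Edge k' X Z} {p : Edge k' Y W} (S : Sq j i q p) :
    F.conjL r (F.basicMap (.sigma h S)) =
      (α_ (F.pathMap r) (F.edge q) (F.edge i)).hom ≫ F.pathMap r ◁ F.face h S ≫
        (α_ (F.pathMap r) (F.edge j) (F.edge p)).inv := by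
  change (((ρ_ (F.pathMap r)).inv ▷ F.edge q ≫ (α_ _ _ _).hom) ▷ F.edge i ≫ (α_ _ _ _).hom) ≫
    F.pathMap r ◁ ((α_ _ _ _).hom ≫ 𝟙 _ ◁ F.face h S ≫ (α_ _ _ _).inv) ≫
    ((α_ _ _ _).inv ≫ ((α_ _ _ _).inv ≫ (ρ_ (F.pathMap r)).hom ▷ F.edge j) ▷ F.edge p) = _
  simp

theorem trafoMap_whiskerL {X Y Z : C.Obj} (h : TPath X Y) {p q : TPath Y Z} (t : Trafo p q) :
    F.trafoMap (t.whiskerL h) = F.conjL h (F.trafoMap t) := by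
  induction t with
  | nil => exact (F.conjL_id _ _).symm
  | cons t a ih =>
    refine (congrArg (· ≫ _) ih).trans ?_
    refine Eq.trans ?_ (F.conjL_comp h _ _).symm
    refine congrArg (_ ≫ ·) ?_
    obtain ⟨f, b, g, rfl, rfl⟩ := a
    simp only [atomicMap, conjL_conjL, conjR_comp, eqToHom_refl, Category.id_comp,
      Category.comp_id]
    rw [F.conjR_eqToHom (TPath.comp_assoc h f _), F.conjR_eqToHom (TPath.comp_assoc h f _).symm,
      conjR_conjL]
    simp

theorem trafoMap_whiskerR {X Y Z : C.Obj} {p q : TPath X Y} (t : Trafo p q) (h : TPath Y Z) :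
    F.trafoMap (t.whiskerR h) = F.conjR (F.trafoMap t) h := by
  induction t with
  | nil => exact (F.conjR_id _ _).symm
  | cons t a ih =>
    refine (congrArg (· ≫ _) ih).trans ?_
    refine Eq.trans ?_ (F.conjR_comp _ _ h).symm
    refine congrArg (_ ≫ ·) ?_
    obtain ⟨f, b, g, rfl, rfl⟩ := a
    simp only [atomicMap, conjR_conjR, eqToHom_refl, Category.id_comp, Category.comp_id]
    simp

section

variable {D : Type u} [Bicategory.{w, v} D]

theorem snd_inv_hom {X : D} {a : X ⟶ X} (s : a ≅ 𝟙 X) :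
    (s.inv ≫ (λ_ a).inv) ≫ ((λ_ a).hom ≫ s.hom) = 𝟙 _ := by simp

theorem snd_hom_inv {X : D} {a : X ⟶ X} (s : a ≅ 𝟙 X) :
    ((λ_ a).hom ≫ s.hom) ≫ (s.inv ≫ (λ_ a).inv) = 𝟙 _ := by simp

theorem snd_gamma_delta {X Y Z : D} {f : X ⟶ Y} {g : Y ⟶ Z} {l : X ⟶ Z} (c : l ≅ f ≫ g) :
    ((α_ _ _ _).hom ≫ 𝟙 _ ◁ c.inv) ≫ (𝟙 _ ◁ c.hom ≫ (α_ _ _ _).inv) = 𝟙 _ := by simp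

theorem snd_delta_gamma {X Y Z : D} {f : X ⟶ Y} {g : Y ⟶ Z} {l : X ⟶ Z} (c : l ≅ f ≫ g) :
    (𝟙 _ ◁ c.hom ≫ (α_ _ _ _).inv) ≫ ((α_ _ _ _).hom ≫ 𝟙 _ ◁ c.inv) = 𝟙 _ := by simp

theorem snd_iota_right {X Y : D} {f g : X ⟶ Y} {a : X ⟶ X} {s : a ≅ 𝟙 X} {c : g ≅ a ≫ f}
    (e : g = f) (k : c.hom ≫ s.hom ▷ f ≫ (λ_ f).hom = eqToHom e) :
    ((ρ_ (𝟙 X)).inv ≫ 𝟙 X ◁ s.inv) ▷ f =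
      eqToHom (show 𝟙 X ≫ f = 𝟙 X ≫ g by rw [e]) ≫
        (𝟙 X ◁ c.hom ≫ (α_ (𝟙 X) a f).inv) ≫ 𝟙 _ := by
  subst e
  have hc : c.hom = (λ_ g).inv ≫ s.inv ▷ g := by
    have := k =≫ ((λ_ g).inv ≫ s.inv ▷ g)
    simpa using this
  rw [hc]
  simp

theorem snd_iota_left {X Y : D} {f g : X ⟶ Y} {a : Y ⟶ Y} {s : a ≅ 𝟙 Y} {c : g ≅ f ≫ a}
    (e : g = f) (k : c.hom ≫ f ◁ s.hom ≫ (ρ_ f).hom = eqToHom e) :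
    (ρ_ (𝟙 X ≫ f)).inv ≫ (𝟙 X ≫ f) ◁ s.inv =
      eqToHom (show 𝟙 X ≫ f = 𝟙 X ≫ g by rw [e]) ≫
        (𝟙 X ◁ c.hom ≫ (α_ (𝟙 X) f a).inv) ≫ 𝟙 _ := by
  subst e
  have hc : c.hom = (ρ_ g).inv ≫ g ◁ s.inv := by
    have := k =≫ ((ρ_ g).inv ≫ g ◁ s.inv)
    simpa using this
  rw [hc]
  simp

theorem snd_hid {X Y : D} {f : X ⟶ Y} {a : X ⟶ X} {b : Y ⟶ Y} {S : a ≫ f ⟶ f ≫ b}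
    {s : a ≅ 𝟙 X} {t : b ≅ 𝟙 Y} (P : X ⟶ X)
    (h : S ≫ f ◁ t.hom ≫ (ρ_ f).hom = s.hom ▷ f ≫ (λ_ f).hom) :
    ((ρ_ P).inv ≫ P ◁ s.inv) ▷ f ≫ ((α_ _ _ _).hom ≫ P ◁ S ≫ (α_ _ _ _).inv) =
      (ρ_ (P ≫ f)).inv ≫ (P ≫ f) ◁ t.inv := by
  have hS : S = s.hom ▷ f ≫ (λ_ f).hom ≫ (ρ_ f).inv ≫ f ◁ t.inv := by
    have := h =≫ ((ρ_ f).inv ≫ f ◁ t.inv)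
    simpa using this
  rw [hS]
  simp

theorem snd_vid {X Y : D} {f : X ⟶ Y} {a : X ⟶ X} {b : Y ⟶ Y} {S : f ≫ b ⟶ a ≫ f}
    {s : a ≅ 𝟙 X} {t : b ≅ 𝟙 Y} (P : X ⟶ X)
    (h : S ≫ s.hom ▷ f ≫ (λ_ f).hom = f ◁ t.hom ≫ (ρ_ f).hom) :
    ((ρ_ (P ≫ f)).inv ≫ (P ≫ f) ◁ t.inv) ≫ ((α_ _ _ _).hom ≫ P ◁ S ≫ (α_ _ _ _).inv) =
      ((ρ_ P).inv ≫ P ◁ s.inv) ▷ f := by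
  have hS : S = f ◁ t.hom ≫ (ρ_ f).hom ≫ (λ_ f).inv ≫ s.inv ▷ f := by
    have := h =≫ ((λ_ f).inv ≫ s.inv ▷ f)
    simpa using this
  rw [hS]
  simp

theorem snd_hcomp {X₁ X₂ X₃ Y₁ Y₂ Y₃ : D}
    {j : X₁ ⟶ X₂} {j' : X₂ ⟶ X₃} {i : Y₁ ⟶ Y₂} {i' : Y₂ ⟶ Y₃} {j'' : X₁ ⟶ X₃} {i'' : Y₁ ⟶ Y₃}
    {p₁ : X₁ ⟶ Y₁} {p₂ : X₂ ⟶ Y₂} {p₃ : X₃ ⟶ Y₃}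
    {S : p₁ ≫ i ⟶ j ≫ p₂} {S' : p₂ ≫ i' ⟶ j' ≫ p₃} {S'' : p₁ ≫ i'' ⟶ j'' ≫ p₃}
    {c : i'' ≅ i ≫ i'} {d : j'' ≅ j ≫ j'} (P : X₁ ⟶ X₁)
    (h : p₁ ◁ c.hom ≫ (α_ _ _ _).inv ≫ S ▷ i' ≫ (α_ _ _ _).hom ≫ j ◁ S' ≫ (α_ _ _ _).inv =
      S'' ≫ d.hom ▷ p₃) :
    ((α_ _ _ _).hom ≫ P ◁ S ≫ (α_ _ _ _).inv) ▷ i' ≫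
        ((α_ _ _ _).hom ≫ (P ≫ j) ◁ S' ≫ (α_ _ _ _).inv) ≫
        ((α_ _ _ _).hom ≫ P ◁ d.inv) ▷ p₃ =
      ((α_ _ _ _).hom ≫ (P ≫ p₁) ◁ c.inv) ≫ ((α_ _ _ _).hom ≫ P ◁ S'' ≫ (α_ _ _ _).inv) := by
  have h' : (α_ _ _ _).inv ≫ S ▷ i' ≫ (α_ _ _ _).hom ≫ j ◁ S' ≫ (α_ _ _ _).inv ≫ d.inv ▷ p₃ =
      p₁ ◁ c.inv ≫ S'' := by
    have := p₁ ◁ c.inv ≫= (h =≫ (d.inv ▷ p₃))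
    simpa using this
  calc
    _ = 𝟙 _ ⊗≫ P ◁ ((α_ _ _ _).inv ≫ S ▷ i' ≫ (α_ _ _ _).hom ≫ j ◁ S' ≫ (α_ _ _ _).inv ≫
        d.inv ▷ p₃) ⊗≫ 𝟙 _ := by bicategory
    _ = _ := by rw [h']; bicategory

theorem snd_vcomp {X₁ X₂ X₃ Y₁ Y₂ Y₃ : D}
    {p₁ : X₁ ⟶ Y₁} {p₂ : X₂ ⟶ Y₂} {p₃ : X₃ ⟶ Y₃}
    {j : X₁ ⟶ X₂} {j' : X₂ ⟶ X₃} {i : Y₁ ⟶ Y₂} {i' : Y₂ ⟶ Y₃} {j'' : X₁ ⟶ X₃} {i'' : Y₁ ⟶ Y₃}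
    {S : j ≫ p₂ ⟶ p₁ ≫ i} {S' : j' ≫ p₃ ⟶ p₂ ≫ i'} {S'' : j'' ≫ p₃ ⟶ p₁ ≫ i''}
    {c : i'' ≅ i ≫ i'} {d : j'' ≅ j ≫ j'} (P : X₁ ⟶ X₁)
    (h : d.hom ▷ p₃ ≫ (α_ _ _ _).hom ≫ j ◁ S' ≫ (α_ _ _ _).inv ≫ S ▷ i' ≫ (α_ _ _ _).hom =
      S'' ≫ p₁ ◁ c.hom) :
    ((α_ _ _ _).hom ≫ (P ≫ j) ◁ S' ≫ (α_ _ _ _).inv) ≫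
        ((α_ _ _ _).hom ≫ P ◁ S ≫ (α_ _ _ _).inv) ▷ i' ≫
        ((α_ _ _ _).hom ≫ (P ≫ p₁) ◁ c.inv) =
      ((α_ _ _ _).hom ≫ P ◁ d.inv) ▷ p₃ ≫ ((α_ _ _ _).hom ≫ P ◁ S'' ≫ (α_ _ _ _).inv) := by
  have h' : (α_ _ _ _).hom ≫ j ◁ S' ≫ (α_ _ _ _).inv ≫ S ▷ i' ≫ (α_ _ _ _).hom ≫ p₁ ◁ c.inv =
      d.inv ▷ p₃ ≫ S'' := by
    have := d.inv ▷ p₃ ≫= (h =≫ (p₁ ◁ c.inv))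
    simpa using this
  calc
    _ = 𝟙 _ ⊗≫ P ◁ ((α_ _ _ _).hom ≫ j ◁ S' ≫ (α_ _ _ _).inv ≫ S ▷ i' ≫ (α_ _ _ _).hom ≫
        p₁ ◁ c.inv) ⊗≫ 𝟙 _ := by bicategory
    _ = _ := by rw [h']; bicategory

theorem snd_cube {X' Y' Z' W' X Y Z W : D}
    {b' : X' ⟶ Y'} {a' : Z' ⟶ W'} {b : X ⟶ Y} {a : Z ⟶ W}
    {q' : X' ⟶ Z'} {p' : Y' ⟶ W'} {q : X ⟶ Z} {p : Y ⟶ W}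
    {x : X' ⟶ X} {y : Y' ⟶ Y} {z : Z' ⟶ Z} {w : W' ⟶ W}
    {K' : q' ≫ a' ⟶ b' ≫ p'} {K : q ≫ a ⟶ b ≫ p} {J' : x ≫ b ⟶ b' ≫ y} {J : z ≫ a ⟶ a' ≫ w}
    {I' : x ≫ q ⟶ q' ≫ z} {I : y ≫ p ⟶ p' ≫ w} (P : X' ⟶ X')
    (h : x ◁ K ≫ (α_ _ _ _).inv ≫ J' ▷ p ≫ (α_ _ _ _).hom ≫ b' ◁ I =
      (α_ _ _ _).inv ≫ I' ▷ a ≫ (α_ _ _ _).hom ≫ q' ◁ J ≫ (α_ _ _ _).inv ≫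
        K' ▷ w ≫ (α_ _ _ _).hom) :
    ((α_ _ _ _).hom ≫ (P ≫ x) ◁ K ≫ (α_ _ _ _).inv) ≫
        ((α_ _ _ _).hom ≫ P ◁ J' ≫ (α_ _ _ _).inv) ▷ p ≫
        ((α_ _ _ _).hom ≫ (P ≫ b') ◁ I ≫ (α_ _ _ _).inv) =
      ((α_ _ _ _).hom ≫ P ◁ I' ≫ (α_ _ _ _).inv) ▷ a ≫
        ((α_ _ _ _).hom ≫ (P ≫ q') ◁ J ≫ (α_ _ _ _).inv) ≫
        ((α_ _ _ _).hom ≫ P ◁ K' ≫ (α_ _ _ _).inv) ▷ w := by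
  calc
    _ = 𝟙 _ ⊗≫ P ◁ (x ◁ K ≫ (α_ _ _ _).inv ≫ J' ▷ p ≫ (α_ _ _ _).hom ≫ b' ◁ I) ⊗≫ 𝟙 _ := by
        bicategory
    _ = _ := by rw [h]; bicategory

theorem snd_gamma_assoc {X Y Z W : D} {f : X ⟶ Y} {g : Y ⟶ Z} {h : Z ⟶ W} {fg : X ⟶ Z}
    {gh : Y ⟶ W} {l r : X ⟶ W} {cfg : fg ≅ f ≫ g} {cgh : gh ≅ g ≫ h} {cl : l ≅ fg ≫ h}
    {cr : r ≅ f ≫ gh} (P : X ⟶ X) (e : l = r)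
    (k : cl.hom ≫ cfg.hom ▷ h ≫ (α_ f g h).hom ≫ f ◁ cgh.inv ≫ cr.inv = eqToHom e) :
    ((α_ _ _ _).hom ≫ P ◁ cfg.inv) ▷ h ≫ ((α_ _ _ _).hom ≫ P ◁ cl.inv) =
      ((α_ _ _ _).hom ≫ (P ≫ f) ◁ cgh.inv) ≫ (𝟙 _ ≫ ((α_ _ _ _).hom ≫ P ◁ cr.inv) ≫
        eqToHom (show P ≫ r = P ≫ l by rw [e])) := by
  subst e
  have h' : (α_ f g h).hom ≫ f ◁ cgh.inv ≫ cr.inv = cfg.inv ▷ h ≫ cl.inv := by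
    have := (cfg.inv ▷ h ≫ cl.inv) ≫= k
    simpa using this
  calc
    _ = 𝟙 _ ⊗≫ P ◁ (cfg.inv ▷ h ≫ cl.inv) := by bicategory
    _ = _ := by rw [← h', eqToHom_refl]; bicategory

end

theorem trafoMap_rel {X Y : C.Obj} {p q : TPath X Y} {s t : Trafo p q} (h : Rel s t) :
    F.trafoMap s = F.trafoMap t := by
  induction h with
  | refl s => rfl
  | symm _ ih => exact ih.symm
  | trans _ _ ih ih' => exact ih.trans ih'
  | comp_left e _ ih => rw [trafoMap_comp, trafoMap_comp, ih]
  | comp_right e _ ih => rw [trafoMap_comp, trafoMap_comp, ih]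
  | whiskerL h _ ih => rw [trafoMap_whiskerL, trafoMap_whiskerL, ih]
  | whiskerR h _ ih => rw [trafoMap_whiskerR, trafoMap_whiskerR, ih]
  | exchange s t =>
    simp only [trafoMap_comp, trafoMap_whiskerL, trafoMap_whiskerR]
    exact F.conj_exchange _ _
  | iota_theta k X =>
    refine (F.trafoMap_comp_eq (F.trafoMap_of_rfl _) (F.trafoMap_of_rfl _)).trans ?_
    exact snd_inv_hom _
  | theta_iota k X =>
    refine (F.trafoMap_comp_eq (F.trafoMap_of_rfl _) (F.trafoMap_of_rfl _)).trans ?_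
    exact snd_hom_inv _
  | gamma_delta f g =>
    refine (F.trafoMap_comp_eq (F.trafoMap_of_rfl _) (F.trafoMap_of_rfl _)).trans ?_
    exact snd_gamma_delta _
  | delta_gamma f g =>
    refine (F.trafoMap_comp_eq (F.trafoMap_of_rfl _) (F.trafoMap_of_rfl _)).trans ?_
    exact snd_delta_gamma _
  | iota_right f =>
    refine (F.trafoMap_whiskered_path _ _ _).trans ?_
    refine Eq.trans ?_ (F.trafoMap_of _ _ _).symm
    rw [conjL_iota]
    exact snd_iota_right (congrArg F.edge f.id_comp) ((F.line _).map_id_comp f)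
  | iota_left f =>
    refine (F.trafoMap_whiskered_nil _ _).trans ?_
    refine Eq.trans ?_ (F.trafoMap_of _ _ _).symm
    rw [conjL_iota]
    exact snd_iota_left (congrArg F.edge f.comp_id) ((F.line _).map_comp_id f)
  | gamma_assoc f g h =>
    refine (F.trafoMap_comp_eq ((F.trafoMap_whiskered_path _ _ _).trans
      (congrArg (· ▷ _) (F.conjL_gamma _ _ _))) (F.trafoMap_of_rfl _)).trans ?_
    refine Eq.trans ?_ (F.trafoMap_comp_eq ((F.trafoMap_whiskered_nil _ _).trans
      (F.conjL_gamma _ _ _)) (F.trafoMap_of _ _ _)).symm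
    exact snd_gamma_assoc _ (congrArg F.edge (f.assoc g h)) ((F.line _).map_assoc f g h)
  | sigma_hid h S hS =>
    refine (F.trafoMap_comp_eq ((F.trafoMap_whiskered_path _ _ _).trans
      (congrArg (· ▷ _) (F.conjL_iota _ _)))
      (F.trafoMap_of_rfl _)).trans ?_
    refine Eq.trans ?_ ((F.trafoMap_whiskered_nil _ _).trans (F.conjL_iota _ _)).symm
    exact snd_hid _ (F.sq_hid h S hS)
  | sigma_vid h S hS =>
    refine (F.trafoMap_comp_eq ((F.trafoMap_whiskered_nil _ _).trans (F.conjL_iota _ _))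
      (F.trafoMap_of_rfl _)).trans ?_
    refine Eq.trans ?_ ((F.trafoMap_whiskered_path _ _ _).trans
      (congrArg (· ▷ _) (F.conjL_iota _ _))).symm
    exact snd_vid _ (F.sq_vid h S hS)
  | sigma_hcomp h S S' S'' hS =>
    refine (F.trafoMap_comp_eq ((F.trafoMap_whiskered_path _ _ _).trans
        (congrArg (· ▷ _) (F.conjL_sigma _ _ _)))
      (F.trafoMap_comp_eq ((F.trafoMap_whiskered_nil _ _).trans (F.conjL_sigma _ _ _))
        ((F.trafoMap_whiskered_path _ _ _).trans
          (congrArg (· ▷ _) (F.conjL_gamma _ _ _))))).trans ?_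
    refine Eq.trans ?_ (F.trafoMap_comp_eq ((F.trafoMap_whiskered_nil _ _).trans
      (F.conjL_gamma _ _ _)) (F.trafoMap_of_rfl _)).symm
    exact snd_hcomp _ (F.sq_hcomp h S S' S'' hS)
  | sigma_vcomp h S S' S'' hS =>
    refine (F.trafoMap_comp_eq ((F.trafoMap_whiskered_nil _ _).trans (F.conjL_sigma _ _ _))
      (F.trafoMap_comp_eq ((F.trafoMap_whiskered_path _ _ _).trans
        (congrArg (· ▷ _) (F.conjL_sigma _ _ _)))
        ((F.trafoMap_whiskered_nil _ _).trans (F.conjL_gamma _ _ _)))).trans ?_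
    refine Eq.trans ?_ (F.trafoMap_comp_eq ((F.trafoMap_whiskered_path _ _ _).trans
      (congrArg (· ▷ _) (F.conjL_gamma _ _ _))) (F.trafoMap_of_rfl _)).symm
    exact snd_vcomp _ (F.sq_vcomp h S S' S'' hS)
  | sigma_cube h h' K' K J' J I' I hc =>
    refine (F.trafoMap_comp_eq ((F.trafoMap_whiskered_nil _ _).trans (F.conjL_sigma _ _ _))
      (F.trafoMap_comp_eq ((F.trafoMap_whiskered_path _ _ _).trans
        (congrArg (· ▷ _) (F.conjL_sigma _ _ _)))
        ((F.trafoMap_whiskered_nil _ _).trans (F.conjL_sigma _ _ _)))).trans ?_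
    refine Eq.trans ?_ (F.trafoMap_comp_eq ((F.trafoMap_whiskered_path _ _ _).trans
        (congrArg (· ▷ _) (F.conjL_sigma _ _ _)))
      (F.trafoMap_comp_eq ((F.trafoMap_whiskered_nil _ _).trans (F.conjL_sigma _ _ _))
        ((F.trafoMap_whiskered_path _ _ _).trans
        (congrArg (· ▷ _) (F.conjL_sigma _ _ _))))).symm
    exact snd_cube _ (F.cube h h' K' K J' J I' I hc)

end MixedPsFun

namespace MixedPsFun

variable {n : ℕ} {C : NFoldCat.{t} n} {D : Type u} [Bicategory.{w, v} D] (F : MixedPsFun C D)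

/-- The action of the pseudofunctor `T C → D` on `2`-cells. -/
def cellMap {X Y : C.Obj} {p q : TPath X Y} (s : p ⟶ q) : F.pathMap p ⟶ F.pathMap q :=
  Quot.lift F.trafoMap (fun _ _ h => F.trafoMap_rel h) s

theorem cellMap_comp {X Y : C.Obj} {p q r : TPath X Y} (s : p ⟶ q) (t : q ⟶ r) :
    F.cellMap (s ≫ t) = F.cellMap s ≫ F.cellMap t := by
  obtain ⟨s⟩ := s
  obtain ⟨t⟩ := t
  exact F.trafoMap_comp s t

theorem cellMap_eqToHom {X Y : C.Obj} {p q : TPath X Y} (h : p = q) :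
    F.cellMap (eqToHom h) = eqToHom (congrArg F.pathMap h) := by
  subst h; rfl

theorem cellMap_whiskL {X Y Z : C.Obj} (h : TPath X Y) {p q : TPath Y Z} (s : p ⟶ q) :
    F.cellMap (NFoldCat.whiskL h s) = F.conjL h (F.cellMap s) := by
  obtain ⟨s⟩ := s
  exact F.trafoMap_whiskerL h s

theorem cellMap_whiskR {X Y Z : C.Obj} {p q : TPath X Y} (s : p ⟶ q) (h : TPath Y Z) :
    F.cellMap (NFoldCat.whiskR s h) = F.conjR (F.cellMap s) h := by
  obtain ⟨s⟩ := s
  exact F.trafoMap_whiskerR s h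

theorem cellMap_assoc {X Y Z W : C.Obj} (p : TPath X Y) (q : TPath Y Z) (r : TPath Z W) :
    F.cellMap (eqToHom (TPath.comp_assoc p q r)) =
      (F.pathComp (p.comp q) r).hom ≫ (F.pathComp p q).hom ▷ F.pathMap r ≫
        (α_ (F.pathMap p) (F.pathMap q) (F.pathMap r)).hom ≫ F.pathMap p ◁ (F.pathComp q r).inv ≫
        (F.pathComp p (q.comp r)).inv := by
  rw [cellMap_eqToHom, ← cancel_mono ((F.pathComp p (q.comp r)).hom ≫
    F.pathMap p ◁ (F.pathComp q r).hom), ← pathComp_assoc]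
  simp

/-- The pseudofunctor `T C → D` associated with a pseudofunctor `F` from `C` to `D`. -/
def lift : T C ⥤ᵖ D where
  obj X := F.obj X.of
  map p := F.pathMap p
  map₂ s := F.cellMap s
  map₂_id _ := rfl
  map₂_comp s t := F.cellMap_comp s t
  mapId X := Iso.refl (𝟙 (F.obj X.of))
  mapComp p q := F.pathComp p q
  map₂_whisker_left p _ _ s := F.cellMap_whiskL p s
  map₂_whisker_right s p := F.cellMap_whiskR s p
  map₂_associator p q r := F.cellMap_assoc p q r
  map₂_left_unitor p := (F.cellMap_eqToHom (TPath.nil_comp p)).trans <|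
    (F.pathComp_nil_left p).symm.trans (congrArg ((F.pathComp .nil p).hom ≫ ·)
      ((congrArg (· ≫ _) (id_whiskerRight _ _)).trans (Category.id_comp _)).symm)
  map₂_right_unitor p := (F.cellMap_eqToHom (TPath.comp_nil p)).trans <|
    (Iso.inv_hom_id _).symm.trans (congrArg ((ρ_ (F.pathMap p)).inv ≫ ·)
      ((congrArg (· ≫ _) (whiskerLeft_id _ _)).trans (Category.id_comp _)).symm)

variable {F} {G : MixedPsFun C D}

/-- The naturality constraint of a morphism at an edge. -/
def edgeNat (μ : Mor F G) {k : Fin n} {X Y : C.Obj} (e : Edge k X Y) :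
    F.edge e ≫ μ.app Y ≅ μ.app X ≫ G.edge e := μ.nat e

/-- The naturality constraint of a morphism at a path. -/
def pathNat (μ : Mor F G) {X : C.Obj} : ∀ {Y : C.Obj} (p : TPath X Y),
    F.pathMap p ≫ μ.app Y ≅ μ.app X ≫ G.pathMap p
  | _, .nil => λ_ _ ≪≫ (ρ_ _).symm
  | _, .cons p e => α_ _ _ _ ≪≫ whiskerLeftIso (F.pathMap p) (edgeNat μ e) ≪≫ (α_ _ _ _).symm ≪≫
      whiskerRightIso (pathNat μ p) (G.edge e) ≪≫ α_ _ _ _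

section

variable {D : Type u} [Bicategory.{w, v} D]

theorem nat_coh_comp {X Y Z W X' Y' Z' W' : D} {p : X ⟶ Y} {q : Y ⟶ Z} {e : Z ⟶ W}
    {p' : X' ⟶ Y'} {q' : Y' ⟶ Z'} {e' : Z' ⟶ W'} {x : X ⟶ X'} {y : Y ⟶ Y'} {z : Z ⟶ Z'}
    {t : W ⟶ W'} {l : X ⟶ Z} {l' : X' ⟶ Z'} {c : l ⟶ p ≫ q} {c' : l' ⟶ p' ≫ q'}
    {N : l ≫ z ⟶ x ≫ l'} {P : p ≫ y ⟶ x ≫ p'} {Q : q ≫ z ⟶ y ≫ q'} {E : e ≫ t ⟶ z ≫ e'}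
    (h : N ≫ x ◁ c' = c ▷ z ≫ (α_ _ _ _).hom ≫ p ◁ Q ≫ (α_ _ _ _).inv ≫ P ▷ q' ≫
      (α_ _ _ _).hom) :
    ((α_ _ _ _).hom ≫ l ◁ E ≫ (α_ _ _ _).inv ≫ N ▷ e' ≫ (α_ _ _ _).hom) ≫
        x ◁ (c' ▷ e' ≫ (α_ _ _ _).hom) =
      (c ▷ e ≫ (α_ _ _ _).hom) ▷ t ≫ (α_ _ _ _).hom ≫
        p ◁ ((α_ _ _ _).hom ≫ q ◁ E ≫ (α_ _ _ _).inv ≫ Q ▷ e' ≫ (α_ _ _ _).hom) ≫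
        (α_ _ _ _).inv ≫ P ▷ (q' ≫ e') ≫ (α_ _ _ _).hom := by
  calc
    _ = 𝟙 _ ⊗≫ l ◁ E ⊗≫ (N ≫ x ◁ c') ▷ e' ⊗≫ 𝟙 _ := by bicategory
    _ = 𝟙 _ ⊗≫ (l ◁ E ≫ c ▷ (z ≫ e')) ⊗≫ p ◁ Q ▷ e' ⊗≫ P ▷ q' ▷ e' ⊗≫ 𝟙 _ := by
      rw [h]; bicategory
    _ = _ := by rw [whisker_exchange]; bicategory

theorem nat_coh_left {X Y Z X' Y' Z' : D} {p : X ⟶ Y} {u v : Y ⟶ Z} {p' : X' ⟶ Y'}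
    {u' v' : Y' ⟶ Z'} {x : X ⟶ X'} {y : Y ⟶ Y'} {z : Z ⟶ Z'} {pu pv : X ⟶ Z} {pu' pv' : X' ⟶ Z'}
    {cu : pu ≅ p ≫ u} {cv : pv ≅ p ≫ v} {cu' : pu' ≅ p' ≫ u'} {cv' : pv' ≅ p' ≫ v'}
    {Nu : pu ≫ z ⟶ x ≫ pu'} {Nv : pv ≫ z ⟶ x ≫ pv'} {P : p ≫ y ⟶ x ≫ p'}
    {U : u ≫ z ⟶ y ≫ u'} {V : v ≫ z ⟶ y ≫ v'} {β : u ⟶ v} {β' : u' ⟶ v'}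
    (hu : Nu ≫ x ◁ cu'.hom = cu.hom ▷ z ≫ (α_ _ _ _).hom ≫ p ◁ U ≫ (α_ _ _ _).inv ≫ P ▷ u' ≫
      (α_ _ _ _).hom)
    (hv : Nv ≫ x ◁ cv'.hom = cv.hom ▷ z ≫ (α_ _ _ _).hom ≫ p ◁ V ≫ (α_ _ _ _).inv ≫ P ▷ v' ≫
      (α_ _ _ _).hom)
    (h : β ▷ z ≫ V = U ≫ y ◁ β') :
    (cu.hom ≫ p ◁ β ≫ cv.inv) ▷ z ≫ Nv = Nu ≫ x ◁ (cu'.hom ≫ p' ◁ β' ≫ cv'.inv) := by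
  rw [← cancel_mono (x ◁ cv'.hom), Category.assoc, hv]
  calc
    _ = cu.hom ▷ z ≫ (α_ _ _ _).hom ≫ p ◁ (β ▷ z ≫ V) ≫ (α_ _ _ _).inv ≫ P ▷ v' ≫
      (α_ _ _ _).hom := by simp
    _ = cu.hom ▷ z ⊗≫ p ◁ U ⊗≫ ((p ≫ y) ◁ β' ≫ P ▷ v') ⊗≫ 𝟙 _ := by rw [h]; bicategory
    _ = (cu.hom ▷ z ≫ (α_ _ _ _).hom ≫ p ◁ U ≫ (α_ _ _ _).inv ≫ P ▷ u' ≫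
      (α_ _ _ _).hom) ≫ x ◁ p' ◁ β' := by rw [whisker_exchange]; bicategory
    _ = _ := by rw [← hu]; simp

theorem nat_coh_right {X Y Z X' Y' Z' : D} {u v : X ⟶ Y} {q : Y ⟶ Z} {u' v' : X' ⟶ Y'}
    {q' : Y' ⟶ Z'} {x : X ⟶ X'} {y : Y ⟶ Y'} {z : Z ⟶ Z'} {pu pv : X ⟶ Z} {pu' pv' : X' ⟶ Z'}
    {cu : pu ≅ u ≫ q} {cv : pv ≅ v ≫ q} {cu' : pu' ≅ u' ≫ q'} {cv' : pv' ≅ v' ≫ q'}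
    {Nu : pu ≫ z ⟶ x ≫ pu'} {Nv : pv ≫ z ⟶ x ≫ pv'} {Q : q ≫ z ⟶ y ≫ q'}
    {U : u ≫ y ⟶ x ≫ u'} {V : v ≫ y ⟶ x ≫ v'} {β : u ⟶ v} {β' : u' ⟶ v'}
    (hu : Nu ≫ x ◁ cu'.hom = cu.hom ▷ z ≫ (α_ _ _ _).hom ≫ u ◁ Q ≫ (α_ _ _ _).inv ≫ U ▷ q' ≫
      (α_ _ _ _).hom)
    (hv : Nv ≫ x ◁ cv'.hom = cv.hom ▷ z ≫ (α_ _ _ _).hom ≫ v ◁ Q ≫ (α_ _ _ _).inv ≫ V ▷ q' ≫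
      (α_ _ _ _).hom)
    (h : β ▷ y ≫ V = U ≫ x ◁ β') :
    (cu.hom ≫ β ▷ q ≫ cv.inv) ▷ z ≫ Nv = Nu ≫ x ◁ (cu'.hom ≫ β' ▷ q' ≫ cv'.inv) := by
  rw [← cancel_mono (x ◁ cv'.hom), Category.assoc, hv]
  calc
    _ = cu.hom ▷ z ≫ β ▷ q ▷ z ≫ (α_ _ _ _).hom ≫ v ◁ Q ≫ (α_ _ _ _).inv ≫ V ▷ q' ≫
      (α_ _ _ _).hom := by simp
    _ = cu.hom ▷ z ⊗≫ (β ▷ (q ≫ z) ≫ v ◁ Q) ⊗≫ V ▷ q' ⊗≫ 𝟙 _ := by bicategory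
    _ = cu.hom ▷ z ⊗≫ u ◁ Q ⊗≫ (β ▷ y ≫ V) ▷ q' ⊗≫ 𝟙 _ := by
      rw [← whisker_exchange]; bicategory
    _ = (cu.hom ▷ z ≫ (α_ _ _ _).hom ≫ u ◁ Q ≫ (α_ _ _ _).inv ≫ U ▷ q' ≫
      (α_ _ _ _).hom) ≫ x ◁ β' ▷ q' := by rw [h]; bicategory
    _ = _ := by rw [← hu]; simp

end

theorem pathNat_comp (μ : Mor F G) {X Y Z : C.Obj} (p : TPath X Y) (q : TPath Y Z) :
    (pathNat μ (p.comp q)).hom ≫ μ.app X ◁ (G.pathComp p q).hom =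
      (F.pathComp p q).hom ▷ μ.app Z ≫ (α_ _ _ _).hom ≫ F.pathMap p ◁ (pathNat μ q).hom ≫
        (α_ _ _ _).inv ≫ (pathNat μ p).hom ▷ G.pathMap q ≫ (α_ _ _ _).hom := by
  induction q with
  | nil =>
    change (pathNat μ p).hom ≫ μ.app X ◁ (ρ_ _).inv = (ρ_ _).inv ▷ _ ≫ (α_ _ _ _).hom ≫
      F.pathMap p ◁ ((λ_ _).hom ≫ (ρ_ _).inv) ≫ (α_ _ _ _).inv ≫ (pathNat μ p).hom ▷ 𝟙 _ ≫
      (α_ _ _ _).hom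
    simp
  | cons q e ih => exact nat_coh_comp ih

theorem pathNat_conjL (μ : Mor F G) {X Y Z : C.Obj} (f : TPath X Y) {u v : TPath Y Z}
    {β : F.pathMap u ⟶ F.pathMap v} {β' : G.pathMap u ⟶ G.pathMap v}
    (h : β ▷ μ.app Z ≫ (pathNat μ v).hom = (pathNat μ u).hom ≫ μ.app Y ◁ β') :
    F.conjL f β ▷ μ.app Z ≫ (pathNat μ (f.comp v)).hom =
      (pathNat μ (f.comp u)).hom ≫ μ.app X ◁ G.conjL f β' :=
  nat_coh_left (pathNat_comp μ f u) (pathNat_comp μ f v) h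

theorem pathNat_conjR (μ : Mor F G) {X Y Z : C.Obj} {u v : TPath X Y}
    {β : F.pathMap u ⟶ F.pathMap v} {β' : G.pathMap u ⟶ G.pathMap v}
    (h : β ▷ μ.app Y ≫ (pathNat μ v).hom = (pathNat μ u).hom ≫ μ.app X ◁ β') (g : TPath Y Z) :
    F.conjR β g ▷ μ.app Z ≫ (pathNat μ (v.comp g)).hom =
      (pathNat μ (u.comp g)).hom ≫ μ.app X ◁ G.conjR β' g :=
  nat_coh_right (pathNat_comp μ u g) (pathNat_comp μ v g) h

section

variable {D : Type u} [Bicategory.{w, v} D]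

theorem nat_coh_inv {X Y X' Y' : D} {u v : X ⟶ Y} {u' v' : X' ⟶ Y'} {x : X ⟶ X'} {y : Y ⟶ Y'}
    {U : u ≫ y ⟶ x ≫ u'} {V : v ≫ y ⟶ x ≫ v'} {β : u ⟶ v} {β' : u' ⟶ v'} {γ : v ⟶ u}
    {γ' : v' ⟶ u'} (h : β ▷ y ≫ V = U ≫ x ◁ β') (hγ : γ ≫ β = 𝟙 _) (hγ' : β' ≫ γ' = 𝟙 _) :
    γ ▷ y ≫ U = V ≫ x ◁ γ' := by
  have := γ ▷ y ≫= (h =≫ (x ◁ γ'))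
  simp only [Category.assoc, ← whiskerLeft_comp, hγ', whiskerLeft_id, Category.comp_id] at this
  rw [← this, ← comp_whiskerRight_assoc, hγ, id_whiskerRight, Category.id_comp]

theorem nat_coh_theta {X X' : D} {a : X ⟶ X} {a' : X' ⟶ X'} {x : X ⟶ X'} (s : a ⟶ 𝟙 X)
    (s' : a' ⟶ 𝟙 X') (N : a ≫ x ⟶ x ≫ a')
    (h : N ≫ x ◁ s' = s ▷ x ≫ (λ_ x).hom ≫ (ρ_ x).inv) :
    ((λ_ a).hom ≫ s) ▷ x ≫ ((λ_ x).hom ≫ (ρ_ x).inv) =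
      ((α_ _ _ _).hom ≫ 𝟙 X ◁ N ≫ (α_ _ _ _).inv ≫ ((λ_ x).hom ≫ (ρ_ x).inv) ▷ a' ≫
        (α_ _ _ _).hom) ≫ x ◁ ((λ_ a').hom ≫ s') := by
  calc
    _ = 𝟙 _ ⊗≫ s ▷ x ≫ (λ_ x).hom ≫ (ρ_ x).inv := by bicategory
    _ = _ := by rw [← h]; bicategory

theorem nat_coh_delta {X Y Z X' Y' Z' : D} {f : X ⟶ Y} {g : Y ⟶ Z} {l : X ⟶ Z} {f' : X' ⟶ Y'}
    {g' : Y' ⟶ Z'} {l' : X' ⟶ Z'} {x : X ⟶ X'} {y : Y ⟶ Y'} {z : Z ⟶ Z'} {c : l ⟶ f ≫ g}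
    {c' : l' ⟶ f' ≫ g'} {L : l ≫ z ⟶ x ≫ l'} {M : f ≫ y ⟶ x ≫ f'} {N : g ≫ z ⟶ y ≫ g'}
    (h : L ≫ x ◁ c' = c ▷ z ≫ (α_ _ _ _).hom ≫ f ◁ N ≫ (α_ _ _ _).inv ≫ M ▷ g' ≫
      (α_ _ _ _).hom) :
    (𝟙 X ◁ c ≫ (α_ _ _ _).inv) ▷ z ≫ ((α_ _ _ _).hom ≫ (𝟙 X ≫ f) ◁ N ≫ (α_ _ _ _).inv ≫
        ((α_ _ _ _).hom ≫ 𝟙 X ◁ M ≫ (α_ _ _ _).inv ≫ ((λ_ x).hom ≫ (ρ_ x).inv) ▷ f' ≫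
          (α_ _ _ _).hom) ▷ g' ≫ (α_ _ _ _).hom) =
      ((α_ _ _ _).hom ≫ 𝟙 X ◁ L ≫ (α_ _ _ _).inv ≫ ((λ_ x).hom ≫ (ρ_ x).inv) ▷ l' ≫
        (α_ _ _ _).hom) ≫ x ◁ (𝟙 X' ◁ c' ≫ (α_ _ _ _).inv) := by
  calc
    _ = 𝟙 _ ⊗≫ (c ▷ z ≫ (α_ _ _ _).hom ≫ f ◁ N ≫ (α_ _ _ _).inv ≫ M ▷ g' ≫
      (α_ _ _ _).hom) ⊗≫ 𝟙 _ := by bicategory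
    _ = _ := by rw [← h]; bicategory

theorem nat_coh_sigma {X Y Z W X' Y' Z' W' : D}
    {j : X ⟶ Y} {i : Z ⟶ W} {q : X ⟶ Z} {p : Y ⟶ W}
    {j' : X' ⟶ Y'} {i' : Z' ⟶ W'} {q' : X' ⟶ Z'} {p' : Y' ⟶ W'}
    {x : X ⟶ X'} {y : Y ⟶ Y'} {z : Z ⟶ Z'} {t : W ⟶ W'}
    {S : q ≫ i ⟶ j ≫ p} {S' : q' ≫ i' ⟶ j' ≫ p'}
    {J : j ≫ y ⟶ x ≫ j'} {P : p ≫ t ⟶ y ≫ p'} {Q : q ≫ z ⟶ x ≫ q'} {I : i ≫ t ⟶ z ≫ i'}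
    (h : S ▷ t ≫ (α_ _ _ _).hom ≫ j ◁ P ≫ (α_ _ _ _).inv ≫ J ▷ p' ≫ (α_ _ _ _).hom =
      (α_ _ _ _).hom ≫ q ◁ I ≫ (α_ _ _ _).inv ≫ Q ▷ i' ≫ (α_ _ _ _).hom ≫ x ◁ S') :
    ((α_ _ _ _).hom ≫ 𝟙 X ◁ S ≫ (α_ _ _ _).inv) ▷ t ≫
        ((α_ _ _ _).hom ≫ (𝟙 X ≫ j) ◁ P ≫ (α_ _ _ _).inv ≫
        ((α_ _ _ _).hom ≫ 𝟙 X ◁ J ≫ (α_ _ _ _).inv ≫ ((λ_ x).hom ≫ (ρ_ x).inv) ▷ j' ≫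
          (α_ _ _ _).hom) ▷ p' ≫ (α_ _ _ _).hom) =
      ((α_ _ _ _).hom ≫ (𝟙 X ≫ q) ◁ I ≫ (α_ _ _ _).inv ≫
        ((α_ _ _ _).hom ≫ 𝟙 X ◁ Q ≫ (α_ _ _ _).inv ≫ ((λ_ x).hom ≫ (ρ_ x).inv) ▷ q' ≫
          (α_ _ _ _).hom) ▷ i' ≫ (α_ _ _ _).hom) ≫
        x ◁ ((α_ _ _ _).hom ≫ 𝟙 X' ◁ S' ≫ (α_ _ _ _).inv) := by
  calc
    _ = 𝟙 _ ⊗≫ (S ▷ t ≫ (α_ _ _ _).hom ≫ j ◁ P ≫ (α_ _ _ _).inv ≫ J ▷ p' ≫ (α_ _ _ _).hom) ⊗≫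
      𝟙 _ := by bicategory
    _ = _ := by rw [h]; bicategory

end

theorem pathNat_basic (μ : Mor F G) {X Y : C.Obj} {u v : TPath X Y} (b : C.Basic u v) :
    F.basicMap b ▷ μ.app Y ≫ (pathNat μ v).hom =
      (pathNat μ u).hom ≫ μ.app X ◁ G.basicMap b := by
  cases b with
  | iota k X =>
    exact nat_coh_inv (nat_coh_theta _ _ _ (μ.nat_id k X)) (snd_inv_hom (F.edgeId k X))
      (snd_hom_inv (G.edgeId k X))
  | theta k X => exact nat_coh_theta _ _ _ (μ.nat_id k X)
  | gamma f g =>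
    exact nat_coh_inv (nat_coh_delta (μ.nat_comp f g)) (snd_gamma_delta (F.edgeComp f g))
      (snd_delta_gamma (G.edgeComp f g))
  | delta f g => exact nat_coh_delta (μ.nat_comp f g)
  | sigma h S => exact nat_coh_sigma (μ.nat_sq h S)

theorem pathNat_cell (μ : Mor F G) {X Y : C.Obj} {p q : TPath X Y} (s : p ⟶ q) :
    F.cellMap s ▷ μ.app Y ≫ (pathNat μ q).hom =
      (pathNat μ p).hom ≫ μ.app X ◁ G.cellMap s := by
  induction s using cell_ind with
  | hid p =>
    change 𝟙 _ ▷ _ ≫ _ = _ ≫ _ ◁ 𝟙 _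
    simp
  | hcons s a ih =>
    rw [cellMap_comp, cellMap_comp, comp_whiskerRight, whiskerLeft_comp, ← reassoc_of% ih,
      Category.assoc]
    refine congrArg (_ ≫ ·) ?_
    obtain ⟨f, b, g, rfl, rfl⟩ := a
    have key := pathNat_conjR μ (pathNat_conjL μ f (pathNat_basic μ b)) g
    have e : ∀ H : MixedPsFun C D, H.cellMap (Atomic.mk f b g rfl rfl).cell =
        H.conjR (H.conjL f (H.basicMap b)) g := fun H => H.trafoMap_whiskered f b g
    rw [e F, e G]
    exact key

/-- The pseudonatural transformation associated with a morphism. -/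
def liftMap (μ : F ⟶ G) : F.lift ⟶ G.lift where
  app X := Mor.app μ X.of
  naturality p := pathNat μ p
  naturality_naturality s := pathNat_cell μ s
  naturality_id X := by
    change ((λ_ _).hom ≫ (ρ_ _).inv) ≫ _ ◁ 𝟙 _ = 𝟙 _ ▷ _ ≫ (λ_ _).hom ≫ (ρ_ _).inv
    simp
  naturality_comp p q := pathNat_comp μ p q

theorem nat_coh_modif {X Y Z X' Y' Z' : D} {p : X ⟶ Y} {e : Y ⟶ Z} {p' : X' ⟶ Y'} {e' : Y' ⟶ Z'}
    {x ξ : X ⟶ X'} {y υ : Y ⟶ Y'} {z ζ : Z ⟶ Z'} {a : x ⟶ ξ} {b : y ⟶ υ} {c : z ⟶ ζ}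
    {P : p ≫ y ⟶ x ≫ p'} {P' : p ≫ υ ⟶ ξ ≫ p'} {E : e ≫ z ⟶ y ≫ e'} {E' : e ≫ ζ ⟶ υ ≫ e'}
    (h : p ◁ b ≫ P' = P ≫ a ▷ p') (h' : e ◁ c ≫ E' = E ≫ b ▷ e') :
    (p ≫ e) ◁ c ≫ ((α_ _ _ _).hom ≫ p ◁ E' ≫ (α_ _ _ _).inv ≫ P' ▷ e' ≫ (α_ _ _ _).hom) =
      ((α_ _ _ _).hom ≫ p ◁ E ≫ (α_ _ _ _).inv ≫ P ▷ e' ≫ (α_ _ _ _).hom) ≫ a ▷ (p' ≫ e') := by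
  calc
    _ = 𝟙 _ ⊗≫ p ◁ (e ◁ c ≫ E') ⊗≫ P' ▷ e' ⊗≫ 𝟙 _ := by bicategory
    _ = 𝟙 _ ⊗≫ p ◁ E ⊗≫ (p ◁ b ≫ P') ▷ e' ⊗≫ 𝟙 _ := by rw [h']; bicategory
    _ = _ := by rw [h]; bicategory

theorem pathNat_modif {μ ν : F ⟶ G} (Γ : μ ⟶ ν) {X Y : C.Obj} (p : TPath X Y) :
    F.pathMap p ◁ Modif.app Γ Y ≫ (pathNat ν p).hom =
      (pathNat μ p).hom ≫ Modif.app Γ X ▷ G.pathMap p := by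
  induction p with
  | nil =>
    change 𝟙 _ ◁ _ ≫ ((λ_ _).hom ≫ (ρ_ _).inv) = ((λ_ _).hom ≫ (ρ_ _).inv) ≫ _ ▷ 𝟙 _
    simp
  | cons p e ih => exact nat_coh_modif ih (Modif.nat Γ e)

/-- The modification associated with a `2`-cell. -/
def liftMap₂ {μ ν : F ⟶ G} (Γ : μ ⟶ ν) : liftMap μ ⟶ liftMap ν where
  as := { app := fun X => Modif.app Γ X.of
          naturality := fun p => pathNat_modif Γ p }

theorem pathNat_id {X Y : C.Obj} (p : TPath X Y) :
    (pathNat (𝟙 F : F ⟶ F) p).hom = (ρ_ (F.pathMap p)).hom ≫ (λ_ (F.pathMap p)).inv := by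
  induction p with
  | nil =>
    change (λ_ (𝟙 _)).hom ≫ (ρ_ (𝟙 _)).inv = (ρ_ (𝟙 _)).hom ≫ (λ_ (𝟙 _)).inv
    rw [unitors_equal, unitors_inv_equal]
  | cons p e ih =>
    have h : ∀ {X Y Z : D} (p : X ⟶ Y) (e : Y ⟶ Z), (α_ p e (𝟙 Z)).hom ≫
        p ◁ ((ρ_ e).hom ≫ (λ_ e).inv) ≫ (α_ p (𝟙 Y) e).inv ≫ ((ρ_ p).hom ≫ (λ_ p).inv) ▷ e ≫
        (α_ (𝟙 X) p e).hom = (ρ_ (p ≫ e)).hom ≫ (λ_ (p ≫ e)).inv := by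
      intros; bicategory
    refine Eq.trans ?_ (h (F.pathMap p) (F.edge e))
    rw [← ih]
    rfl

theorem nat_coh_vcomp {X Y Z X' Y' Z' X'' Y'' Z'' : D} {p : X ⟶ Y} {e : Y ⟶ Z} {p' : X' ⟶ Y'}
    {e' : Y' ⟶ Z'} {p'' : X'' ⟶ Y''} {e'' : Y'' ⟶ Z''} {x : X ⟶ X'} {y : Y ⟶ Y'} {z : Z ⟶ Z'}
    {x' : X' ⟶ X''} {y' : Y' ⟶ Y''} {z' : Z' ⟶ Z''} (P : p ≫ y ⟶ x ≫ p') (E : e ≫ z ⟶ y ≫ e')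
    (P' : p' ≫ y' ⟶ x' ≫ p'') (E' : e' ≫ z' ⟶ y' ≫ e'') :
    (α_ _ _ _).hom ≫ p ◁ ((α_ _ _ _).inv ≫ E ▷ z' ≫ (α_ _ _ _).hom ≫ y ◁ E' ≫ (α_ _ _ _).inv) ≫
        (α_ _ _ _).inv ≫
        ((α_ _ _ _).inv ≫ P ▷ y' ≫ (α_ _ _ _).hom ≫ x ◁ P' ≫ (α_ _ _ _).inv) ▷ e'' ≫
        (α_ _ _ _).hom =
      (α_ _ _ _).inv ≫
        ((α_ _ _ _).hom ≫ p ◁ E ≫ (α_ _ _ _).inv ≫ P ▷ e' ≫ (α_ _ _ _).hom) ▷ z' ≫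
        (α_ _ _ _).hom ≫
        x ◁ ((α_ _ _ _).hom ≫ p' ◁ E' ≫ (α_ _ _ _).inv ≫ P' ▷ e'' ≫ (α_ _ _ _).hom) ≫
        (α_ _ _ _).inv := by
  calc
    _ = 𝟙 _ ⊗≫ p ◁ E ▷ z' ⊗≫ ((p ≫ y) ◁ E' ≫ P ▷ (y' ≫ e'')) ⊗≫ x ◁ P' ▷ e'' ⊗≫ 𝟙 _ := by
      bicategory
    _ = _ := by rw [whisker_exchange]; bicategory

theorem pathNat_vcomp {H : MixedPsFun C D} (μ : F ⟶ G) (ν : G ⟶ H) {X Y : C.Obj} (p : TPath X Y) :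
    (pathNat (μ ≫ ν) p).hom = (α_ _ _ _).inv ≫ (pathNat μ p).hom ▷ Mor.app ν Y ≫ (α_ _ _ _).hom ≫
      Mor.app μ X ◁ (pathNat ν p).hom ≫ (α_ _ _ _).inv := by
  induction p with
  | nil =>
    have h : ∀ {X Y Z : D} (x : X ⟶ Y) (y : Y ⟶ Z), (λ_ (x ≫ y)).hom ≫ (ρ_ (x ≫ y)).inv =
        (α_ _ _ _).inv ≫ ((λ_ x).hom ≫ (ρ_ x).inv) ▷ y ≫ (α_ _ _ _).hom ≫
        x ◁ ((λ_ y).hom ≫ (ρ_ y).inv) ≫ (α_ _ _ _).inv := by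
      intros; bicategory
    exact h (Mor.app μ X) (Mor.app ν X)
  | cons p e ih =>
    refine Eq.trans ?_ (nat_coh_vcomp (pathNat μ p).hom (edgeNat μ e).hom (pathNat ν p).hom
      (edgeNat ν e).hom)
    rw [← ih]
    rfl

theorem trans_ext {B : Type*} [Bicategory B] {H H' : B ⥤ᵖ D} {η θ : H ⟶ H'}
    (h : η.app = θ.app)
    (h' : ∀ {X Y : B} (f : X ⟶ Y), HEq (η.naturality f).hom (θ.naturality f).hom) : η = θ := by
  obtain ⟨a, b, _, _, _⟩ := η
  obtain ⟨a', b', _, _, _⟩ := θ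
  obtain rfl : a = a' := h
  have : @b = @b' := by
    funext X Y f
    ext
    exact eq_of_heq (h' f)
  subst this
  rfl

theorem psFun_eq_conj {B : Type*} [Bicategory B] {H H' : B ⥤ᵖ D} {f f' g g' : H ⟶ H'} (h : f = g)
    (h' : g' = f') (a : f ⟶ f') (b : g ⟶ g')
    (hab : ∀ X, a.as.app X = eqToHom (by rw [h]) ≫ b.as.app X ≫ eqToHom (by rw [h'])) :
    a = eqToHom h ≫ b ≫ eqToHom h' := by
  subst h h'
  refine Eq.trans ?_ ((Category.id_comp _).trans (Category.comp_id b)).symm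
  exact Pseudofunctor.StrongTrans.homCategory.ext fun X => by simpa using hab X

end MixedPsFun

/-- The `D^{Ob C}`-functor `Φ : PsFun(C, D) → PsFun(T C, D)`. -/
def Phi {n : ℕ} (C : NFoldCat.{t} n) (D : Type u) [Bicategory.{w, v} D] [Bicategory.Strict D] :
    OverFunctor (MixedPsFun.forget C D) (PsFun.forget C D) where
  functor := StrictPseudofunctor.mk''
    { obj := MixedPsFun.lift
      map := MixedPsFun.liftMap
      map₂ := MixedPsFun.liftMap₂
      map₂_id := fun _ => rfl
      map₂_comp := fun _ _ => rfl
      map_id := fun _ => MixedPsFun.trans_ext rfl fun p => heq_of_eq (MixedPsFun.pathNat_id p)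
      map_comp := fun μ ν => MixedPsFun.trans_ext rfl fun p =>
        heq_of_eq (MixedPsFun.pathNat_vcomp μ ν p)
      map₂_whisker_left := fun _ _ _ _ => MixedPsFun.psFun_eq_conj _ _ _ _ fun _ =>
        ((Category.id_comp _).trans (Category.comp_id _)).symm
      map₂_whisker_right := fun _ _ => MixedPsFun.psFun_eq_conj _ _ _ _ fun _ =>
        ((Category.id_comp _).trans (Category.comp_id _)).symm }
  comm := StrictPseudofunctor.ext_prelax rfl

/-! The 2-category `T C` is generated by the edges of `C`, the cells `ι`, `θ`, `γ`, `δ`, `σ`, and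
exactly the relations that a pseudofunctor on `C` satisfies. A pseudofunctor out of `T C` is
therefore determined, up to canonical isomorphism, by its values on edges and on these cells.

For `F` on `C`, the composite ΨΦ sends an edge `e` to `𝟙 ≫ F.edge e`, because `pathMap` starts at
the empty path; the left unitor compares it with `F`. The identities `counit_id`, `counit_comp` and
`counit_sq` say that the unitor respects the unit constraints, the composition constraints and the
squares. For `H` on `T C`, the composite ΦΨ replaces the value of `H` on a path by the composite of
its values on the edges of the path; the constraints of `H` provide the isomorphism `compare`. It
respects concatenation (`compare_comp`) and all 2-cells (`compare_cell`); the latter reduces to the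
generating cells, since every 2-cell is a composite of whiskered ones.

Both comparisons are icons: pseudonatural transformations whose components on objects are
identities. An icon is inverted by inverting its constraints, which gives the two inverse
transformations. Compatibility with morphisms of pseudofunctors (`counit_nat_coh`, `compare_nat`)
makes the invertible 2-cells `x ≫ 𝟙 ≅ 𝟙 ≫ x` naturality constraints of transformations between the
composite 2-functors and the identities. Their remaining axioms, and those of the invertible
modifications, are unitor coherence, because ΨΦ and ΦΨ leave the components on objects of `C`
unchanged. Finally, all components over `D^{Ob C}` are identities or unitors, and unitors in a
strict `D` are identities up to the equality of their source and target; hence everything lies over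
`D^{Ob C}`. -/

namespace MixedPsFun

/-! ### Icons: the axioms of transformations and modifications when the components are identities.
-/

section Icon

variable {D : Type u} [Bicategory.{w, v} D]

/-- The naturality constraint with identity components associated with an invertible `2`-cell. -/
def iconIso {X Y : D} {f g : X ⟶ Y} (κ : f ≅ g) : f ≫ 𝟙 Y ≅ 𝟙 X ≫ g :=
  ρ_ f ≪≫ κ ≪≫ (λ_ g).symm

/-- Unitors are natural, so they cancel and only the square for `κ` and `κ'` remains. Here `β` and
`β'` stand for the images of one 2-cell under two pseudofunctors. -/
theorem icon_nat {X Y : D} {f g f' g' : X ⟶ Y} {κ : f ≅ f'} {κ' : g ≅ g'} {β : f ⟶ g}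
    {β' : f' ⟶ g'} (h : β ≫ κ'.hom = κ.hom ≫ β') :
    β ▷ 𝟙 Y ≫ (iconIso κ').hom = (iconIso κ).hom ≫ 𝟙 X ◁ β' := by
  simp [iconIso, reassoc_of% h]

/-- The `_symm` variants keep the hypothesis of the original lemma and concern the inverse
constraints, so one verification serves an icon and its inverse. -/
theorem icon_nat_symm {X Y : D} {f g f' g' : X ⟶ Y} {κ : f ≅ f'} {κ' : g ≅ g'} {β : f ⟶ g}
    {β' : f' ⟶ g'} (h : β ≫ κ'.hom = κ.hom ≫ β') :
    β' ▷ 𝟙 Y ≫ (iconIso κ'.symm).hom = (iconIso κ.symm).hom ≫ 𝟙 X ◁ β :=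
  icon_nat (by rw [Iso.symm_hom, Iso.symm_hom, Iso.eq_inv_comp, ← reassoc_of% h]; simp)

/-- The unit axiom of an icon, where `s` and `t` are the unit constraints of its source and its
target. -/
theorem icon_id {X : D} {a b : X ⟶ X} {κ : a ≅ b} {s : a ⟶ 𝟙 X} {t : b ⟶ 𝟙 X}
    (h : κ.hom ≫ t = s) :
    (iconIso κ).hom ≫ 𝟙 X ◁ t = s ▷ 𝟙 X ≫ (λ_ (𝟙 X)).hom ≫ (ρ_ (𝟙 X)).inv := by
  subst h
  simp [iconIso, unitors_equal, unitors_inv_equal]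

theorem icon_id_symm {X : D} {a b : X ⟶ X} {κ : a ≅ b} {s : a ⟶ 𝟙 X} {t : b ⟶ 𝟙 X}
    (h : κ.hom ≫ t = s) :
    (iconIso κ.symm).hom ≫ 𝟙 X ◁ s = t ▷ 𝟙 X ≫ (λ_ (𝟙 X)).hom ≫ (ρ_ (𝟙 X)).inv :=
  icon_id (by simp [← h])

/-- The composition axiom of an icon, where `c` and `c'` are the composition constraints of its
source and its target. -/
theorem icon_comp {X Y Z : D} {f f' : X ⟶ Y} {g g' : Y ⟶ Z} {l l' : X ⟶ Z} {κf : f ≅ f'}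
    {κg : g ≅ g'} {κ : l ≅ l'} {c : l ⟶ f ≫ g} {c' : l' ⟶ f' ≫ g'}
    (h : κ.hom ≫ c' = c ≫ κf.hom ▷ g ≫ f' ◁ κg.hom) :
    (iconIso κ).hom ≫ 𝟙 X ◁ c' = c ▷ 𝟙 Z ≫ (α_ _ _ _).hom ≫ f ◁ (iconIso κg).hom ≫
      (α_ _ _ _).inv ≫ (iconIso κf).hom ▷ g' ≫ (α_ _ _ _).hom := by
  -- The pasting in the conclusion applies the constraint of `g` before that of `f`, opposite to the
  -- order in `h`.
  rw [← whisker_exchange] at h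
  calc
    _ = 𝟙 _ ⊗≫ (κ.hom ≫ c') ⊗≫ 𝟙 _ := by simp only [iconIso, Iso.trans_hom, Iso.symm_hom]; bicategory
    _ = _ := by rw [h]; simp only [iconIso, Iso.trans_hom, Iso.symm_hom]; bicategory

theorem icon_comp_symm {X Y Z : D} {f f' : X ⟶ Y} {g g' : Y ⟶ Z} {l l' : X ⟶ Z} {κf : f ≅ f'}
    {κg : g ≅ g'} {κ : l ≅ l'} {c : l ⟶ f ≫ g} {c' : l' ⟶ f' ≫ g'}
    (h : κ.hom ≫ c' = c ≫ κf.hom ▷ g ≫ f' ◁ κg.hom) :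
    (iconIso κ.symm).hom ≫ 𝟙 X ◁ c = c' ▷ 𝟙 Z ≫ (α_ _ _ _).hom ≫ f' ◁ (iconIso κg.symm).hom ≫
      (α_ _ _ _).inv ≫ (iconIso κf.symm).hom ▷ g ≫ (α_ _ _ _).hom := by
  refine icon_comp ?_
  rw [← whisker_exchange, Iso.symm_hom, Iso.inv_comp_eq, reassoc_of% h]
  simp

/-- The axiom `nat_sq` of `Mor` for an icon: once the unitors are removed, the constraints on the
four edges only have to carry `S` to `S'`. -/
theorem icon_sq {X Y Z W : D} {j j' : X ⟶ Y} {i i' : Z ⟶ W} {q q' : X ⟶ Z} {p p' : Y ⟶ W}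
    {κj : j ≅ j'} {κi : i ≅ i'} {κq : q ≅ q'} {κp : p ≅ p'}
    {S : q ≫ i ⟶ j ≫ p} {S' : q' ≫ i' ⟶ j' ≫ p'}
    (h : S ≫ κj.hom ▷ p ≫ j' ◁ κp.hom = κq.hom ▷ i ≫ q' ◁ κi.hom ≫ S') :
    S ▷ 𝟙 W ≫ (α_ _ _ _).hom ≫ j ◁ (iconIso κp).hom ≫ (α_ _ _ _).inv ≫
        (iconIso κj).hom ▷ p' ≫ (α_ _ _ _).hom =
      (α_ _ _ _).hom ≫ q ◁ (iconIso κi).hom ≫ (α_ _ _ _).inv ≫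
        (iconIso κq).hom ▷ i' ≫ (α_ _ _ _).hom ≫ 𝟙 X ◁ S' := by
  rw [← whisker_exchange, ← whisker_exchange_assoc] at h
  calc
    _ = 𝟙 _ ⊗≫ (S ≫ j ◁ κp.hom ≫ κj.hom ▷ p') ⊗≫ 𝟙 _ := by
      simp only [iconIso, Iso.trans_hom, Iso.symm_hom]; bicategory
    _ = _ := by rw [h]; simp only [iconIso, Iso.trans_hom, Iso.symm_hom]; bicategory

theorem icon_sq_symm {X Y Z W : D} {j j' : X ⟶ Y} {i i' : Z ⟶ W} {q q' : X ⟶ Z} {p p' : Y ⟶ W}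
    {κj : j ≅ j'} {κi : i ≅ i'} {κq : q ≅ q'} {κp : p ≅ p'}
    {S : q ≫ i ⟶ j ≫ p} {S' : q' ≫ i' ⟶ j' ≫ p'}
    (h : S ≫ κj.hom ▷ p ≫ j' ◁ κp.hom = κq.hom ▷ i ≫ q' ◁ κi.hom ≫ S') :
    S' ▷ 𝟙 W ≫ (α_ _ _ _).hom ≫ j' ◁ (iconIso κp.symm).hom ≫ (α_ _ _ _).inv ≫
        (iconIso κj.symm).hom ▷ p ≫ (α_ _ _ _).hom =
      (α_ _ _ _).hom ≫ q' ◁ (iconIso κi.symm).hom ≫ (α_ _ _ _).inv ≫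
        (iconIso κq.symm).hom ▷ i ≫ (α_ _ _ _).hom ≫ 𝟙 X ◁ S := by
  refine icon_sq ?_
  -- Composing `h` with the inverse constraints on both sides solves it for the opposite square; the
  -- cancellations follow after one interchange.
  have := κq.inv ▷ i' ≫= (q ◁ κi.inv ≫= (h =≫ (j' ◁ κp.inv ≫ κj.inv ▷ p)))
  simp only [Category.assoc] at this
  rw [← whisker_exchange_assoc (κq.inv), ← whisker_exchange_assoc (κq.inv)] at this
  simp only [whiskerLeft_hom_inv_assoc, hom_inv_whiskerRight, Category.comp_id,
    inv_hom_whiskerRight_assoc, whiskerLeft_inv_hom_assoc] at this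
  simp only [Iso.symm_hom]
  rw [← whisker_exchange, ← whisker_exchange_assoc, this]

/-- For a transformation with constraint `A` between the sources of two icons and one with
constraint `B` between the targets, `h` says that the icons intertwine them. The conclusion is then
the modification axiom for the cells `x ≫ 𝟙 ≅ 𝟙 ≫ x`, from `A` followed by an icon to an icon
followed by `B`. -/
theorem icon_modif {X Y X' Y' : D} {f g : X ⟶ Y} {f' g' : X' ⟶ Y'} {x : X ⟶ X'} {y : Y ⟶ Y'}
    {κ : f ≅ g} {κ' : f' ≅ g'} {A : f ≫ y ⟶ x ≫ f'} {B : g ≫ y ⟶ x ≫ g'}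
    (h : A ≫ x ◁ κ'.hom = κ.hom ▷ y ≫ B) :
    f ◁ ((ρ_ y).hom ≫ (λ_ y).inv) ≫ ((α_ _ _ _).inv ≫ (iconIso κ).hom ▷ y ≫ (α_ _ _ _).hom ≫
        𝟙 X ◁ B ≫ (α_ _ _ _).inv) =
      ((α_ _ _ _).inv ≫ A ▷ 𝟙 Y' ≫ (α_ _ _ _).hom ≫ x ◁ (iconIso κ').hom ≫ (α_ _ _ _).inv) ≫
        ((ρ_ x).hom ≫ (λ_ x).inv) ▷ g' := by
  calc
    _ = 𝟙 _ ⊗≫ (κ.hom ▷ y ≫ B) ⊗≫ 𝟙 _ := by simp only [iconIso, Iso.trans_hom, Iso.symm_hom]; bicategory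
    _ = _ := by rw [← h]; simp only [iconIso, Iso.trans_hom, Iso.symm_hom]; bicategory

theorem icon_modif_symm {X Y X' Y' : D} {f g : X ⟶ Y} {f' g' : X' ⟶ Y'} {x : X ⟶ X'}
    {y : Y ⟶ Y'} {κ : f ≅ g} {κ' : f' ≅ g'} {A : f ≫ y ⟶ x ≫ f'} {B : g ≫ y ⟶ x ≫ g'}
    (h : A ≫ x ◁ κ'.hom = κ.hom ▷ y ≫ B) :
    g ◁ ((ρ_ y).hom ≫ (λ_ y).inv) ≫ ((α_ _ _ _).inv ≫ (iconIso κ.symm).hom ▷ y ≫ (α_ _ _ _).hom ≫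
        𝟙 X ◁ A ≫ (α_ _ _ _).inv) =
      ((α_ _ _ _).inv ≫ B ▷ 𝟙 Y' ≫ (α_ _ _ _).hom ≫ x ◁ (iconIso κ'.symm).hom ≫
        (α_ _ _ _).inv) ≫ ((ρ_ x).hom ≫ (λ_ x).inv) ▷ f' :=
  icon_modif (by
    rw [← cancel_mono (x ◁ κ'.hom), ← cancel_epi (κ.hom ▷ y)]
    simp [h])

/-- Modification axiom for `𝟙 ≅ 𝟙 ≫ 𝟙`, from the identity transformation to an icon followed by its
inverse: `κ` cancels against its inverse. -/
theorem icon_unit {X Y : D} {f g : X ⟶ Y} (κ : f ≅ g) :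
    f ◁ (λ_ (𝟙 Y)).inv ≫ ((α_ _ _ _).inv ≫ (iconIso κ).hom ▷ 𝟙 Y ≫ (α_ _ _ _).hom ≫
        𝟙 X ◁ (iconIso κ.symm).hom ≫ (α_ _ _ _).inv) =
      ((ρ_ f).hom ≫ (λ_ f).inv) ≫ (λ_ (𝟙 X)).inv ▷ f := by
  calc
    _ = 𝟙 _ ⊗≫ (κ.hom ≫ κ.inv) ⊗≫ 𝟙 _ := by
      simp only [iconIso, Iso.trans_hom, Iso.symm_hom]; bicategory
    _ = _ := by rw [Iso.hom_inv_id]; bicategory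

/-- The companion of `icon_unit` for the inverse icon followed by the icon, ending at the identity
transformation. -/
theorem icon_counit {X Y : D} {f g : X ⟶ Y} (κ : f ≅ g) :
    g ◁ (λ_ (𝟙 Y)).hom ≫ ((ρ_ g).hom ≫ (λ_ g).inv) =
      ((α_ _ _ _).inv ≫ (iconIso κ.symm).hom ▷ 𝟙 Y ≫ (α_ _ _ _).hom ≫
        𝟙 X ◁ (iconIso κ).hom ≫ (α_ _ _ _).inv) ≫ (λ_ (𝟙 X)).hom ▷ g := by
  symm
  calc
    _ = 𝟙 _ ⊗≫ (κ.inv ≫ κ.hom) ⊗≫ 𝟙 _ := by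
      simp only [iconIso, Iso.trans_hom, Iso.symm_hom]; bicategory
    _ = _ := by rw [Iso.inv_hom_id]; bicategory

end Icon

/-! ### The comparison of ΨΦF with F. -/

variable {n : ℕ} {C : NFoldCat.{t} n} {D : Type u} [Bicategory.{w, v} D]

/-- The pseudofunctor `C → D` underlying `F.lift`. -/
abbrev unlift (F : MixedPsFun C D) : MixedPsFun C D := (T.unit C).postcomp F.lift

/-- The unit constraint of `F.lift` is an identity, so that of `F.unlift` is just the value of `θ`,
which `basicMap` defines with a leading unitor. -/
theorem counit_id (F : MixedPsFun C D) (k : Fin n) (X : C.Obj) :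
    (λ_ (F.edge (Edge.id k X))).hom ≫ (F.edgeId k X).hom = ((F.unlift.line k).mapId X).hom := by
  have e : F.trafoMap (Trafo.of (.theta k X)) = _ := F.trafoMap_of_rfl (.theta k X)
  change _ = F.trafoMap (Trafo.of (.theta k X)) ≫ 𝟙 _
  rw [e]
  exact (Category.comp_id _).symm

/-- The first bracket on the right is the value of `δ`, the second is `pathComp` on two paths of
length one. Stating the coherence in an arbitrary bicategory frees it from the recursive
definitions. -/
theorem counit_comp_coh {X Y Z : D} {f : X ⟶ Y} {g : Y ⟶ Z} {l : X ⟶ Z} (c : l ⟶ f ≫ g) :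
    (λ_ l).hom ≫ c = ((𝟙 X ◁ c ≫ (α_ (𝟙 X) f g).inv) ≫
      ((ρ_ (𝟙 X ≫ f)).inv ▷ g ≫ (α_ _ _ _).hom)) ≫ (λ_ f).hom ▷ (𝟙 Y ≫ g) ≫ f ◁ (λ_ g).hom := by
  bicategory

/-- The composition constraint of `F.unlift` is the value of `δ` followed by `pathComp`; only units
distinguish it from `edgeComp`. -/
theorem counit_comp (F : MixedPsFun C D) {k : Fin n} {X Y Z : C.Obj} (f : Edge k X Y)
    (g : Edge k Y Z) :
    (λ_ (F.edge (f.comp g))).hom ≫ (F.edgeComp f g).hom =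
      ((F.unlift.line k).mapComp f g).hom ≫ (λ_ (F.edge f)).hom ▷ (𝟙 _ ≫ F.edge g) ≫
        F.edge f ◁ (λ_ (F.edge g)).hom := by
  have e : F.trafoMap (Trafo.of (.delta f g)) = _ := F.trafoMap_of_rfl (.delta f g)
  refine (counit_comp_coh _).trans (congrArg (· ≫ _) ?_)
  change _ = F.trafoMap (Trafo.of (.delta f g)) ≫ _
  rw [e]
  rfl

theorem counit_sq_coh {X Y Z W : D} {j : X ⟶ Y} {i : Z ⟶ W} {q : X ⟶ Z} {p : Y ⟶ W}
    (S : q ≫ i ⟶ j ≫ p) :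
    (((α_ _ _ _).inv ≫ (ρ_ (𝟙 X ≫ q)).hom ▷ i) ≫
      ((α_ (𝟙 X) q i).hom ≫ 𝟙 X ◁ S ≫ (α_ (𝟙 X) j p).inv) ≫
      ((ρ_ (𝟙 X ≫ j)).inv ▷ p ≫ (α_ _ _ _).hom)) ≫ (λ_ j).hom ▷ (𝟙 Y ≫ p) ≫ j ◁ (λ_ p).hom =
    (λ_ q).hom ▷ (𝟙 Z ≫ i) ≫ q ◁ (λ_ i).hom ≫ S := by
  bicategory

/-- The square of `F.unlift` is the value of `σ` conjugated by `pathComp`, and that value is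
`F.face` padded with units. -/
theorem counit_sq (F : MixedPsFun C D) {k k' : Fin n} (h : k < k') {X Y Z W : C.Obj}
    {j : Edge k X Y} {i : Edge k Z W} {q : Edge k' X Z} {p : Edge k' Y W} (S : Sq j i q p) :
    F.unlift.sq h S ≫ (λ_ (F.edge j)).hom ▷ (𝟙 _ ≫ F.edge p) ≫ F.edge j ◁ (λ_ (F.edge p)).hom =
      (λ_ (F.edge q)).hom ▷ (𝟙 _ ≫ F.edge i) ≫ F.edge q ◁ (λ_ (F.edge i)).hom ≫ F.face h S := by
  have e : F.trafoMap (Trafo.of (.sigma h S)) = _ := F.trafoMap_of_rfl (.sigma h S)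
  refine Eq.trans (congrArg (· ≫ _) ?_) (counit_sq_coh _)
  -- This is `mapSq` unfolded; only its middle factor, the image of `σ`, has to be evaluated.
  exact congrArg (fun x => (F.pathComp q.path i.path).inv ≫ x ≫ (F.pathComp j.path p.path).hom) e

/-- The component `ΨΦF → F` of the counit. -/
def counit (F : MixedPsFun C D) : F.unlift ⟶ F where
  app X := 𝟙 (F.obj X)
  -- A path of length one is sent to `𝟙 ≫ F.edge e`, whence the left unitor.
  nat e := iconIso (λ_ (F.edge e))
  nat_id k X := icon_id (κ := λ_ (F.edge (Edge.id k X))) (F.counit_id k X)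
  nat_comp f g := icon_comp (F.counit_comp f g)
  nat_sq h _ _ _ _ _ _ _ _ S := icon_sq (F.counit_sq h S)

/-- The component `F → ΨΦF` of the inverse of the counit. -/
def counitInv (F : MixedPsFun C D) : F ⟶ F.unlift where
  app X := 𝟙 (F.obj X)
  nat e := iconIso (λ_ (F.edge e)).symm
  nat_id k X := icon_id_symm (κ := λ_ (F.edge (Edge.id k X))) (F.counit_id k X)
  nat_comp f g := icon_comp_symm (F.counit_comp f g)
  nat_sq h _ _ _ _ _ _ _ _ S := icon_sq_symm (F.counit_sq h S)

/-! ### Coherence diagrams for comparing the value on a path with the composite of the values on its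
edges. -/

section

variable {D : Type u} [Bicategory.{w, v} D]

/-- The inductive step of `compare_comp`, for a second path `q` extended by an edge `e`. The
hypothesis `h` is the case of `q`, and `hm` rebrackets the constraints of the pseudofunctor. -/
theorem compare_coh_comp {X Y Z W : D} {p p' : X ⟶ Y} {q q' : Y ⟶ Z} {e : Z ⟶ W} {pq pq' : X ⟶ Z}
    {qe : Y ⟶ W} {l : X ⟶ W} {κp : p ⟶ p'} {κq : q ⟶ q'} {κ : pq ⟶ pq'} {c : pq ⟶ p ≫ q}
    {c' : pq' ⟶ p' ≫ q'} {m : l ⟶ pq ≫ e} {m' : l ⟶ p ≫ qe} {d : qe ⟶ q ≫ e}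
    (h : κ ≫ c' = c ≫ κp ▷ q ≫ p' ◁ κq)
    (hm : m ≫ c ▷ e ≫ (α_ _ _ _).hom = m' ≫ p ◁ d) :
    (m ≫ κ ▷ e) ≫ c' ▷ e ≫ (α_ _ _ _).hom = m' ≫ κp ▷ qe ≫ p' ◁ (d ≫ κq ▷ e) := by
  calc
    _ = m ≫ (κ ≫ c') ▷ e ≫ (α_ _ _ _).hom := by simp
    _ = (m ≫ c ▷ e ≫ (α_ _ _ _).hom) ≫ κp ▷ (q ≫ e) ≫ p' ◁ κq ▷ e := by rw [h]; simp
    _ = _ := by rw [hm]; simp only [Category.assoc, whiskerLeft_comp, whisker_exchange_assoc]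

/-- The hypothesis is the associativity axiom of a pseudofunctor when the associator in its source
is an identity; the inverse constraints are moved to the other side. -/
theorem compare_coh_assoc {X Y Z W : D} {p : X ⟶ Y} {q : Y ⟶ Z} {e : Z ⟶ W} {pq : X ⟶ Z}
    {qe : Y ⟶ W} {l : X ⟶ W} {c : pq ⟶ p ≫ q} {m : l ⟶ pq ≫ e} {m' : l ≅ p ≫ qe} {d : qe ≅ q ≫ e}
    (h : 𝟙 l = m ≫ c ▷ e ≫ (α_ _ _ _).hom ≫ p ◁ d.inv ≫ m'.inv) :
    m ≫ c ▷ e ≫ (α_ _ _ _).hom = m'.hom ≫ p ◁ d.hom := by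
  have := h =≫ (m'.hom ≫ p ◁ d.hom)
  simpa using this.symm

/-- The base case of `compare_comp`; the hypothesis is the right unit axiom with a trivial unitor in
the source. -/
theorem compare_coh_nil {X Y : D} {p p' : X ⟶ Y} {i : Y ⟶ Y} {κ : p ⟶ p'} {c : p ⟶ p ≫ i}
    {s : i ⟶ 𝟙 Y} (h : 𝟙 p = c ≫ p ◁ s ≫ (ρ_ p).hom) :
    κ ≫ (ρ_ p').inv = c ≫ κ ▷ i ≫ p' ◁ s := by
  have := h =≫ κ
  rw [← whisker_exchange, ← cancel_mono (ρ_ p').hom]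
  simpa using this

theorem compare_coh_vcomp {K : Type*} [Category K] {u v x u' v' x' : K} {κu : u ⟶ u'}
    {κv : v ⟶ v'} {κx : x ⟶ x'} {β : u ⟶ v} {β' : u' ⟶ v'} {γ : v ⟶ x} {γ' : v' ⟶ x'}
    (h : β ≫ κv = κu ≫ β') (h' : γ ≫ κx = κv ≫ γ') : (β ≫ γ) ≫ κx = κu ≫ β' ≫ γ' := by
  rw [Category.assoc, h', reassoc_of% h]

/-- By `hu` and `hv` the comparison respects concatenation, so its square for `β` can be whiskered
by a path on the source side. `compare_coh_right` is the same on the target side. -/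
theorem compare_coh_left {X Y Z : D} {f f' : X ⟶ Y} {u v u' v' : Y ⟶ Z} {pu pv pu' pv' : X ⟶ Z}
    {cu : pu ≅ f ≫ u} {cv : pv ≅ f ≫ v} {cu' : pu' ≅ f' ≫ u'} {cv' : pv' ≅ f' ≫ v'}
    {κf : f ⟶ f'} {κu : u ⟶ u'} {κv : v ⟶ v'} {Ku : pu ⟶ pu'} {Kv : pv ⟶ pv'} {β : u ⟶ v}
    {β' : u' ⟶ v'} (hu : Ku ≫ cu'.hom = cu.hom ≫ κf ▷ u ≫ f' ◁ κu)
    (hv : Kv ≫ cv'.hom = cv.hom ≫ κf ▷ v ≫ f' ◁ κv) (h : β ≫ κv = κu ≫ β') :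
    (cu.hom ≫ f ◁ β ≫ cv.inv) ≫ Kv = Ku ≫ cu'.hom ≫ f' ◁ β' ≫ cv'.inv := by
  rw [← cancel_mono cv'.hom]
  simp only [Category.assoc, hv, Iso.inv_hom_id, Category.comp_id, Iso.inv_hom_id_assoc]
  rw [reassoc_of% hu, ← whiskerLeft_comp, ← h, whiskerLeft_comp, whisker_exchange_assoc]

theorem compare_coh_right {X Y Z : D} {f f' : Y ⟶ Z} {u v u' v' : X ⟶ Y} {pu pv pu' pv' : X ⟶ Z}
    {cu : pu ≅ u ≫ f} {cv : pv ≅ v ≫ f} {cu' : pu' ≅ u' ≫ f'} {cv' : pv' ≅ v' ≫ f'}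
    {κf : f ⟶ f'} {κu : u ⟶ u'} {κv : v ⟶ v'} {Ku : pu ⟶ pu'} {Kv : pv ⟶ pv'} {β : u ⟶ v}
    {β' : u' ⟶ v'} (hu : Ku ≫ cu'.hom = cu.hom ≫ κu ▷ f ≫ u' ◁ κf)
    (hv : Kv ≫ cv'.hom = cv.hom ≫ κv ▷ f ≫ v' ◁ κf) (h : β ≫ κv = κu ≫ β') :
    (cu.hom ≫ β ▷ f ≫ cv.inv) ≫ Kv = Ku ≫ cu'.hom ≫ β' ▷ f' ≫ cv'.inv := by
  rw [← cancel_mono cv'.hom]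
  simp only [Category.assoc, hv, Iso.inv_hom_id, Category.comp_id, Iso.inv_hom_id_assoc]
  rw [reassoc_of% hu, whisker_exchange, ← comp_whiskerRight_assoc, ← comp_whiskerRight_assoc, h]

/-- The case of `θ`. In its use `φ` is an identity, whose two ends agree only after unfolding. -/
theorem compare_coh_theta {X : D} {a : X ⟶ X} {A I : X ⟶ X} {κ : A ⟶ 𝟙 X ≫ a} {i : I ⟶ 𝟙 X}
    {s : A ⟶ I} {φ : A ⟶ a} (h : κ ≫ (λ_ a).hom = φ) {s' : a ⟶ I} (hs : φ ≫ s' = s) :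
    s ≫ i = κ ≫ (λ_ a).hom ≫ s' ≫ i := by
  rw [reassoc_of% h, reassoc_of% hs]

/-- Naturality at a cell gives naturality at its inverse, so `ι` and `γ` follow from `θ` and `δ`. -/
theorem compare_coh_inv {K : Type*} [Category K] {u v u' v' : K} {κu : u ⟶ u'} {κv : v ⟶ v'}
    {β : u ⟶ v} {β' : u' ⟶ v'} {γ : v ⟶ u} {γ' : v' ⟶ u'} (h : β ≫ κv = κu ≫ β')
    (hγ : γ ≫ β = 𝟙 _) (hγ' : β' ≫ γ' = 𝟙 _) : γ ≫ κu = κv ≫ γ' := by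
  have := γ ≫= (h =≫ γ')
  simp only [Category.assoc, hγ', Category.comp_id] at this
  rw [← this, reassoc_of% hγ]

/-- The hypotheses force `κf` and `κl` to be inverse unitors; `d` is the image of `δ` and `M` the
composition constraint for two edges. -/
theorem compare_coh_delta {X Y Z : D} {f : X ⟶ Y} {g : Y ⟶ Z} {l m : X ⟶ Z} {κf : f ⟶ 𝟙 X ≫ f}
    {κl : l ⟶ 𝟙 X ≫ l} {M : m ⟶ f ≫ g} {d : l ⟶ m} (h : κf ≫ (λ_ f).hom = 𝟙 f)
    (hl : κl ≫ (λ_ l).hom = 𝟙 l) :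
    d ≫ (M ≫ κf ▷ g) = κl ≫ 𝟙 X ◁ (d ≫ M) ≫ (α_ _ _ _).inv := by
  have h' : κf = (λ_ f).inv := by rw [← cancel_mono (λ_ f).hom, h, Iso.inv_hom_id]
  have hl' : κl = (λ_ l).inv := by rw [← cancel_mono (λ_ l).hom, hl, Iso.inv_hom_id]
  subst h' hl'
  simp

/-- Restriction conjugates the image `S` of `σ` by the constraints `A` and `B`; the comparison on
two edges consists of these same constraints and a unitor, so they cancel. -/
theorem compare_coh_sigma {X Y Z W : D} {j : X ⟶ Y} {i : Z ⟶ W} {q : X ⟶ Z} {p : Y ⟶ W}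
    {a b : X ⟶ W} {κq : q ⟶ 𝟙 X ≫ q} {κj : j ⟶ 𝟙 X ≫ j} {A : a ≅ q ≫ i} {B : b ≅ j ≫ p}
    {S : a ⟶ b} (hq : κq ≫ (λ_ q).hom = 𝟙 q) (hj : κj ≫ (λ_ j).hom = 𝟙 j) :
    S ≫ (B.hom ≫ κj ▷ p) = (A.hom ≫ κq ▷ i) ≫ (α_ _ _ _).hom ≫
      𝟙 X ◁ (A.inv ≫ S ≫ B.hom) ≫ (α_ _ _ _).inv := by
  have hq' : κq = (λ_ q).inv := by rw [← cancel_mono (λ_ q).hom, hq, Iso.inv_hom_id]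
  have hj' : κj = (λ_ j).inv := by rw [← cancel_mono (λ_ j).hom, hj, Iso.inv_hom_id]
  subst hq' hj'
  simp

/-- The inductive step of `compare_nat`: `hL` splits off the constraint `E` at the last edge, `h`
treats the rest of the path, and the interchange law reorders the two. -/
theorem compare_coh_nat_cons {X Y Z X' Y' Z' : D} {p P : X ⟶ Y} {e : Y ⟶ Z} {l : X ⟶ Z}
    {p' P' : X' ⟶ Y'} {e' : Y' ⟶ Z'} {l' : X' ⟶ Z'} {x : X ⟶ X'} {y : Y ⟶ Y'} {z : Z ⟶ Z'}
    {m : l ⟶ p ≫ e} {m' : l' ⟶ p' ≫ e'} {κ : p ⟶ P} {κ' : p' ⟶ P'} {L : l ≫ z ⟶ x ≫ l'}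
    {A : p ≫ y ⟶ x ≫ p'} {B : P ≫ y ⟶ x ≫ P'} {E : e ≫ z ⟶ y ≫ e'}
    (hL : L ≫ x ◁ m' = m ▷ z ≫ (α_ _ _ _).hom ≫ p ◁ E ≫ (α_ _ _ _).inv ≫ A ▷ e' ≫ (α_ _ _ _).hom)
    (h : A ≫ x ◁ κ' = κ ▷ y ≫ B) :
    L ≫ x ◁ (m' ≫ κ' ▷ e') = (m ≫ κ ▷ e) ▷ z ≫ ((α_ _ _ _).hom ≫ P ◁ E ≫ (α_ _ _ _).inv ≫
      B ▷ e' ≫ (α_ _ _ _).hom) := by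
  calc
    _ = (L ≫ x ◁ m') ≫ x ◁ κ' ▷ e' := by simp
    _ = m ▷ z ⊗≫ p ◁ E ⊗≫ (A ≫ x ◁ κ') ▷ e' ⊗≫ 𝟙 _ := by rw [hL]; bicategory
    _ = m ▷ z ⊗≫ (p ◁ E ≫ κ ▷ (y ≫ e')) ⊗≫ B ▷ e' ⊗≫ 𝟙 _ := by rw [h]; bicategory
    _ = _ := by rw [whisker_exchange]; bicategory

end

/-! ### The comparison of H with ΦΨH. -/

variable {n : ℕ} {C : NFoldCat.{t} n} {D : Type u} [Bicategory.{w, v} D]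

/-- The pseudofunctor `C → D` obtained from a pseudofunctor `T C → D` by restriction. -/
abbrev restrict (H : T C ⥤ᵖ D) : MixedPsFun C D := (T.unit C).postcomp H

/-- The comparison of the image of a path with the composite of the images of its edges. -/
def compare (H : T C ⥤ᵖ D) {X : C.Obj} : ∀ {Y : C.Obj} (p : TPath X Y),
    H.map (T.hom p) ≅ (restrict H).pathMap p
  | _, .nil => H.mapId ⟨X⟩
  | _, .cons p e => H.mapComp (T.hom p) (T.hom e.path) ≪≫
      whiskerRightIso (compare H p) ((restrict H).edge e)

/-- Both ways of splitting a concatenation into edges use only constraints of `H`, and those are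
coherent. The induction is on `q`, on which concatenation recurses. -/
theorem compare_comp (H : T C ⥤ᵖ D) {X Y Z : C.Obj} (p : TPath X Y) (q : TPath Y Z) :
    (compare H (p.comp q)).hom ≫ ((restrict H).pathComp p q).hom =
      (H.mapComp (T.hom p) (T.hom q)).hom ≫ (compare H p).hom ▷ H.map (T.hom q) ≫
        (restrict H).pathMap p ◁ (compare H q).hom := by
  induction q with
  | nil =>
    have h := H.map₂_right_unitor (T.hom p)
    -- Concatenation with the empty path on the right is definitionally trivial, so the right unitor
    -- of `T C` is an identity.
    have h' : H.map₂ (ρ_ (T.hom p)).hom = 𝟙 _ := H.map₂_id _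
    exact compare_coh_nil (h'.symm.trans h)
  | cons q e ih =>
    have h := H.map₂_associator (T.hom p) (T.hom q) (T.hom e.path)
    -- The two bracketings agree definitionally because the third path is a single edge.
    have h' : H.map₂ (α_ (T.hom p) (T.hom q) (T.hom e.path)).hom = 𝟙 _ := H.map₂_id _
    exact compare_coh_comp ih (compare_coh_assoc (h'.symm.trans h))

/-- The left unit axiom of `H`, in which the unitor of `T C` disappears on a single edge; it
identifies `compare` on an edge with the inverse left unitor. -/
theorem compare_path (H : T C ⥤ᵖ D) {k : Fin n} {X Y : C.Obj} (e : Edge k X Y) :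
    (compare H e.path).hom ≫ (λ_ ((restrict H).edge e)).hom = 𝟙 ((restrict H).edge e) := by
  have h := H.map₂_left_unitor (T.hom e.path)
  have h' : H.map₂ (λ_ (T.hom e.path)).hom = 𝟙 _ := H.map₂_id _
  exact (Category.assoc _ _ _).trans (h.symm.trans h')

/-- Φ evaluates a generating cell through the constraints and squares of the restriction of `H`,
which are themselves the image under `H` of that cell corrected by constraints of `H`. -/
theorem compare_basic (H : T C ⥤ᵖ D) {X Y : C.Obj} {u v : TPath X Y} (b : C.Basic u v) :
    H.map₂ (T.hom₂ (Trafo.of b)) ≫ (compare H v).hom =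
      (compare H u).hom ≫ (restrict H).basicMap b := by
  -- `θ` and `δ` are treated directly, since they define the constraints of the restriction; their
  -- inverses come from `compare_coh_inv`.
  have theta (k : Fin n) (X : C.Obj) : H.map₂ (T.hom₂ (Trafo.of (.theta k X))) ≫
      (compare H .nil).hom = (compare H (Edge.id k X).path).hom ≫
        (restrict H).basicMap (.theta k X) :=
    compare_coh_theta (compare_path H (Edge.id k X)) (Category.id_comp _)
  have delta {k : Fin n} {X Y Z : C.Obj} (f : Edge k X Y) (g : Edge k Y Z) :
      H.map₂ (T.hom₂ (Trafo.of (.delta f g))) ≫ (compare H (f.path.comp g.path)).hom =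
        (compare H (f.comp g).path).hom ≫ (restrict H).basicMap (.delta f g) :=
    compare_coh_delta (compare_path H f) (compare_path H (f.comp g))
  cases b with
  | iota k X =>
    exact compare_coh_inv (theta k X) (H.map₂Iso (T.idIso k X)).inv_hom_id
      (snd_hom_inv ((restrict H).edgeId k X))
  | theta k X => exact theta k X
  | gamma f g =>
    exact compare_coh_inv (delta f g) (H.map₂Iso (T.compIso f g)).inv_hom_id
      (snd_delta_gamma ((restrict H).edgeComp f g))
  | delta f g => exact delta f g
  | sigma h S => exact compare_coh_sigma (compare_path H _) (compare_path H _)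

/-- Writing an atomic cell by means of bicategorical whiskering makes the whiskering axioms of a
pseudofunctor applicable to it. -/
theorem cell_whiskered {X W Z Y : C.Obj} (f : TPath X W) {u v : TPath W Z} (b : C.Basic u v)
    (g : TPath Z Y) : (Trafo.whiskered f b g).cell =
      NFoldCat.whiskR (NFoldCat.whiskL f (Trafo.of b).cell) g :=
  (Atomic.cell_congr b _ _ _ _ (by simp) (by simp)).trans
    ((Category.id_comp _).trans (Category.comp_id _))

/-- Every 2-cell is a composite of atomic ones and naturality squares can be pasted, so
`compare_basic` and stability under whiskering suffice. -/
theorem compare_cell (H : T C ⥤ᵖ D) {X Y : C.Obj} {p q : TPath X Y} (s : p ⟶ q) :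
    H.map₂ (show T.hom p ⟶ T.hom q from s) ≫ (compare H q).hom =
      (compare H p).hom ≫ (restrict H).cellMap s := by
  induction s using cell_ind with
  | hid p =>
    refine (congrArg (· ≫ _) (H.map₂_id (T.hom p))).trans ?_
    exact (Category.id_comp _).trans (Category.comp_id _).symm
  | hcons s a ih =>
    obtain ⟨f, b, g, rfl, rfl⟩ := a
    have e : H.map₂ (show T.hom ((f.comp _).comp g) ⟶ T.hom ((f.comp _).comp g) from
        (Atomic.mk f b g rfl rfl).cell) ≫ (compare H _).hom = (compare H _).hom ≫
          (restrict H).cellMap (Atomic.mk f b g rfl rfl).cell := by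
      have e₁ : (restrict H).cellMap (Atomic.mk f b g rfl rfl).cell =
        (restrict H).conjR ((restrict H).conjL f ((restrict H).basicMap b)) g :=
        (restrict H).trafoMap_whiskered f b g
      rw [e₁]
      -- The square for the generating cell `b` is whiskered by `f`, then by `g`; `compare_comp`
      -- supplies the compatibility each time.
      have e₂ := compare_coh_left (compare_comp H f _) (compare_comp H f _) (compare_basic H b)
      have e₃ := compare_coh_right (compare_comp H _ g) (compare_comp H _ g) e₂
      refine Eq.trans (congrArg (· ≫ _) ?_) e₃
      refine (congrArg H.map₂ (cell_whiskered f b g)).trans ?_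
      refine (H.map₂_whisker_right _ _).trans ?_
      refine congrArg (_ ≫ · ≫ _) (congrArg (· ▷ _) ?_)
      exact H.map₂_whisker_left _ _
    rw [cellMap_comp]
    refine (congrArg (· ≫ _) (H.map₂_comp _ _)).trans ?_
    exact compare_coh_vcomp ih e

/-- The component `H → ΦΨH` of the unit. -/
def unit (H : T C ⥤ᵖ D) : H ⟶ (restrict H).lift where
  app X := 𝟙 (H.obj X)
  naturality p := iconIso (compare H p)
  naturality_naturality s := icon_nat (compare_cell H s)
  -- On the empty path `compare` is the unit constraint of `H`, while the unit constraint of the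
  -- lift is an identity.
  naturality_id _ := icon_id (Category.comp_id _)
  naturality_comp p q := icon_comp (compare_comp H p q)

/-- The component `ΦΨH → H` of the inverse of the unit. -/
def unitInv (H : T C ⥤ᵖ D) : (restrict H).lift ⟶ H where
  app X := 𝟙 (H.obj X)
  naturality p := iconIso (compare H p).symm
  naturality_naturality s := icon_nat_symm (compare_cell H s)
  naturality_id _ := icon_id_symm (Category.comp_id _)
  naturality_comp p q := icon_comp_symm (compare_comp H p q)

/-- The composition axiom of `η` determines its constraint at a path from those at the edges, and
`pathNat` is that pasting. This makes the comparison natural in `H`. -/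
theorem compare_nat {H H' : T C ⥤ᵖ D} (η : H ⟶ H') {X Y : C.Obj} (p : TPath X Y) :
    (η.naturality (T.hom p)).hom ≫ η.app ⟨X⟩ ◁ (compare H' p).hom =
      (compare H p).hom ▷ η.app ⟨Y⟩ ≫ (pathNat ((T.unit C).postcompMap η) p).hom := by
  induction p with
  | nil => exact η.naturality_id ⟨X⟩
  | cons p e ih => exact compare_coh_nat_cons (η.naturality_comp (T.hom p) (T.hom e.path)) ih

end MixedPsFun

/-! ### Cells over identities of `D^{Ob C}`, and naturality of the two comparisons. -/

/-- Heterogeneous equality is unavoidable: `x ≫ 𝟙`, `𝟙 ≫ x` and `x` are equal without being the same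
term. The lemma reduces it to a check on the components. -/
theorem PowCat.heq_id {S : Type t} {D : Type u} [Bicategory.{w, v} D] {F G : PowCat S D}
    {f g h : F ⟶ G} (a : f ⟶ g) (hf : ∀ X, f.app X = h.app X) (hg : ∀ X, g.app X = h.app X)
    (ha : ∀ X, a.app X = eqToHom ((hf X).trans (hg X).symm)) : HEq a (𝟙 h) := by
  obtain rfl : f = h := Hom.ext (funext hf)
  obtain rfl : g = f := Hom.ext (funext hg)
  exact heq_of_eq (PowCat.hom_ext ha)

namespace MixedPsFun

section

variable {D : Type u} [Bicategory.{w, v} D]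

/-- The naturality constraint of an identity. -/
def slideIso {X Y : D} (x : X ⟶ Y) : x ≫ 𝟙 Y ≅ 𝟙 X ≫ x := ρ_ x ≪≫ (λ_ x).symm

/-- In the uses, `a` and `b` are components of a 2-cell and of its image under ΨΦ or ΦΨ, which are
the same. -/
theorem slide_nat {X Y : D} {x y : X ⟶ Y} {a b : x ⟶ y} (h : a = b) :
    a ▷ 𝟙 Y ≫ (slideIso y).hom = (slideIso x).hom ≫ 𝟙 X ◁ b := by
  simp [slideIso, h]

/-- Here, and in `slide_comp`, `a` and `b` are components of the constraints of 2-functors, hence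
identities; only unitor coherence is left. -/
theorem slide_id {X : D} {a b : 𝟙 X ⟶ 𝟙 X} (ha : a = 𝟙 _) (hb : b = 𝟙 _) :
    (slideIso (𝟙 X)).hom ≫ 𝟙 X ◁ b = a ▷ 𝟙 X ≫ (λ_ (𝟙 X)).hom ≫ (ρ_ (𝟙 X)).inv := by
  simp [slideIso, ha, hb, unitors_equal, unitors_inv_equal]

theorem slide_comp {X Y Z : D} {x : X ⟶ Y} {y : Y ⟶ Z} {a b : x ≫ y ⟶ x ≫ y} (ha : a = 𝟙 _)
    (hb : b = 𝟙 _) :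
    (slideIso (x ≫ y)).hom ≫ 𝟙 X ◁ b = a ▷ 𝟙 Z ≫ (α_ _ _ _).hom ≫ x ◁ (slideIso y).hom ≫
      (α_ _ _ _).inv ≫ (slideIso x).hom ▷ y ≫ (α_ _ _ _).hom := by
  subst ha hb
  simp only [slideIso, Iso.trans_hom, Iso.symm_hom]
  bicategory

/-- With `slide_counit`, this is the modification axiom for the isomorphisms exhibiting the two
transformations as inverse, read off at an object of `C`. -/
theorem slide_unit {X Y : D} (x : X ⟶ Y) :
    x ◁ (λ_ (𝟙 Y)).inv ≫ ((α_ _ _ _).inv ≫ (slideIso x).hom ▷ 𝟙 Y ≫ (α_ _ _ _).hom ≫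
        𝟙 X ◁ (slideIso x).hom ≫ (α_ _ _ _).inv) =
      ((ρ_ x).hom ≫ (λ_ x).inv) ≫ (λ_ (𝟙 X)).inv ▷ x := by
  simp only [slideIso, Iso.trans_hom, Iso.symm_hom]
  bicategory

theorem slide_counit {X Y : D} (x : X ⟶ Y) :
    x ◁ (λ_ (𝟙 Y)).hom ≫ ((ρ_ x).hom ≫ (λ_ x).inv) =
      ((α_ _ _ _).inv ≫ (slideIso x).hom ▷ 𝟙 Y ≫ (α_ _ _ _).hom ≫
        𝟙 X ◁ (slideIso x).hom ≫ (α_ _ _ _).inv) ≫ (λ_ (𝟙 X)).hom ▷ x := by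
  simp only [slideIso, Iso.trans_hom, Iso.symm_hom]
  bicategory

/-- Strictness makes both unitors transports along equalities; this is why the naturality
constraints lie over identities of `D^{Ob C}`. -/
theorem slide_hom [Bicategory.Strict D] {X Y : D} (x : X ⟶ Y) :
    (slideIso x).hom = eqToHom (by rw [Bicategory.Strict.comp_id, Bicategory.Strict.id_comp]) := by
  simp [slideIso, Bicategory.Strict.rightUnitor_eqToIso, Bicategory.Strict.leftUnitor_eqToIso]

/-- The bracket is `pathNat` on a path of length one. Apart from unitors it is the constraint `E` at
the edge, so the unitor comparison is natural in `F`. -/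
theorem counit_nat_coh {X Y X' Y' : D} {e : X ⟶ Y} {e' : X' ⟶ Y'} {x : X ⟶ X'} {y : Y ⟶ Y'}
    (E : e ≫ y ⟶ x ≫ e') :
    ((α_ _ _ _).hom ≫ 𝟙 X ◁ E ≫ (α_ _ _ _).inv ≫ ((λ_ x).hom ≫ (ρ_ x).inv) ▷ e' ≫
      (α_ _ _ _).hom) ≫ x ◁ (λ_ e').hom = (λ_ e).hom ▷ y ≫ E := by
  bicategory

end

variable {n : ℕ} {C : NFoldCat.{t} n} {D : Type u} [Bicategory.{w, v} D]

theorem app_eqToHom {F G : MixedPsFun C D} {μ ν : F ⟶ G} (h : μ = ν) (X : C.Obj) :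
    Modif.app (eqToHom h) X = eqToHom (by rw [h]) := by
  subst h; rfl

theorem _root_.PsFun.app_eqToHom {B : Type*} [Bicategory B] {H H' : B ⥤ᵖ D} {η θ : H ⟶ H'}
    (h : η = θ) (X : B) : (eqToHom h).as.app X = eqToHom (by rw [h]) := by
  subst h; rfl

/-- The naturality constraint of the counit. -/
def counitNat {F G : MixedPsFun C D} (μ : F ⟶ G) :
    (T.unit C).postcompMap (liftMap μ) ≫ G.counit ≅ F.counit ≫ μ :=
  mkIso (fun X => slideIso (Mor.app μ X)) fun f =>
    icon_modif (κ := λ_ (F.edge f)) (κ' := λ_ (G.edge f)) (counit_nat_coh (Mor.nat μ f).hom)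

/-- The naturality constraint of the inverse of the counit. -/
def counitInvNat {F G : MixedPsFun C D} (μ : F ⟶ G) :
    μ ≫ G.counitInv ≅ F.counitInv ≫ (T.unit C).postcompMap (liftMap μ) :=
  mkIso (fun X => slideIso (Mor.app μ X)) fun f =>
    icon_modif_symm (κ := λ_ (F.edge f)) (κ' := λ_ (G.edge f)) (counit_nat_coh (Mor.nat μ f).hom)

/-- The counit followed by its inverse is isomorphic to the identity. -/
def counitUnitIso (F : MixedPsFun C D) : 𝟙 F.unlift ≅ F.counit ≫ F.counitInv :=
  mkIso (fun X => (λ_ (𝟙 (F.obj X))).symm) fun f => icon_unit (λ_ (F.edge f))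

/-- The inverse of the counit followed by the counit is isomorphic to the identity. -/
def counitCounitIso (F : MixedPsFun C D) : F.counitInv ≫ F.counit ≅ 𝟙 F :=
  mkIso (fun X => λ_ (𝟙 (F.obj X))) fun f => icon_counit (λ_ (F.edge f))

/-- The naturality constraint of the unit. -/
def unitNat {H H' : T C ⥤ᵖ D} (η : H ⟶ H') :
    η ≫ unit H' ≅ unit H ≫ liftMap ((T.unit C).postcompMap η) :=
  Pseudofunctor.StrongTrans.isoMk (fun X => slideIso (η.app X)) fun p =>
    icon_modif (compare_nat η p)

/-- The naturality constraint of the inverse of the unit. -/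
def unitInvNat {H H' : T C ⥤ᵖ D} (η : H ⟶ H') :
    liftMap ((T.unit C).postcompMap η) ≫ unitInv H' ≅ unitInv H ≫ η :=
  Pseudofunctor.StrongTrans.isoMk (fun X => slideIso (η.app X)) fun p =>
    icon_modif_symm (compare_nat η p)

/-- The unit followed by its inverse is isomorphic to the identity. -/
def unitUnitIso (H : T C ⥤ᵖ D) : 𝟙 H ≅ unit H ≫ unitInv H :=
  Pseudofunctor.StrongTrans.isoMk (fun X => (λ_ (𝟙 (H.obj X))).symm) fun p =>
    icon_unit (compare H p)

/-- The inverse of the unit followed by the unit is isomorphic to the identity. -/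
def unitCounitIso (H : T C ⥤ᵖ D) : unitInv H ≫ unit H ≅ 𝟙 (restrict H).lift :=
  Pseudofunctor.StrongTrans.isoMk (fun X => λ_ (𝟙 (H.obj X))) fun p =>
    icon_counit (compare H p)

/-! ### The transformations between ΨΦ, ΦΨ and the identities, over `D^{Ob C}`. -/

variable (C D)
-- The constraints of a 2-functor are transports along equalities, and a transport of morphisms is
-- computed on components.
theorem mapId_app (K : StrictPseudofunctor (MixedPsFun C D) (MixedPsFun C D))
    (F : MixedPsFun C D) (X : C.Obj) :
    Modif.app (K.mapId F).hom X = eqToHom (by rw [K.map_id]) := by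
  rw [K.mapId_eq_eqToIso]
  exact app_eqToHom (K.map_id F) X

theorem _root_.PsFun.mapId_app (K : StrictPseudofunctor (T C ⥤ᵖ D) (T C ⥤ᵖ D))
    (H : T C ⥤ᵖ D) (X : T C) :
    (K.mapId H).hom.as.app X = eqToHom (by rw [K.map_id]) := by
  rw [K.mapId_eq_eqToIso]
  exact PsFun.app_eqToHom (K.map_id H) X

variable [Bicategory.Strict D]

theorem mapComp_app (K : StrictPseudofunctor (MixedPsFun C D) (MixedPsFun C D))
    {F G H : MixedPsFun C D} (μ : F ⟶ G) (ν : G ⟶ H) (X : C.Obj) :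
    Modif.app (K.mapComp μ ν).hom X = eqToHom (by rw [K.map_comp]) := by
  rw [K.mapComp_eq_eqToIso]
  exact app_eqToHom (K.map_comp μ ν) X

theorem _root_.PsFun.mapComp_app (K : StrictPseudofunctor (T C ⥤ᵖ D) (T C ⥤ᵖ D))
    {F G H : T C ⥤ᵖ D} (μ : F ⟶ G) (ν : G ⟶ H) (X : T C) :
    (K.mapComp μ ν).hom.as.app X = eqToHom (by rw [K.map_comp]) := by
  rw [K.mapComp_eq_eqToIso]
  exact PsFun.app_eqToHom (K.map_comp μ ν) X

/-- The transformation `ΨΦ ⇒ 1`. -/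
def counitTrans : ((Phi C D).comp (Psi C D)).functor.toPseudofunctor ⟶
    (OverFunctor.id (MixedPsFun.forget C D)).functor.toPseudofunctor where
  app F := F.counit
  naturality μ := counitNat μ
  naturality_naturality _ := hom_ext fun _ => slide_nat rfl
  -- ΨΦ preserves identities with the same components, so the transport given by `mapId_app` is at
  -- each object definitionally an identity.
  naturality_id F := hom_ext fun X => slide_id
    (mapId_app C D ((Phi C D).comp (Psi C D)).functor F X) rfl
  naturality_comp μ ν := hom_ext fun X => slide_comp
    (mapComp_app C D ((Phi C D).comp (Psi C D)).functor μ ν X) rfl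

/-- The transformation `1 ⇒ ΨΦ`. -/
def counitInvTrans : (OverFunctor.id (MixedPsFun.forget C D)).functor.toPseudofunctor ⟶
    ((Phi C D).comp (Psi C D)).functor.toPseudofunctor where
  app F := F.counitInv
  naturality μ := counitInvNat μ
  naturality_naturality _ := hom_ext fun _ => slide_nat rfl
  naturality_id F := hom_ext fun X => slide_id rfl
    (mapId_app C D ((Phi C D).comp (Psi C D)).functor F X)
  naturality_comp μ ν := hom_ext fun X => slide_comp rfl
    (mapComp_app C D ((Phi C D).comp (Psi C D)).functor μ ν X)

/-- The transformation `1 ⇒ ΦΨ`. -/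
def unitTrans : (OverFunctor.id (PsFun.forget C D)).functor.toPseudofunctor ⟶
    ((Psi C D).comp (Phi C D)).functor.toPseudofunctor where
  app H := unit H
  naturality η := unitNat η
  naturality_naturality _ := Pseudofunctor.StrongTrans.homCategory.ext fun _ => slide_nat rfl
  naturality_id H := Pseudofunctor.StrongTrans.homCategory.ext fun X => slide_id rfl
    (PsFun.mapId_app C D ((Psi C D).comp (Phi C D)).functor H X)
  naturality_comp μ ν := Pseudofunctor.StrongTrans.homCategory.ext fun X => slide_comp rfl
    (PsFun.mapComp_app C D ((Psi C D).comp (Phi C D)).functor μ ν X)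

/-- The transformation `ΦΨ ⇒ 1`. -/
def unitInvTrans : ((Psi C D).comp (Phi C D)).functor.toPseudofunctor ⟶
    (OverFunctor.id (PsFun.forget C D)).functor.toPseudofunctor where
  app H := unitInv H
  naturality η := unitInvNat η
  naturality_naturality _ := Pseudofunctor.StrongTrans.homCategory.ext fun _ => slide_nat rfl
  naturality_id H := Pseudofunctor.StrongTrans.homCategory.ext fun X => slide_id
    (PsFun.mapId_app C D ((Psi C D).comp (Phi C D)).functor H X) rfl
  naturality_comp μ ν := Pseudofunctor.StrongTrans.homCategory.ext fun X => slide_comp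
    (PsFun.mapComp_app C D ((Psi C D).comp (Phi C D)).functor μ ν X) rfl

/-- Forgetting to `D^{Ob C}` leaves the identity components of `counit` and the constraints
`slideIso`; the latter are identities by `slide_hom`. -/
theorem isOverNat_counit :
    IsOverNat (G := (Phi C D).comp (Psi C D)) (H := OverFunctor.id _) (counitTrans C D) where
  app _ := HEq.rfl
  naturality _ := PowCat.heq_id _ (fun _ => Bicategory.Strict.comp_id _)
    (fun _ => Bicategory.Strict.id_comp _)
    fun _ => slide_hom _

theorem isOverNat_counitInv :
    IsOverNat (G := OverFunctor.id _) (H := (Phi C D).comp (Psi C D)) (counitInvTrans C D) where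
  app _ := HEq.rfl
  naturality _ := PowCat.heq_id _ (fun _ => Bicategory.Strict.comp_id _)
    (fun _ => Bicategory.Strict.id_comp _)
    fun _ => slide_hom _

theorem isOverNat_unit :
    IsOverNat (G := OverFunctor.id _) (H := (Psi C D).comp (Phi C D)) (unitTrans C D) where
  app _ := HEq.rfl
  naturality _ := PowCat.heq_id _ (fun _ => Bicategory.Strict.comp_id _)
    (fun _ => Bicategory.Strict.id_comp _)
    fun _ => slide_hom _

theorem isOverNat_unitInv :
    IsOverNat (G := (Psi C D).comp (Phi C D)) (H := OverFunctor.id _) (unitInvTrans C D) where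
  app _ := HEq.rfl
  naturality _ := PowCat.heq_id _ (fun _ => Bicategory.Strict.comp_id _)
    (fun _ => Bicategory.Strict.id_comp _)
    fun _ => slide_hom _

/-- The two invertible modifications have components given by `𝟙 ≫ 𝟙 ≅ 𝟙`, an identity up to
equality of its ends because `D` is strict. -/
theorem isOverEquiv_counit :
    IsOverEquiv (G := (Phi C D).comp (Psi C D)) (H := OverFunctor.id _) (counitTrans C D) :=
  ⟨isOverNat_counit C D, counitInvTrans C D, isOverNat_counitInv C D,
    ⟨Pseudofunctor.StrongTrans.isoMk (fun F => counitUnitIso F)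
      fun μ => hom_ext fun X => slide_unit (Mor.app μ X),
      fun _ => PowCat.heq_id _ (fun _ => rfl) (fun _ => Bicategory.Strict.comp_id _) fun _ =>
        congrArg Iso.inv (Bicategory.Strict.leftUnitor_eqToIso _)⟩,
    ⟨Pseudofunctor.StrongTrans.isoMk (fun F => counitCounitIso F)
      fun μ => hom_ext fun X => slide_counit (Mor.app μ X),
      fun _ => PowCat.heq_id _ (fun _ => Bicategory.Strict.comp_id _) (fun _ => rfl) fun _ =>
        congrArg Iso.hom (Bicategory.Strict.leftUnitor_eqToIso _)⟩⟩

theorem isOverEquiv_unit :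
    IsOverEquiv (G := OverFunctor.id _) (H := (Psi C D).comp (Phi C D)) (unitTrans C D) :=
  ⟨isOverNat_unit C D, unitInvTrans C D, isOverNat_unitInv C D,
    ⟨Pseudofunctor.StrongTrans.isoMk (fun H => unitUnitIso H)
      fun η => Pseudofunctor.StrongTrans.homCategory.ext fun X => slide_unit (η.app X),
      fun _ => PowCat.heq_id _ (fun _ => rfl) (fun _ => Bicategory.Strict.comp_id _) fun _ =>
        congrArg Iso.inv (Bicategory.Strict.leftUnitor_eqToIso _)⟩,
    ⟨Pseudofunctor.StrongTrans.isoMk (fun H => unitCounitIso H)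
      fun η => Pseudofunctor.StrongTrans.homCategory.ext fun X => slide_counit (η.app X),
      fun _ => PowCat.heq_id _ (fun _ => Bicategory.Strict.comp_id _) (fun _ => rfl) fun _ =>
        congrArg Iso.hom (Bicategory.Strict.leftUnitor_eqToIso _)⟩⟩

end MixedPsFun

theorem propositionp {n : ℕ} (C : NFoldCat.{t} n) (D : Type u) [Bicategory.{w, v} D]
    [Bicategory.Strict D] : OverQuasiInverse (Phi C D) (Psi C D) :=
  -- `OverFunctor.comp` is in diagrammatic order, so `(Psi C D).comp (Phi C D)` is ΦΨ and
  -- `unitTrans` supplies the first equivalence.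
  ⟨⟨_, MixedPsFun.isOverEquiv_unit C D⟩, ⟨_, MixedPsFun.isOverEquiv_counit C D⟩⟩
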